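/- Notation. Let $\Gamma=\mathrm{SL}_2(\mathbb Z)$, $\Gamma_\infty=\{\pm\left(\begin{smallmatrix}1&n\\0&1\end{smallmatrix}\right):n\in\mathbb Z\}$, $j(\gamma,z)=cz+d$ for $\gamma=\left(\begin{smallmatrix}a&b\\c&d\end{smallmatrix}\right)\in\Gamma$, and $z=x+iy$ in the upper half plane $\mathbb H$. For $k\in 2\mathbb Z$ put $\theta_k(s)=\pi^{-s}\Gamma(s+|k|/2)\zeta(2s)$ and $$E_k(z,s)=\sum_{\gamma\in\Gamma_\infty\backslash\Gamma}\left(\frac{j(\gamma,z)}{|j(\gamma,z)|}\right)^{-k}\mathrm{Im}(\gamma z)^s\quad(\mathrm{Re}(s)>1),\qquad E_k^*(z,s)=\theta_k(s)E_k(z,s),$$ where $E_k^*(z,s)$ is extended by analytic continuation in $s$ to all of $\mathbb C$ if $k\ne0$, and to $\mathbb C\setminus\{0,1\}$ if $k=0$ (it then has simple poles at $0$ and $1$). For functions $f,g$ on $\mathbb H$ of holomorphic weight $k$ let $\langle f,g\rangle=\int_{\Gamma\backslash\mathbb H}y^kf(z)\overline{g(z)}\,\frac{dx\,dy}{y^2}$.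 Let $\sigma_w(n)=\sum_{d\mid n}d^w$. Proposition 9.1. Let $f(z)=\sum_{n\ge1}a_f(n)e^{2\pi inz}$ be a weight-$k$ cusp form for $\mathrm{SL}_2(\mathbb Z)$, and let $k_1,k_2\in2\mathbb Z$ satisfy $k_1+k_2=k$ and $k_2\ge0$. Let $u,v\in\mathbb C$ satisfy $$-\mathrm{Re}(u)-\frac k2+\frac12<\left|\mathrm{Re}(v)-\frac12\right|<\mathrm{Re}(u)-\frac{k_2}2-\frac72,$$ and suppose $v\notin\{0,1\}$ if $k_2=0$. Put $s=u-v+k/2$ and $w=u+v+k/2-1$. Then the integral and the series below converge absolutely, and $$\Big\langle f,\;y^{-k/2}E^*_{k_1}(\cdot,\overline u)E^*_{k_2}(\cdot,\overline v)\Big\rangle=\left[(-1)^{k_2/2}\,2\pi^{k/2}\,\zeta(2u)\,\frac{\Gamma(|k_1|/2+u)}{\Gamma(k_1/2+u)}\,\frac{\Gamma(s)\Gamma(w)}{(2\pi)^{s+w}}\right]\sum_{n=1}^\infty\frac{a_f(n)\,\sigma_{2v-1}(n)}{n^w}.$$ -/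

import Mathlib

open scoped MatrixGroups ComplexConjugate Modular
open UpperHalfPlane MeasureTheory

noncomputable section

namespace RankinEisenstein

/-- The subgroup `Γ_∞ = {± (1 n; 0 1) : n ∈ ℤ}` of `SL(2, ℤ)`. -/
def gammaInfty : Subgroup SL(2, ℤ) where
  carrier := {γ | ∃ n : ℤ, γ = ModularGroup.T ^ n ∨ γ = -ModularGroup.T ^ n}
  one_mem' := ⟨0, Or.inl (by simp)⟩
  mul_mem' := by
    rintro _ _ ⟨m, rfl | rfl⟩ ⟨n, rfl | rfl⟩
    · exact ⟨m + n, Or.inl (by rw [zpow_add])⟩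
    · exact ⟨m + n, Or.inr (by rw [zpow_add, mul_neg])⟩
    · exact ⟨m + n, Or.inr (by rw [zpow_add, neg_mul])⟩
    · exact ⟨m + n, Or.inl (by rw [zpow_add, neg_mul_neg])⟩
  inv_mem' := by
    rintro _ ⟨m, rfl | rfl⟩
    · exact ⟨-m, Or.inl (by rw [zpow_neg])⟩
    · refine ⟨-m, Or.inr ?_⟩
      rw [inv_eq_iff_mul_eq_one, neg_mul_neg, zpow_neg, mul_inv_cancel]

/-- The automorphy factor `j(γ, z) = c z + d` for `γ = (a b; c d)`. -/
def autFactor (γ : SL(2, ℤ)) (z : ℍ) : ℂ := (γ 1 0 : ℂ) * (z : ℂ) + (γ 1 1 : ℂ)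

/-- The term `(j(γ, z) / |j(γ, z)|) ^ (-k) * Im(γ z) ^ s` of the Eisenstein series. -/
def eisensteinTerm (k : ℤ) (z : ℍ) (s : ℂ) (γ : SL(2, ℤ)) : ℂ :=
  (autFactor γ z / (‖autFactor γ z‖ : ℂ)) ^ (-k) * (((γ • z).im : ℝ) : ℂ) ^ s

/-- The non-holomorphic Eisenstein series of weight `k`,
`E_k(z, s) = ∑_{γ ∈ Γ_∞ \ SL(2, ℤ)} (j(γ, z) / |j(γ, z)|) ^ (-k) Im(γ z) ^ s`, for `Re s > 1`.
For even `k` the terms do not depend on the chosen representatives, see `eisensteinTerm_congr`. -/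
def eisensteinSeries (k : ℤ) (z : ℍ) (s : ℂ) : ℂ :=
  ∑' q : Quotient (QuotientGroup.rightRel gammaInfty), eisensteinTerm k z s q.out

/-- `θ_k(s) = π ^ (-s) Γ(s + |k| / 2) ζ(2 s)`. -/
def theta (k : ℤ) (s : ℂ) : ℂ :=
  (Real.pi : ℂ) ^ (-s) * Complex.Gamma (s + ((|k| : ℤ) : ℂ) / 2) * riemannZeta (2 * s)

/-- The domain of `s ↦ E*_k(z, s)`: everything if `k ≠ 0`; for `k = 0` the two simple poles
`s = 0` and `s = 1` are removed. -/
def eisensteinDomain (k : ℤ) : Set ℂ := {s | k = 0 → s ≠ 0 ∧ s ≠ 1}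

/-- `F` is the analytic continuation in `s` of `θ_k(s) E_k(z, s)` from `Re s > 1` to
`eisensteinDomain k`. It is unique there, see `IsContinuation.eqOn`. -/
def IsContinuation (k : ℤ) (z : ℍ) (F : ℂ → ℂ) : Prop :=
  DifferentiableOn ℂ F (eisensteinDomain k) ∧
    ∀ s : ℂ, 1 < s.re → F s = theta k s * eisensteinSeries k z s

open Classical in
/-- The completed non-holomorphic Eisenstein series `E*_k(z, s)`: the analytic continuation in `s`
of `θ_k(s) E_k(z, s)`. Only its values for `s ∈ eisensteinDomain k` are meaningful. -/
def completedEisenstein (k : ℤ) (z : ℍ) (s : ℂ) : ℂ :=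
  if h : ∃ F : ℂ → ℂ, IsContinuation k z F then h.choose s else 0

/-- The divisor power function `σ_w(n) = ∑_{d ∣ n} d ^ w` with complex exponent. -/
def divisorSum (w : ℂ) (n : ℕ) : ℂ := ∑ d ∈ n.divisors, (d : ℂ) ^ w

/-- The integrand `y ^ k f(z) conj(g(z))` of the Petersson inner product in weight `k`. -/
def peterssonIntegrand (k : ℤ) (f g : ℍ → ℂ) (z : ℍ) : ℂ :=
  (z.im : ℂ) ^ k * f z * conj (g z)

/-- The Petersson inner product `⟨f, g⟩ = ∫_{SL(2, ℤ) \ ℍ} y ^ k f(z) conj(g(z)) dx dy / y ^ 2`,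
computed on the standard fundamental domain; `volume` on `ℍ` is the measure `dx dy / y ^ 2`. -/
def peterssonInner (k : ℤ) (f g : ℍ → ℂ) : ℂ :=
  ∫ z in 𝒟, peterssonIntegrand k f g z

/-- The function `y ^ (-k / 2) E*_{k₁}(z, s) E*_{k₂}(z, t)` of holomorphic weight `k = k₁ + k₂`. -/
def eisensteinProduct (k₁ k₂ : ℤ) (s t : ℂ) (z : ℍ) : ℂ :=
  (z.im : ℂ) ^ (-(((k₁ + k₂ : ℤ) : ℂ) / 2)) *
    completedEisenstein k₁ z s * completedEisenstein k₂ z t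

theorem eisensteinTerm_congr {k : ℤ} (hk : Even k) (z : ℍ) (s : ℂ) {γ δ : SL(2, ℤ)}
    (h : QuotientGroup.rightRel gammaInfty γ δ) :
    eisensteinTerm k z s γ = eisensteinTerm k z s δ := by
  rw [QuotientGroup.rightRel_apply] at h
  obtain ⟨n, hn⟩ := h
  have key : (δ = ModularGroup.T ^ n * γ) ∨ (δ = -(ModularGroup.T ^ n * γ)) := by
    rcases hn with hn | hn
    · exact Or.inl (by rw [← hn]; group)
    · refine Or.inr ?_
      rw [← neg_mul, ← hn]; group
  have h10 : (ModularGroup.T ^ n * γ) 1 0 = γ 1 0 := by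
    simp
  have h11 : (ModularGroup.T ^ n * γ) 1 1 = γ 1 1 := by
    simp
  have him : ((ModularGroup.T ^ n * γ) • z).im = (γ • z).im := by
    rw [mul_smul, ModularGroup.im_T_zpow_smul]
  have hj : autFactor (ModularGroup.T ^ n * γ) z = autFactor γ z := by
    simp only [autFactor, h10, h11]
  rcases key with rfl | rfl
  · simp only [eisensteinTerm, hj, him]
  · have hj' : autFactor (-(ModularGroup.T ^ n * γ)) z = -autFactor γ z := by
      rw [← hj]
      simp only [autFactor, Matrix.SpecialLinearGroup.coe_neg, Matrix.neg_apply]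
      push_cast
      ring
    simp only [eisensteinTerm, hj', ModularGroup.SL_neg_smul, him, norm_neg, neg_div]
    rw [hk.neg.neg_zpow]

theorem IsContinuation.eqOn {k : ℤ} {z : ℍ} {F G : ℂ → ℂ} (hF : IsContinuation k z F)
    (hG : IsContinuation k z G) : Set.EqOn F G (eisensteinDomain k) := by
  have hU : eisensteinDomain k = Set.univ ∨ eisensteinDomain k = ({0, 1} : Set ℂ)ᶜ := by
    by_cases hk : k = 0
    · right; ext s; simp [eisensteinDomain, hk]
    · left; ext s; simp [eisensteinDomain, hk]
  have hc : (({0, 1} : Set ℂ)).Countable := (Set.toFinite _).countable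
  have hopen : IsOpen (eisensteinDomain k) := by
    rcases hU with h | h <;> rw [h]
    · exact isOpen_univ
    · exact (Set.toFinite _).isClosed.isOpen_compl
  have hconn : IsPreconnected (eisensteinDomain k) := by
    rcases hU with h | h <;> rw [h]
    · exact isPreconnected_univ
    · refine (hc.isConnected_compl_of_one_lt_rank ?_).isPreconnected
      simp
  have h2 : (2 : ℂ) ∈ eisensteinDomain k := fun _ => by norm_num
  refine (hF.1.analyticOnNhd hopen).eqOn_of_preconnected_of_eventuallyEq
    (hG.1.analyticOnNhd hopen) hconn h2 ?_
  have : {s : ℂ | 1 < s.re} ∈ nhds (2 : ℂ) :=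
    (isOpen_lt continuous_const Complex.continuous_re).mem_nhds (by simp)
  filter_upwards [this] with s hs
  rw [hF.2 s hs, hG.2 s hs]

end RankinEisenstein

end

noncomputable section

namespace RankinEisenstein

/-! The proof is a Rankin–Selberg unfolding in a region of absolute convergence, followed by
analytic continuation in `v` with `u` fixed. Write `k₂ = 2m`, and let `ω = cz + d` run over the
lattice.

Continuation of `E*`. Up to the factor `2ζ(2s)`, the Eisenstein series is a sum over all nonzero
lattice points (`latticeSum_eq`). In weight `2m ≥ 0` this sum is a Mellin transform of the theta
series `∑ conj ω ^ (2m) exp(-πt|ω|²/y)`. The transformation `t ↦ 1/t` is proved for all exponents at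
once: Poisson summation in one coordinate of the generating function in `X` gives a double series
that is symmetric under exchange of its indices, and one then compares coefficients of `X ^ n`
(`thetaSeries_functional_equation`). Riemann's splitting at `t = 1` (`mellin_eq_tailMellin_add`)
gives the continuation and also polynomial growth on `𝒟`; negative weights follow by complex
conjugation.

The identity for `m + 1 < Re v < Re u - 2`. Unfolding `E_{k₁}` turns the inner product into an
integral over a strip of width one of `f(z) y ^ (k/2+u)` times the second lattice sum. No Fourier
expansion of the Eisenstein series is used. Instead `f` is expanded, and each row `c ≠ 0` of the
lattice is unfolded again: writing `j = qc + r`, the sum over `q` turns strip integrals into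
integrals over `ℍ`, an affine substitution removes `c` and `r`, and the character sum over `r` is
nonzero only for `c ∣ l`. This produces the divisor sums (`tsum_integral_latticeWave_all`) times a
single archimedean integral. That integral (`archIntegral_eq`) is computed by writing `(ω/|ω|) ^
(2m) |ω| ^ (-2v)` as a product of powers of `y ± ix`, moving it to the Fourier side, and applying
the gamma and beta integrals.

Continuation in `v`. The rapid decay of `f` beats the polynomial growth of the theta integrals, so
after removal of the poles at `0, 1` for `m = 0` the inner product is entire in `v`. The Dirichlet
series is holomorphic for `|Re v - 1/2| < Re u - 5/2`, and the identity theorem concludes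
(`peterssonInner_eq`). This argument takes `k ≥ 0`; for `k < 0` there are no nonzero cusp forms. -/

open scoped Pointwise FourierTransform

/-! ### Theta series of the lattice and their functional equation -/

/-- The lattice point `x₀ z + x₁`. -/
def latticePoint (z : ℍ) (x : Fin 2 → ℤ) : ℂ := (x 0 : ℂ) * (z : ℂ) + (x 1 : ℂ)

lemma latticePoint_re (z : ℍ) (x : Fin 2 → ℤ) : (latticePoint z x).re = x 0 * z.re + x 1 := by
  simp [latticePoint]

lemma latticePoint_im (z : ℍ) (x : Fin 2 → ℤ) : (latticePoint z x).im = x 0 * z.im := by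
  simp [latticePoint]

lemma latticePoint_zero (z : ℍ) : latticePoint z 0 = 0 := by simp [latticePoint]

lemma latticePoint_ne_zero (z : ℍ) {x : Fin 2 → ℤ} (hx : x ≠ 0) : latticePoint z x ≠ 0 := by
  intro h
  have h2 := EisensteinSeries.r_mul_max_le z hx
  rw [show (x 0 : ℂ) * (z : ℂ) + (x 1 : ℂ) = 0 from h, norm_zero] at h2
  have h3 : 0 < EisensteinSeries.r z * ‖x‖ :=
    mul_pos (EisensteinSeries.r_pos z) (norm_pos_iff.mpr hx)
  linarith

lemma summable_norm_latticePoint_rpow (z : ℍ) {k : ℝ} (hk : 2 < k) :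
    Summable fun x : Fin 2 → ℤ => ‖latticePoint z x‖ ^ (-k) :=
  Summable.of_nonneg_of_le (fun _ => by positivity)
    (fun x => EisensteinSeries.summand_bound z (by linarith : (0 : ℝ) ≤ k) x)
    ((EisensteinSeries.summable_one_div_norm_rpow hk).mul_left _)

/-- Completing the square absorbs the linear term at the cost of half the quadratic decay. The
remaining Gaussian is compared with `‖ω‖ ^ (-4)`, which is summable because `4 > 2`. -/
lemma summable_exp_latticePoint (z : ℍ) {a : ℝ} (ha : 0 < a) (b : ℝ) :
    Summable fun x : Fin 2 → ℤ =>
      Real.exp (-a * ‖latticePoint z x‖ ^ 2 + b * ‖latticePoint z x‖) := by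
  have hs := ((summable_norm_latticePoint_rpow z (by norm_num : (2 : ℝ) < 4)).mul_left
    (Real.exp (b ^ 2 / (2 * a)) * (8 / a ^ 2)))
  refine Summable.of_norm_bounded_eventually hs ?_
  have : {(0 : Fin 2 → ℤ)}ᶜ ∈ Filter.cofinite := by simp
  filter_upwards [this] with x hx
  have hpos : 0 < ‖latticePoint z x‖ := norm_pos_iff.mpr (latticePoint_ne_zero z hx)
  set r := ‖latticePoint z x‖
  rw [Real.norm_of_nonneg (Real.exp_pos _).le]
  have h1 : -a * r ^ 2 + b * r ≤ b ^ 2 / (2 * a) - a / 2 * r ^ 2 := by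
    have : 0 ≤ (a * r - b) ^ 2 / (2 * a) := by positivity
    have h2 : (a * r - b) ^ 2 / (2 * a) = a / 2 * r ^ 2 - b * r + b ^ 2 / (2 * a) := by
      field_simp
      ring
    linarith
  calc Real.exp (-a * r ^ 2 + b * r) ≤ Real.exp (b ^ 2 / (2 * a) - a / 2 * r ^ 2) :=
        Real.exp_le_exp.mpr h1
    _ = Real.exp (b ^ 2 / (2 * a)) * (Real.exp (a / 2 * r ^ 2))⁻¹ := by
        rw [sub_eq_add_neg, Real.exp_add, Real.exp_neg]
    _ ≤ Real.exp (b ^ 2 / (2 * a)) * ((a / 2 * r ^ 2) ^ 2 / 2)⁻¹ := by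
        gcongr
        have := Real.quadratic_le_exp_of_nonneg (by positivity : 0 ≤ a / 2 * r ^ 2)
        nlinarith [show 0 ≤ a / 2 * r ^ 2 by positivity]
    _ = _ := by
        rw [Real.rpow_neg hpos.le]
        norm_cast
        field_simp
        ring

/-- The generating function of the theta series, in the variable `X`. -/
def thetaGen (z : ℍ) (t : ℝ) (X : ℂ) : ℂ :=
  ∑' x : Fin 2 → ℤ, Complex.exp (-(Real.pi * t / z.im * ‖latticePoint z x‖ ^ 2 : ℝ) +
    X * conj (latticePoint z x))

lemma summable_thetaGen (z : ℍ) {t : ℝ} (ht : 0 < t) (X : ℂ) :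
    Summable fun x : Fin 2 → ℤ => Complex.exp
      (-(Real.pi * t / z.im * ‖latticePoint z x‖ ^ 2 : ℝ) + X * conj (latticePoint z x)) := by
  refine Summable.of_norm_bounded (summable_exp_latticePoint z
    (a := Real.pi * t / z.im) (by have := z.im_pos; positivity) ‖X‖) fun x => ?_
  rw [Complex.norm_exp]
  apply Real.exp_le_exp.mpr
  rw [Complex.add_re, Complex.neg_re, Complex.ofReal_re, neg_mul]
  gcongr
  calc _ ≤ ‖X * conj (latticePoint z x)‖ := Complex.re_le_norm _
    _ = _ := by simp

/-- The summand after Poisson summation in the second coordinate. -/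
def thetaDual (z : ℍ) (t : ℝ) (X : ℂ) (m n : ℤ) : ℂ :=
  Complex.exp (-Real.pi * t * z.im * m ^ 2 - Real.pi * (z.im / t) * n ^ 2
    - Complex.I * X * z.im * (m + n / t) + z.im * X ^ 2 / (4 * Real.pi * t)
    + 2 * Real.pi * Complex.I * m * n * z.re)

/-- This symmetry carries the whole functional equation: inverting `t` only exchanges the original
index with the dual one. -/
lemma thetaDual_symm (z : ℍ) {t : ℝ} (ht : 0 < t) (X : ℂ) (m n : ℤ) :
    thetaDual z t⁻¹ (-X / t) m n = thetaDual z t X (-n) (-m) := by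
  unfold thetaDual
  congr 1
  have : (t : ℂ) ≠ 0 := by exact_mod_cast ht.ne'
  have : (Real.pi : ℂ) ≠ 0 := by exact_mod_cast Real.pi_ne_zero
  push_cast
  field_simp
  ring

lemma summable_thetaDual (z : ℍ) {t : ℝ} (ht : 0 < t) (X : ℂ) :
    Summable (Function.uncurry (thetaDual z t X)) := by
  rw [← (finTwoArrowEquiv ℤ).summable_iff]
  -- For the lattice of `ti` the squared norm is `(tm)² + n²`, which is the quadratic form in the
  -- exponent up to the scale `πy/t`.
  let z' : ℍ := ⟨t * Complex.I, by simpa using ht⟩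
  have hy := z.im_pos
  have hs := (summable_exp_latticePoint z' (a := Real.pi * z.im / t) (by positivity)
    (‖X‖ * z.im * (1 / t + 1 / t))).mul_left (Real.exp ((z.im * X ^ 2 / (4 * Real.pi * t) : ℂ).re))
  refine Summable.of_norm_bounded hs fun x => ?_
  have h1 : ‖latticePoint z' x‖ ^ 2 = (x 0 * t) ^ 2 + (x 1) ^ 2 := by
    rw [← Complex.normSq_eq_norm_sq, Complex.normSq_apply]
    simp [latticePoint, z']
    ring
  have h2 : ‖((x 0 : ℂ) + (x 1 : ℂ) / t)‖ ≤ ‖latticePoint z' x‖ * (1 / t + 1 / t)  := by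
    have e0 : |(x 0 : ℝ) * t| ≤ ‖latticePoint z' x‖ := by
      apply abs_le_of_sq_le_sq _ (norm_nonneg _)
      rw [h1]; nlinarith [sq_nonneg (x 1 : ℝ)]
    have e1 : |(x 1 : ℝ)| ≤ ‖latticePoint z' x‖ := by
      apply abs_le_of_sq_le_sq _ (norm_nonneg _)
      rw [h1]; nlinarith [sq_nonneg ((x 0 : ℝ) * t)]
    have : ((x 0 : ℂ) + (x 1 : ℂ) / t) = (((x 0 * t) * (1 / t) + x 1 * (1 / t) : ℝ) : ℂ) := by
      push_cast
      have : (t : ℂ) ≠ 0 := by exact_mod_cast ht.ne'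
      field_simp
    rw [this, Complex.norm_real, Real.norm_eq_abs, mul_add]
    refine (abs_add_le _ _).trans ?_
    rw [abs_mul _ (1 / t), abs_mul _ (1 / t), abs_of_pos (by positivity : 0 < 1 / t)]
    gcongr
  rw [← Real.exp_add, Function.comp_apply]
  change ‖thetaDual z t X (x 0) (x 1)‖ ≤ _
  rw [thetaDual, Complex.norm_exp]
  apply Real.exp_le_exp.mpr
  have e : (-Real.pi * t * z.im * (x 0 : ℂ) ^ 2 - Real.pi * (z.im / t) * (x 1 : ℂ) ^ 2
    - Complex.I * X * z.im * (x 0 + x 1 / t) + z.im * X ^ 2 / (4 * Real.pi * t)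
    + 2 * Real.pi * Complex.I * x 0 * x 1 * z.re : ℂ) =
    ((-(Real.pi * z.im / t) * ((x 0 * t) ^ 2 + (x 1) ^ 2) : ℝ) : ℂ)
      + z.im * X ^ 2 / (4 * Real.pi * t) + -(Complex.I * X * z.im * (x 0 + x 1 / t))
      + ((2 * Real.pi * x 0 * x 1 * z.re : ℝ) : ℂ) * Complex.I := by
    have : (t : ℂ) ≠ 0 := by exact_mod_cast ht.ne'
    push_cast
    field_simp
    ring
  rw [e, Complex.add_re, Complex.add_re, Complex.add_re, Complex.re_ofReal_mul, Complex.I_re,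
    Complex.ofReal_re, h1, mul_zero, add_zero]
  have h3 : (-(Complex.I * X * z.im * (x 0 + x 1 / t))).re ≤
      ‖X‖ * z.im * (1 / t + 1 / t) * ‖latticePoint z' x‖ := by
    refine (Complex.re_le_norm _).trans ?_
    rw [norm_neg, norm_mul, norm_mul, norm_mul, Complex.norm_I, one_mul, Complex.norm_real,
      Real.norm_of_nonneg hy.le]
    calc _ ≤ ‖X‖ * z.im * (‖latticePoint z' x‖ * (1 / t + 1 / t)) := by gcongr
      _ = _ := by ring
  linarith

/-- For fixed first coordinate the sum over the second is a one-dimensional Gaussian sum with a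
linear term, so one-dimensional Poisson summation applies. -/
lemma thetaGen_eq (z : ℍ) {t : ℝ} (ht : 0 < t) (X : ℂ) :
    thetaGen z t X = ((z.im / t : ℝ) : ℂ) ^ (1 / 2 : ℂ) *
      ∑' (m : ℤ) (n : ℤ), thetaDual z t X m n := by
  have hy := z.im_pos
  have htc : (t : ℂ) ≠ 0 := by exact_mod_cast ht.ne'
  have hyc : (z.im : ℂ) ≠ 0 := by exact_mod_cast hy.ne'
  have hpi : (Real.pi : ℂ) ≠ 0 := by exact_mod_cast Real.pi_ne_zero
  have hs := summable_thetaGen z ht X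
  rw [thetaGen, ← (finTwoArrowEquiv ℤ).symm.tsum_eq]
  refine (Summable.tsum_prod ((finTwoArrowEquiv ℤ).symm.summable_iff.mpr hs)).trans ?_
  rw [← tsum_mul_left]
  refine tsum_congr fun m => ?_
  simp only [Function.comp_apply]
  have h1 : ∀ n : ℤ, Complex.exp (-(Real.pi * t / z.im *
        ‖latticePoint z ((finTwoArrowEquiv ℤ).symm (m, n))‖ ^ 2 : ℝ) +
        X * conj (latticePoint z ((finTwoArrowEquiv ℤ).symm (m, n)))) =
      Complex.exp (-(Real.pi * t / z.im * m ^ 2 * (z.re ^ 2 + z.im ^ 2) : ℝ) +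
        X * m * (z.re - z.im * Complex.I)) *
      Complex.exp (-Real.pi * ((t / z.im : ℝ) : ℂ) * n ^ 2 +
        2 * Real.pi * (-t * m * z.re / z.im + X / (2 * Real.pi)) * n) := by
    intro n
    rw [← Complex.exp_add]
    congr 1
    have e1 : conj (latticePoint z ((finTwoArrowEquiv ℤ).symm (m, n))) =
        m * (z.re - z.im * Complex.I) + n := by
      apply Complex.ext <;> simp [latticePoint]
    have e2 : ‖latticePoint z ((finTwoArrowEquiv ℤ).symm (m, n))‖ ^ 2 =
        (m * z.re + n) ^ 2 + (m * z.im) ^ 2 := by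
      rw [← Complex.normSq_eq_norm_sq, Complex.normSq_apply, latticePoint_re, latticePoint_im]
      simp
      ring
    rw [e1, e2]
    push_cast
    field_simp
    ring
  simp_rw [h1]
  rw [tsum_mul_left, Complex.tsum_exp_neg_quadratic
    (by rw [Complex.ofReal_re]; positivity), ← mul_assoc, mul_comm (Complex.exp _), mul_assoc,
    ← tsum_mul_left]
  have h2 : 1 / ((t / z.im : ℝ) : ℂ) ^ (1 / 2 : ℂ) = ((z.im / t : ℝ) : ℂ) ^ (1 / 2 : ℂ) := by
    rw [one_div, ← Complex.inv_cpow, ← Complex.ofReal_inv, inv_div]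
    rw [Complex.arg_ofReal_of_nonneg (by positivity)]
    exact Real.pi_pos.ne
  rw [h2]
  congr 1
  refine tsum_congr fun n => ?_
  rw [← Complex.exp_add, thetaDual]
  congr 1
  push_cast
  field_simp
  ring_nf
  simp only [Complex.I_sq]
  ring

lemma thetaGen_functional_equation (z : ℍ) {t : ℝ} (ht : 0 < t) (X : ℂ) :
    thetaGen z t⁻¹ (-X / t) = t * thetaGen z t X := by
  rw [thetaGen_eq z ht, thetaGen_eq z (inv_pos.mpr ht)]
  have hy := z.im_pos
  have h1 : ∑' (m : ℤ) (n : ℤ), thetaDual z t⁻¹ (-X / t) m n =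
      ∑' (m : ℤ) (n : ℤ), thetaDual z t X m n := by
    simp_rw [thetaDual_symm z ht]
    rw [← (summable_thetaDual z ht X).tsum_comm, ← (Equiv.neg ℤ).tsum_eq]
    refine tsum_congr fun m => ?_
    rw [← (Equiv.neg ℤ).tsum_eq]
    simp
  rw [h1, ← mul_assoc]
  congr 1
  rw [div_inv_eq_mul, show (z.im * t : ℝ) = t ^ 2 * (z.im / t) by field_simp,
    Complex.ofReal_mul, Complex.mul_cpow_ofReal_nonneg (by positivity) (by positivity)]
  congr 1
  rw [show (1 / 2 : ℂ) = ((1 / 2 : ℝ) : ℂ) by norm_num, ← Complex.ofReal_cpow (by positivity),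
    ← Real.sqrt_eq_rpow, Real.sqrt_sq ht.le]

/-- The theta series attached to the harmonic polynomial `conj ω ^ n`. -/
def thetaSeries (n : ℕ) (z : ℍ) (t : ℝ) : ℂ :=
  ∑' x : Fin 2 → ℤ, conj (latticePoint z x) ^ n *
    Real.exp (-(Real.pi * t / z.im * ‖latticePoint z x‖ ^ 2))

/-- The majorant that permits exchanging the lattice sum with the power series of `exp (X * conj
ω)`. -/
lemma summable_thetaSeries_exp (z : ℍ) {t : ℝ} (ht : 0 < t) (b : ℝ) :
    Summable fun p : (Fin 2 → ℤ) × ℕ => (b ^ p.2 / p.2.factorial) * ‖latticePoint z p.1‖ ^ p.2 *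
      Real.exp (-(Real.pi * t / z.im * ‖latticePoint z p.1‖ ^ 2)) := by
  wlog hb : 0 ≤ b generalizing b
  · refine Summable.of_norm_bounded (this |b| (abs_nonneg _)) fun p => ?_
    simp
  have hexp : ∀ x : Fin 2 → ℤ, HasSum (fun n : ℕ => (b ^ n / n.factorial) *
      ‖latticePoint z x‖ ^ n * Real.exp (-(Real.pi * t / z.im * ‖latticePoint z x‖ ^ 2)))
      (Real.exp (b * ‖latticePoint z x‖) *
        Real.exp (-(Real.pi * t / z.im * ‖latticePoint z x‖ ^ 2))) := by
    intro x
    have := (NormedSpace.expSeries_div_hasSum_exp (𝔸 := ℝ) (b * ‖latticePoint z x‖)).mul_right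
      (Real.exp (-(Real.pi * t / z.im * ‖latticePoint z x‖ ^ 2)))
    rw [← Real.exp_eq_exp_ℝ] at this
    refine this.congr_fun ?_
    intro n
    simp only [mul_pow]
    ring
  rw [summable_prod_of_nonneg (fun p => by positivity)]
  refine ⟨fun x => (hexp x).summable, ?_⟩
  simp_rw [fun x => (hexp x).tsum_eq, ← Real.exp_add]
  convert summable_exp_latticePoint z (a := Real.pi * t / z.im)
    (by have := z.im_pos; positivity) b using 3
  ring

lemma summable_thetaSeries (n : ℕ) (z : ℍ) {t : ℝ} (ht : 0 < t) :
    Summable fun x : Fin 2 → ℤ => conj (latticePoint z x) ^ n *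
      (Real.exp (-(Real.pi * t / z.im * ‖latticePoint z x‖ ^ 2)) : ℂ) := by
  have := ((summable_thetaSeries_exp z ht 1).comp_injective
    (i := fun x : Fin 2 → ℤ => (x, n)) (fun x y h => (Prod.mk.inj h).1)).mul_left
    (n.factorial : ℝ)
  refine Summable.of_norm_bounded this fun x => le_of_eq ?_
  have : (n.factorial : ℝ) ≠ 0 := by positivity
  rw [norm_mul, norm_pow, RCLike.norm_conj, Complex.norm_real, Real.norm_of_nonneg
    (Real.exp_pos _).le]
  simp only [Function.comp_apply, one_pow]
  field_simp

lemma hasSum_thetaGen (z : ℍ) {t : ℝ} (ht : 0 < t) (X : ℂ) :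
    HasSum (fun n : ℕ => thetaSeries n z t / n.factorial * X ^ n) (thetaGen z t X) := by
  let g : (Fin 2 → ℤ) × ℕ → ℂ := fun p => (X ^ p.2 / p.2.factorial) *
    conj (latticePoint z p.1) ^ p.2 *
      (Real.exp (-(Real.pi * t / z.im * ‖latticePoint z p.1‖ ^ 2)) : ℂ)
  have hg : Summable g := by
    refine Summable.of_norm_bounded (summable_thetaSeries_exp z ht ‖X‖) fun p => le_of_eq ?_
    rw [norm_mul, norm_mul, norm_div, norm_pow, norm_pow, RCLike.norm_conj, Complex.norm_natCast,
      Complex.norm_real, Real.norm_of_nonneg (Real.exp_pos _).le]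
  have h1 : HasSum g (thetaGen z t X) := by
    convert hg.hasSum using 1
    rw [hg.tsum_prod, thetaGen]
    refine tsum_congr fun x => ?_
    have := (NormedSpace.expSeries_div_hasSum_exp (𝔸 := ℂ)
      (X * conj (latticePoint z x))).mul_right
      (Real.exp (-(Real.pi * t / z.im * ‖latticePoint z x‖ ^ 2)) : ℂ)
    rw [← Complex.exp_eq_exp_ℂ] at this
    rw [add_comm, Complex.exp_add, ← Complex.ofReal_neg, ← Complex.ofReal_exp, ← this.tsum_eq]
    refine tsum_congr fun n => ?_
    simp only [g, mul_pow]
    ring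
  have h2 : HasSum (fun p : ℕ × (Fin 2 → ℤ) => g (p.2, p.1)) (thetaGen z t X) :=
    (Equiv.prodComm _ _).hasSum_iff.mpr h1
  refine h2.prod_fiberwise fun n => ?_
  have h3 := (summable_thetaSeries n z ht).hasSum.mul_left (X ^ n / n.factorial)
  have h4 : thetaSeries n z t / n.factorial * X ^ n = X ^ n / n.factorial * thetaSeries n z t := by
    ring
  rw [h4]
  refine h3.congr_fun fun x => ?_
  simp only [g]
  ring

/-- The coefficients of an everywhere convergent power series are determined by its sum. -/
lemma coeff_unique_of_hasSum {c d : ℕ → ℂ} {F : ℂ → ℂ}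
    (hc : ∀ X, HasSum (fun n => c n * X ^ n) (F X))
    (hd : ∀ X, HasSum (fun n => d n * X ^ n) (F X)) : c = d := by
  have key : ∀ e : ℕ → ℂ, (∀ X, HasSum (fun n => e n * X ^ n) (F X)) →
      HasFPowerSeriesAt F (FormalMultilinearSeries.ofScalars ℂ e) 0 := by
    intro e he
    refine ⟨1, ?_, one_pos, ?_⟩
    · have := (he 1).summable.norm
      refine FormalMultilinearSeries.le_radius_of_summable _ (r := 1) ?_
      refine Summable.of_nonneg_of_le (fun _ => by positivity) (fun n => ?_) this
      simp
    · intro y _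
      simpa [FormalMultilinearSeries.ofScalars_apply_eq, zero_add] using! (he y).congr_fun fun n => by simp [mul_comm]
  have := (key c hc).eq_formalMultilinearSeries (key d hd)
  exact (FormalMultilinearSeries.ofScalars_series_injective ℂ ℂ) this

/-- Both sides of the functional equation of `thetaGen` are power series in `X`. Comparing
coefficients leaves a factor `(-1/t) ^ n`, whose sign disappears for even `n`. -/
lemma thetaSeries_functional_equation {n : ℕ} (hn : Even n) (z : ℍ) {t : ℝ} (ht : 0 < t) :
    thetaSeries n z t⁻¹ = (t : ℂ) ^ (n + 1) * thetaSeries n z t := by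
  have htc : (t : ℂ) ≠ 0 := by exact_mod_cast ht.ne'
  have h := coeff_unique_of_hasSum (F := fun X => t * thetaGen z t X)
    (c := fun n => thetaSeries n z t⁻¹ / n.factorial * (-1 / t) ^ n)
    (d := fun n => t * (thetaSeries n z t / n.factorial)) ?_ ?_
  · have := congrFun h n
    simp only [div_pow, hn.neg_one_pow] at this
    have h2 : (n.factorial : ℂ) ≠ 0 := by exact_mod_cast n.factorial_ne_zero
    have h3 : (t : ℂ) ^ n ≠ 0 := pow_ne_zero _ htc
    rw [div_mul_div_comm, mul_one, div_eq_iff (mul_ne_zero h2 h3)] at this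
    rw [this]
    field_simp
    ring
  · intro X
    have := hasSum_thetaGen z (inv_pos.mpr ht) (-X / t)
    rw [thetaGen_functional_equation z ht] at this
    convert this using 2 with n
    rw [mul_assoc, ← mul_pow]
    ring
  · intro X
    simpa only [mul_assoc] using (hasSum_thetaGen z ht X).mul_left (t : ℂ)

/-! ### Series of integrals and holomorphic parameter integrals -/

section Integration

variable {α : Type*} [MeasurableSpace α] {μ : Measure α}

lemma integrable_tsum_of_tsum_lintegral {ι : Type*} [Countable ι] {f : ι → α → ℂ}
    (hf : ∀ i, AEStronglyMeasurable (f i) μ) (h : ∑' i, ∫⁻ a, ‖f i a‖ₑ ∂μ ≠ ⊤) :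
    Integrable (fun a => ∑' i, f i a) μ := by
  have hs : ∀ᵐ a ∂μ, Summable fun i => ‖f i a‖ :=
    summable_norm_of_tsum_eLpNorm_ne_top le_rfl hf (by simpa [eLpNorm_one_eq_lintegral_enorm])
  have hm : AEStronglyMeasurable (fun a => ∑' i, f i a) μ := by
    refine aestronglyMeasurable_of_tendsto_ae (u := (Filter.atTop : Filter (Finset ι)))
      (f := fun S a => ∑ i ∈ S, f i a) (fun S => ?_) ?_
    · exact Finset.aestronglyMeasurable_fun_sum S fun i _ => hf i
    · filter_upwards [hs] with a ha using ha.of_norm.hasSum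
  refine ⟨hm, ?_⟩
  calc ∫⁻ a, ‖∑' i, f i a‖ₑ ∂μ ≤ ∫⁻ a, ∑' i, ‖f i a‖ₑ ∂μ := by
        refine lintegral_mono_ae ?_
        filter_upwards [hs] with a ha using enorm_tsum_le_tsum_enorm
    _ = ∑' i, ∫⁻ a, ‖f i a‖ₑ ∂μ := lintegral_tsum fun i => (hf i).enorm
    _ < ⊤ := h.lt_top

lemma hasSum_integral_of_tsum_lintegral {ι : Type*} [Countable ι] {f : ι → α → ℂ}
    (hf : ∀ i, AEStronglyMeasurable (f i) μ) (h : ∑' i, ∫⁻ a, ‖f i a‖ₑ ∂μ ≠ ⊤) :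
    HasSum (fun i => ∫ a, f i a ∂μ) (∫ a, ∑' i, f i a ∂μ) := by
  rw [integral_tsum hf h]
  refine Summable.hasSum (Summable.of_norm ?_)
  rw [← tsum_enorm_ne_top_iff_summable_norm]
  exact ne_top_of_le_ne_top h (ENNReal.tsum_le_tsum fun i => enorm_integral_le_lintegral_enorm _)

/-- A parameter integral of holomorphic functions that is locally uniformly dominated is
holomorphic. -/
theorem differentiableOn_integral_of_locally_dominated {U : Set ℂ} (hU : IsOpen U)
    {F : ℂ → α → ℂ} (hm : ∀ s ∈ U, AEStronglyMeasurable (F s) μ)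
    (hd : ∀ᵐ a ∂μ, DifferentiableOn ℂ (fun s => F s a) U)
    (hb : ∀ s₀ ∈ U, ∃ V ∈ nhds s₀, ∃ b : α → ℝ, Integrable b μ ∧
      ∀ᵐ a ∂μ, ∀ s ∈ V, ‖F s a‖ ≤ b a) :
    DifferentiableOn ℂ (fun s => ∫ a, F s a ∂μ) U := by
  intro s₀ hs₀
  obtain ⟨V, hV, b, hbi, hbb⟩ := hb s₀ hs₀
  obtain ⟨ε, hε, hball⟩ := Metric.mem_nhds_iff.mp (Filter.inter_mem hV (hU.mem_nhds hs₀))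
  -- Closed discs of radius `ε/3` about points of the `ε/3`-ball stay inside `V ∩ U`, so Cauchy's
  -- estimate bounds the derivative by `b / (ε/3)`.
  have hε2 : 0 < ε / 3 := by positivity
  have hsub : ∀ s ∈ Metric.ball s₀ (ε / 3), Metric.closedBall s (ε / 3) ⊆ V ∩ U := by
    intro s hs
    refine subset_trans (fun y hy => ?_) hball
    rw [Metric.mem_ball] at hs ⊢
    rw [Metric.mem_closedBall] at hy
    linarith [dist_triangle y s s₀]
  have hda : ∀ᵐ a ∂μ, ∀ s ∈ U, HasDerivAt (fun s => F s a) (deriv (fun s => F s a) s) s := by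
    filter_upwards [hd] with a ha s hs
    exact (ha.differentiableAt (hU.mem_nhds hs)).hasDerivAt
  refine (hasDerivAt_integral_of_dominated_loc_of_deriv_le (F := F)
    (F' := fun s a => deriv (fun s => F s a) s) (bound := fun a => b a / (ε / 3))
    (Metric.ball_mem_nhds s₀ hε2) ?_ ?_ ?_ ?_ (hbi.div_const _) ?_).2
      |>.differentiableAt.differentiableWithinAt
  · filter_upwards [hU.mem_nhds hs₀] with s hs using hm s hs
  · refine hbi.mono' (hm s₀ hs₀) ?_
    filter_upwards [hbb] with a ha using ha s₀ (mem_of_mem_nhds hV)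
  -- Measurability of the derivative in `a` comes from writing it as a limit of a sequence of
  -- difference quotients.
  · have hseq : Filter.Tendsto (fun n : ℕ => ((ε / 3 / (n + 1) : ℝ) : ℂ)) Filter.atTop
        (nhdsWithin 0 {0}ᶜ) := by
      refine tendsto_nhdsWithin_iff.mpr ⟨?_, ?_⟩
      · rw [← Complex.ofReal_zero]
        refine (Complex.continuous_ofReal.tendsto 0).comp ?_
        simpa [div_eq_mul_inv] using
          (tendsto_one_div_add_atTop_nhds_zero_nat (𝕜 := ℝ)).const_mul (ε / 3)
      · refine Filter.Eventually.of_forall fun n => ?_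
        have : (0 : ℝ) < ε / 3 / (n + 1) := by positivity
        simpa using (Complex.ofReal_ne_zero.mpr this.ne')
    have hmem : ∀ n : ℕ, s₀ + ((ε / 3 / (n + 1) : ℝ) : ℂ) ∈ U := by
      intro n
      refine (hsub s₀ (Metric.mem_ball_self hε2) ?_).2
      rw [Metric.mem_closedBall, dist_eq_norm, add_sub_cancel_left, Complex.norm_real,
        Real.norm_of_nonneg (by positivity)]
      exact div_le_self hε2.le (by linarith [Nat.cast_nonneg (α := ℝ) n])
    refine aestronglyMeasurable_of_tendsto_ae (u := Filter.atTop)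
      (f := fun (n : ℕ) a => ((ε / 3 / (n + 1) : ℝ) : ℂ)⁻¹ •
        (F (s₀ + ((ε / 3 / (n + 1) : ℝ) : ℂ)) a - F s₀ a)) (fun n => ?_) ?_
    · exact ((hm _ (hmem n)).sub (hm s₀ hs₀)).const_smul (((ε / 3 / (n + 1) : ℝ) : ℂ)⁻¹)
    · filter_upwards [hda] with a ha
      exact (hasDerivAt_iff_tendsto_slope_zero.mp (ha s₀ hs₀)).comp hseq
  · filter_upwards [hbb, hd] with a ha hda' s hs
    refine Complex.norm_deriv_le_of_forall_mem_sphere_norm_le hε2 ?_ fun y hy => ?_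
    · refine DifferentiableOn.diffContOnCl (hda'.mono fun y hy => (hsub s hs ?_).2)
      exact Metric.closure_ball_subset_closedBall hy
    · exact ha y (hsub s hs (Metric.sphere_subset_closedBall hy)).1
  · filter_upwards [hda] with a ha s hs
    exact ha s (hsub s hs (Metric.mem_closedBall_self hε2.le)).2

end Integration

/-! ### Mellin transforms of exponential series -/

section Mellin

variable {ι : Type*} [Countable ι] {c : ι → ℂ} {A : ι → ℝ} {F : ℝ → ℂ}

/-- The part `∫_1^∞ t ^ (s - 1) F(t) dt` of the Mellin transform. -/
def tailMellin (F : ℝ → ℂ) (s : ℂ) : ℂ := ∫ t in Set.Ioi (1 : ℝ), (t : ℂ) ^ (s - 1) * F t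

lemma lintegral_mellin_exp {a : ℂ} {p : ℝ} (hp : a = 0 ∨ 0 < p) {s : ℂ} (hs : 0 < s.re) :
    ∫⁻ t in Set.Ioi (0 : ℝ), ‖(t : ℂ) ^ (s - 1) * (a * Real.exp (-p * t))‖ₑ =
      ENNReal.ofReal (Real.Gamma s.re * (‖a‖ / p ^ s.re)) := by
  rcases hp with rfl | hp
  · simp
  have h1 : ∀ t ∈ Set.Ioi (0 : ℝ), ‖(t : ℂ) ^ (s - 1) * (a * Real.exp (-p * t))‖ₑ =
      ENNReal.ofReal (‖a‖ * (t ^ (s.re - 1) * Real.exp (-(p * t)))) := by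
    intro t ht
    rw [← ofReal_norm, norm_mul, norm_mul, Complex.norm_cpow_eq_rpow_re_of_pos ht,
      Complex.norm_real, Real.norm_of_nonneg (Real.exp_pos _).le]
    simp only [Complex.sub_re, Complex.one_re, neg_mul]
    ring_nf
  rw [setLIntegral_congr_fun measurableSet_Ioi h1]
  have hint : IntegrableOn (fun t : ℝ => t ^ (s.re - 1) * Real.exp (-(p * t))) (Set.Ioi 0) := by
    have := integrableOn_rpow_mul_exp_neg_mul_rpow (p := 1) (s := s.re - 1) (b := p)
      (by linarith) one_pos hp
    simpa using this
  rw [← ofReal_integral_eq_lintegral_ofReal (hint.const_mul _), integral_const_mul,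
    Real.integral_rpow_mul_exp_neg_mul_Ioi hs hp]
  · rw [one_div, Real.inv_rpow hp.le]
    ring_nf
  · filter_upwards [ae_restrict_mem measurableSet_Ioi] with t ht
    have : 0 < t := ht
    positivity

omit [Countable ι] in
lemma tsum_lintegral_mellin (hA : ∀ i, c i = 0 ∨ 0 < A i) {s : ℂ} (hs : 0 < s.re)
    (hsum : Summable fun i => ‖c i‖ / A i ^ s.re) :
    ∑' i, ∫⁻ t in Set.Ioi (0 : ℝ), ‖(t : ℂ) ^ (s - 1) * (c i * Real.exp (-A i * t))‖ₑ =
      ENNReal.ofReal (Real.Gamma s.re * ∑' i, ‖c i‖ / A i ^ s.re) := by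
  simp_rw [fun i => lintegral_mellin_exp (hA i) hs]
  rw [← tsum_mul_left, ENNReal.ofReal_tsum_of_nonneg _ (hsum.mul_left _)]
  intro i
  rcases hA i with h | h
  · simp [h]
  · have := Real.Gamma_pos_of_pos hs
    positivity

lemma lintegral_enorm_mellin_le (hA : ∀ i, c i = 0 ∨ 0 < A i) {s : ℂ} (hs : 0 < s.re)
    (hF : ∀ t ∈ Set.Ioi (0 : ℝ), HasSum (fun i => c i * Real.exp (-A i * t)) (F t))
    (hsum : Summable fun i => ‖c i‖ / A i ^ s.re) :
    ∫⁻ t in Set.Ioi (0 : ℝ), ‖(t : ℂ) ^ (s - 1) * F t‖ₑ ≤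
      ENNReal.ofReal (Real.Gamma s.re * ∑' i, ‖c i‖ / A i ^ s.re) := by
  rw [← tsum_lintegral_mellin hA hs hsum, ← lintegral_tsum]
  · refine setLIntegral_mono' measurableSet_Ioi fun t ht => ?_
    rw [← (hF t ht).tsum_eq, ← tsum_mul_left]
    exact enorm_tsum_le_tsum_enorm
  · intro i
    fun_prop

lemma integrableOn_mellin (hA : ∀ i, c i = 0 ∨ 0 < A i) {s : ℂ} (hs : 0 < s.re)
    (hF : ∀ t ∈ Set.Ioi (0 : ℝ), HasSum (fun i => c i * Real.exp (-A i * t)) (F t))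
    (hsum : Summable fun i => ‖c i‖ / A i ^ s.re) :
    IntegrableOn (fun t : ℝ => (t : ℂ) ^ (s - 1) * F t) (Set.Ioi 0) := by
  have := integrable_tsum_of_tsum_lintegral (μ := volume.restrict (Set.Ioi (0 : ℝ)))
    (f := fun i t => (t : ℂ) ^ (s - 1) * (c i * Real.exp (-A i * t))) (fun i => by fun_prop)
    (by rw [tsum_lintegral_mellin hA hs hsum]; exact ENNReal.ofReal_ne_top)
  refine this.congr ?_
  filter_upwards [ae_restrict_mem measurableSet_Ioi] with t ht
  rw [← (hF t ht).tsum_eq, tsum_mul_left]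

lemma norm_cpow_le_of_one_le {t : ℝ} (ht : 1 ≤ t) {s : ℂ} {M : ℝ} (hM : s.re ≤ M) :
    ‖(t : ℂ) ^ (s - 1)‖ ≤ ‖(t : ℂ) ^ ((M : ℂ) - 1)‖ := by
  rw [Complex.norm_cpow_eq_rpow_re_of_pos (by linarith),
    Complex.norm_cpow_eq_rpow_re_of_pos (by linarith)]
  apply Real.rpow_le_rpow_of_exponent_le ht
  simpa using hM

lemma aestronglyMeasurable_of_hasSum_exp
    (hF : ∀ t ∈ Set.Ioi (0 : ℝ), HasSum (fun i => c i * Real.exp (-A i * t)) (F t)) :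
    AEStronglyMeasurable F (volume.restrict (Set.Ioi (0 : ℝ))) := by
  refine aestronglyMeasurable_of_tendsto_ae (u := (Filter.atTop : Filter (Finset ι)))
    (f := fun S (t : ℝ) => ∑ i ∈ S, c i * (Real.exp (-A i * t) : ℂ)) (fun S => by fun_prop) ?_
  filter_upwards [ae_restrict_mem measurableSet_Ioi] with t ht using hF t ht

/-- On `t ≥ 1` raising the real part of the exponent only increases the integrand, so convergence of
the full transform at one `M` gives the tail for every `s` to its left. -/
lemma integrableOn_tailMellin (hA : ∀ i, c i = 0 ∨ 0 < A i) {M : ℝ} (hM : 0 < M)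
    (hF : ∀ t ∈ Set.Ioi (0 : ℝ), HasSum (fun i => c i * Real.exp (-A i * t)) (F t))
    (hsum : Summable fun i => ‖c i‖ / A i ^ M) {s : ℂ} (hs : s.re ≤ M) :
    IntegrableOn (fun t : ℝ => (t : ℂ) ^ (s - 1) * F t) (Set.Ioi 1) := by
  have h : IntegrableOn (fun t : ℝ => (t : ℂ) ^ ((M : ℂ) - 1) * F t) (Set.Ioi 1) :=
    (integrableOn_mellin (s := M) hA (by simpa using hM) hF (by simpa using hsum)).mono_set
      (Set.Ioi_subset_Ioi zero_le_one)
  have hFm : AEStronglyMeasurable F (volume.restrict (Set.Ioi (1 : ℝ))) :=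
    (aestronglyMeasurable_of_hasSum_exp hF).mono_measure
      (Measure.restrict_mono (Set.Ioi_subset_Ioi zero_le_one) le_rfl)
  refine Integrable.mono' (g := fun t => ‖(t : ℂ) ^ ((M : ℂ) - 1) * F t‖) (Integrable.norm h)
    (AEStronglyMeasurable.mul
      (Complex.measurable_ofReal.pow_const (s - 1)).aestronglyMeasurable hFm) ?_
  filter_upwards [ae_restrict_mem measurableSet_Ioi] with t ht
  rw [norm_mul, norm_mul]
  gcongr
  exact norm_cpow_le_of_one_le (le_of_lt ht) hs

/-- An explicit bound uniform in a left half-plane; it becomes the growth estimate in `z` once `c`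
and `A` come from the lattice. -/
lemma norm_tailMellin_le (hA : ∀ i, c i = 0 ∨ 0 < A i) {M : ℝ} (hM : 0 < M)
    (hF : ∀ t ∈ Set.Ioi (0 : ℝ), HasSum (fun i => c i * Real.exp (-A i * t)) (F t))
    (hsum : Summable fun i => ‖c i‖ / A i ^ M) {s : ℂ} (hs : s.re ≤ M) :
    ‖tailMellin F s‖ ≤ Real.Gamma M * ∑' i, ‖c i‖ / A i ^ M := by
  have hnn : 0 ≤ Real.Gamma M * ∑' i, ‖c i‖ / A i ^ M := by
    refine mul_nonneg (Real.Gamma_pos_of_pos hM).le (tsum_nonneg fun i => ?_)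
    rcases hA i with h | h
    · simp [h]
    · positivity
  rw [← ENNReal.ofReal_le_ofReal_iff hnn, ofReal_norm]
  calc ‖tailMellin F s‖ₑ ≤ ∫⁻ t in Set.Ioi (1 : ℝ), ‖(t : ℂ) ^ (s - 1) * F t‖ₑ :=
        enorm_integral_le_lintegral_enorm _
    _ ≤ ∫⁻ t in Set.Ioi (1 : ℝ), ‖(t : ℂ) ^ ((M : ℂ) - 1) * F t‖ₑ := by
        refine setLIntegral_mono' measurableSet_Ioi fun t ht => ?_
        rw [enorm_mul, enorm_mul]
        gcongr ?_ * _
        rw [← ofReal_norm, ← ofReal_norm]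
        exact ENNReal.ofReal_le_ofReal (norm_cpow_le_of_one_le (le_of_lt ht) hs)
    _ ≤ ∫⁻ t in Set.Ioi (0 : ℝ), ‖(t : ℂ) ^ ((M : ℂ) - 1) * F t‖ₑ :=
        lintegral_mono_set (Set.Ioi_subset_Ioi zero_le_one)
    _ ≤ _ := by
        simpa using lintegral_enorm_mellin_le (s := M) hA (by simpa using hM) hF
          (by simpa using hsum)

lemma differentiable_tailMellin (hA : ∀ i, c i = 0 ∨ 0 < A i) {σ : ℝ}
    (hF : ∀ t ∈ Set.Ioi (0 : ℝ), HasSum (fun i => c i * Real.exp (-A i * t)) (F t))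
    (hsum : ∀ M, σ < M → Summable fun i => ‖c i‖ / A i ^ M) :
    Differentiable ℂ (tailMellin F) := by
  rw [← differentiableOn_univ]
  have hFm : AEStronglyMeasurable F (volume.restrict (Set.Ioi (1 : ℝ))) :=
    (aestronglyMeasurable_of_hasSum_exp hF).mono_measure
      (Measure.restrict_mono (Set.Ioi_subset_Ioi zero_le_one) le_rfl)
  refine differentiableOn_integral_of_locally_dominated isOpen_univ (fun s _ =>
    AEStronglyMeasurable.mul (Complex.measurable_ofReal.pow_const (s - 1)).aestronglyMeasurable hFm)
    ?_ fun s₀ _ => ?_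
  · filter_upwards [ae_restrict_mem measurableSet_Ioi] with t ht s _
    have : (t : ℂ) ≠ 0 := by
      have : (1 : ℝ) < t := ht
      exact_mod_cast (by linarith : t ≠ 0)
    refine DifferentiableAt.differentiableWithinAt ?_
    exact ((differentiableAt_id.sub_const 1).const_cpow (Or.inl this)).mul_const _
  · set M : ℝ := max (|s₀.re| + 1) (σ + 1)
    have hM : 0 < M := lt_of_lt_of_le (by positivity) (le_max_left _ _)
    have hMσ : σ < M := lt_of_lt_of_le (by linarith) (le_max_right _ _)
    have hMs : s₀.re < M :=
      lt_of_lt_of_le (by linarith [le_abs_self s₀.re]) (le_max_left _ _)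
    refine ⟨{s | s.re < M}, (isOpen_lt Complex.continuous_re continuous_const).mem_nhds hMs,
      fun t => ‖(t : ℂ) ^ ((M : ℂ) - 1) * F t‖,
      Integrable.norm (integrableOn_tailMellin hA hM hF (hsum M hMσ) (by simp)), ?_⟩
    filter_upwards [ae_restrict_mem measurableSet_Ioi] with t ht s hs
    rw [norm_mul, norm_mul]
    gcongr
    exact norm_cpow_le_of_one_le (le_of_lt ht) (le_of_lt hs)

/-- The Mellin transform of a series `F` such that `δ + F` satisfies a functional equation. -/
theorem mellin_eq_tailMellin_add (hA : ∀ i, c i = 0 ∨ 0 < A i) {σ : ℝ} (hσ : 0 ≤ σ) {K : ℕ} {δ : ℂ}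
    (hδ : δ = 0 ∨ (K : ℝ) ≤ σ)
    (hF : ∀ t ∈ Set.Ioi (0 : ℝ), HasSum (fun i => c i * Real.exp (-A i * t)) (F t))
    (hfe : ∀ t ∈ Set.Ioi (0 : ℝ), δ + F t⁻¹ = (t : ℂ) ^ K * (δ + F t))
    (hsum : ∀ M, σ < M → Summable fun i => ‖c i‖ / A i ^ M) {s : ℂ} (hs : σ < s.re) :
    mellin F s = tailMellin F s + tailMellin F (K - s) - δ * (1 / s + 1 / (K - s)) := by
  have hs0 : 0 < s.re := hσ.trans_lt hs
  have hconv := integrableOn_mellin hA hs0 hF (hsum _ hs)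
  have htail : ∀ s' : ℂ, IntegrableOn (fun t : ℝ => (t : ℂ) ^ (s' - 1) * F t) (Set.Ioi 1) := by
    intro s'
    exact integrableOn_tailMellin hA (M := max (|s'.re| + 1) (σ + 1))
      (lt_of_lt_of_le (by positivity) (le_max_left _ _)) hF
      (hsum _ (lt_of_lt_of_le (by linarith) (le_max_right _ _)))
      ((by linarith [le_abs_self s'.re] : s'.re ≤ |s'.re| + 1).trans (le_max_left _ _))
  have h1 : mellin F s = (∫ t in Set.Ioc (0 : ℝ) 1, (t : ℂ) ^ (s - 1) * F t) + tailMellin F s := by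
    rw [mellin, tailMellin, ← setIntegral_union (Set.Ioc_disjoint_Ioi le_rfl) measurableSet_Ioi
      (hconv.mono_set Set.Ioc_subset_Ioi_self) (htail s), Set.Ioc_union_Ioi_eq_Ioi zero_le_one]
    rfl
  have h2 : ∫ t in Set.Ioc (0 : ℝ) 1, (t : ℂ) ^ (s - 1) * F t =
      mellin (Set.indicator (Set.Iic 1) F) s := by
    rw [mellin, ← Set.Ioi_inter_Iic, Set.inter_comm,
      ← Measure.restrict_restrict measurableSet_Iic, ← integral_indicator measurableSet_Iic]
    refine integral_congr_ae (Filter.Eventually.of_forall fun t => ?_)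
    by_cases ht : t ∈ Set.Iic (1 : ℝ) <;> simp [ht]
  -- Riemann's substitution `t ↦ 1/t` moves `(0, 1]` to `[1, ∞)`, where the functional equation
  -- replaces `F t⁻¹`; the `δ` terms are pure powers of `t`.
  have h3 : mellin (Set.indicator (Set.Iic 1) F) s =
      ∫ t in Set.Ioi (1 : ℝ), ((t : ℂ) ^ ((K : ℂ) - s - 1) * F t +
        δ * ((t : ℂ) ^ ((K : ℂ) - s - 1) - (t : ℂ) ^ (-s - 1))) := by
    have := mellin_comp_inv (Set.indicator (Set.Iic 1) F) (-s)
    rw [neg_neg] at this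
    rw [← this, mellin, ← integral_Ici_eq_integral_Ioi (x := (1 : ℝ)), ← Set.inter_eq_self_of_subset_left
      (show Set.Ici (1 : ℝ) ⊆ Set.Ioi 0 from fun x hx => lt_of_lt_of_le (zero_lt_one' ℝ) hx),
      ← Measure.restrict_restrict measurableSet_Ici, ← integral_indicator measurableSet_Ici]
    refine setIntegral_congr_fun measurableSet_Ioi fun t ht => ?_
    have ht0 : 0 < t := ht
    have htc : (t : ℂ) ≠ 0 := by exact_mod_cast ht0.ne'
    by_cases h : 1 ≤ t
    · have h' : t⁻¹ ∈ Set.Iic (1 : ℝ) := inv_le_one_of_one_le₀ h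
      simp only [Set.indicator_of_mem h', Set.indicator_of_mem (show t ∈ Set.Ici (1 : ℝ) from h),
        smul_eq_mul]
      have h4 : F t⁻¹ = (t : ℂ) ^ K * (δ + F t) - δ := by rw [← hfe t ht]; ring
      rw [h4, show (K : ℂ) - s - 1 = (-s - 1) + K by ring, Complex.cpow_add _ _ htc,
        Complex.cpow_natCast]
      ring
    · have h' : t⁻¹ ∉ Set.Iic (1 : ℝ) := by
        simpa using (one_lt_inv₀ ht0).mpr (not_le.mp h)
      simp [Set.indicator_of_notMem h', Set.indicator_of_notMem (show t ∉ Set.Ici (1 : ℝ) from h)]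
  rw [h1, h2, h3]
  rcases eq_or_ne δ 0 with rfl | hne
  · simp [tailMellin, add_comm]
  -- Only for `δ ≠ 0` do the pure powers occur, and then `K ≤ σ` makes their integrals converge at
  -- infinity.
  · have hK : (K : ℝ) < s.re := (hδ.resolve_left hne).trans_lt hs
    have e1 : ((K : ℂ) - s - 1).re < -1 := by simp; linarith
    have e2 : (-s - 1 : ℂ).re < -1 := by simp; linarith
    have i1 := integrableOn_Ioi_cpow_of_lt e1 one_pos
    have i2 := integrableOn_Ioi_cpow_of_lt e2 one_pos
    have i3 : IntegrableOn (fun t : ℝ => δ * ((t : ℂ) ^ ((K : ℂ) - s - 1) - (t : ℂ) ^ (-s - 1)))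
        (Set.Ioi 1) := (i1.sub i2).const_mul δ
    rw [integral_add (htail (K - s)) i3, integral_const_mul, integral_sub i1 i2, integral_Ioi_cpow_of_lt e1 one_pos, integral_Ioi_cpow_of_lt e2 one_pos,
      tailMellin, tailMellin]
    have n1 : s ≠ 0 := by rintro rfl; simp at hs0
    have n2 : (K : ℂ) - s ≠ 0 := by
      intro h
      have := congrArg Complex.re h
      simp at this
      linarith
    simp only [Complex.ofReal_one, Complex.one_cpow, sub_add_cancel]
    field_simp
    ring

end Mellin

/-! ### Eisenstein series as lattice sums -/

/-- The term of the Eisenstein series attached to a lattice point. -/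
def latticeTerm (k : ℤ) (s : ℂ) (z : ℍ) (x : Fin 2 → ℤ) : ℂ :=
  (latticePoint z x / (‖latticePoint z x‖ : ℂ)) ^ (-k) *
    ((z.im / ‖latticePoint z x‖ ^ 2 : ℝ) : ℂ) ^ s

/-- The Eisenstein series as a sum over the full lattice. -/
def latticeSum (k : ℤ) (s : ℂ) (z : ℍ) : ℂ := ∑' x : Fin 2 → ℤ, latticeTerm k s z x

lemma latticeTerm_zero (k : ℤ) {s : ℂ} (hs : 0 < s.re) (z : ℍ) : latticeTerm k s z 0 = 0 := by
  have : s ≠ 0 := by rintro rfl; simp at hs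
  simp [latticeTerm, latticePoint_zero, Complex.zero_cpow this]

lemma norm_latticeTerm (k : ℤ) {s : ℂ} (hs : 0 < s.re) (z : ℍ) (x : Fin 2 → ℤ) :
    ‖latticeTerm k s z x‖ = z.im ^ s.re * ‖latticePoint z x‖ ^ (-(2 * s.re)) := by
  rcases eq_or_ne x 0 with rfl | hx
  · rw [latticeTerm_zero k hs, latticePoint_zero, norm_zero, Real.zero_rpow (by linarith),
      mul_zero]
  · have h := norm_pos_iff.mpr (latticePoint_ne_zero z hx)
    rw [latticeTerm, norm_mul, norm_zpow, norm_div, Complex.norm_real, norm_norm,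
      div_self h.ne', one_zpow, one_mul, Complex.norm_cpow_eq_rpow_re_of_pos
      (by have := z.im_pos; positivity), Real.div_rpow z.im_pos.le (by positivity),
      ← Real.rpow_natCast, ← Real.rpow_mul h.le, Real.rpow_neg h.le, div_eq_mul_inv]
    norm_num

lemma summable_latticeTerm (k : ℤ) {s : ℂ} (hs : 1 < s.re) (z : ℍ) :
    Summable (latticeTerm k s z) := by
  refine Summable.of_norm ?_
  simp_rw [fun x => norm_latticeTerm k (by linarith : 0 < s.re) z x]
  exact (summable_norm_latticePoint_rpow z (by linarith)).mul_left _

lemma latticePoint_smul (z : ℍ) (r : ℕ) (x : Fin 2 → ℤ) :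
    latticePoint z (r • x) = r * latticePoint z x := by
  simp [latticePoint]; ring

lemma latticePoint_neg (z : ℍ) (x : Fin 2 → ℤ) : latticePoint z (-x) = -latticePoint z x := by
  simp [latticePoint]; ring

lemma latticeTerm_neg {k : ℤ} (hk : Even k) (s : ℂ) (z : ℍ) (x : Fin 2 → ℤ) :
    latticeTerm k s z (-x) = latticeTerm k s z x := by
  rw [latticeTerm, latticePoint_neg, norm_neg, neg_div, hk.neg.neg_zpow, latticeTerm]

lemma latticeTerm_smul (k : ℤ) (s : ℂ) (z : ℍ) {r : ℕ} (hr : r ≠ 0) (x : Fin 2 → ℤ) :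
    latticeTerm k s z (r • x) = 1 / (r : ℂ) ^ (2 * s) * latticeTerm k s z x := by
  have hr' : (r : ℂ) ≠ 0 := by exact_mod_cast hr
  have hrpos : (0 : ℝ) < r := by exact_mod_cast Nat.pos_of_ne_zero hr
  rw [latticeTerm, latticePoint_smul, norm_mul, Complex.norm_natCast, latticeTerm]
  have h1 : (r : ℂ) * latticePoint z x / ((r * ‖latticePoint z x‖ : ℝ) : ℂ) =
      latticePoint z x / (‖latticePoint z x‖ : ℂ) := by
    push_cast
    rw [mul_div_mul_left _ _ hr']
  have h2 : (z.im / (r * ‖latticePoint z x‖) ^ 2 : ℝ) =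
      ((r : ℝ) ^ 2)⁻¹ * (z.im / ‖latticePoint z x‖ ^ 2) := by
    rw [mul_pow, ← div_div, div_right_comm, div_eq_inv_mul]
  have hy := z.im_pos
  rw [h1, h2, Complex.ofReal_mul, Complex.mul_cpow_ofReal_nonneg (by positivity) (by positivity)]
  have h3 : ((((r : ℝ) ^ 2)⁻¹ : ℝ) : ℂ) ^ s = 1 / (r : ℂ) ^ (2 * s) := by
    rw [Complex.ofReal_inv, Complex.inv_cpow, one_div, Complex.ofReal_pow, Complex.ofReal_natCast,
      ← Complex.natCast_cpow_natCast_mul]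
    · norm_num
    · rw [Complex.arg_ofReal_of_nonneg (by positivity)]
      exact Real.pi_pos.ne
  rw [h3]
  ring

lemma eisensteinTerm_eq_latticeTerm (k : ℤ) (z : ℍ) (s : ℂ) (γ : SL(2, ℤ)) :
    eisensteinTerm k z s γ = latticeTerm k s z (γ 1) := by
  have h : (γ • z).im = z.im / ‖latticePoint z (γ 1)‖ ^ 2 := by
    rw [ModularGroup.im_smul_eq_div_normSq, Complex.normSq_eq_norm_sq]
    simp [latticePoint, ModularGroup.denom_apply]
  rw [eisensteinTerm, h]
  rfl

/-! ### Cosets and coprime pairs -/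

section Coprime

open EisensteinSeries

/-- Classes of `Γ_∞ \ SL(2, ℤ)` with a sign are coprime pairs. -/
def signedRow (p : Quotient (QuotientGroup.rightRel gammaInfty) × Bool) : gammaSet 1 1 0 :=
  ⟨bif p.2 then p.1.out 1 else -(p.1.out 1), by
    rw [mem_gammaSet_one]
    have := ModularGroup.bottom_row_coprime p.1.out
    cases p.2
    · simpa using this.neg_neg
    · simpa using this⟩

lemma mem_gammaInfty_iff {g : SL(2, ℤ)} : g ∈ gammaInfty ↔ g 1 0 = 0 := by
  constructor
  · rintro ⟨n, rfl | rfl⟩ <;> simp [ModularGroup.coe_T_zpow]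
  · intro hc
    have had := g.det_coe
    replace had : g 0 0 * g 1 1 = 1 := by rw [Matrix.det_fin_two, hc] at had; lia
    rcases Int.eq_one_or_neg_one_of_mul_eq_one' had with (⟨ha, hd⟩ | ⟨ha, hd⟩)
    · refine ⟨g 0 1, Or.inl ?_⟩
      ext i j; fin_cases i <;> fin_cases j <;>
        simp [ha, hc, hd, ModularGroup.coe_T_zpow]
    · refine ⟨-(g 0 1), Or.inr ?_⟩
      ext i j; fin_cases i <;> fin_cases j <;>
        simp [ha, hc, hd, ModularGroup.coe_T_zpow]

lemma row_of_mem_gammaInfty {g h : SL(2, ℤ)} (H : g * h⁻¹ ∈ gammaInfty) :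
    g 1 = h 1 ∨ g 1 = -(h 1) := by
  obtain ⟨n, hn⟩ := H
  refine hn.imp (fun hn => ?_) fun hn => ?_
  · rw [mul_inv_eq_iff_eq_mul] at hn
    ext i
    fin_cases i <;> simp [hn]
  · rw [mul_inv_eq_iff_eq_mul] at hn
    ext i
    fin_cases i <;> simp [hn, ModularGroup.coe_T_zpow, Matrix.vecMul, Matrix.vecHead, Matrix.vecTail]

lemma mem_gammaInfty_of_row {g h : SL(2, ℤ)} (H : g 1 = h 1 ∨ g 1 = -(h 1)) :
    g * h⁻¹ ∈ gammaInfty := by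
  have h0 : (g * h⁻¹) 1 0 = g 1 0 * h 1 1 - g 1 1 * h 1 0 := by
    simp [Matrix.mul_apply, Fin.sum_univ_two, Matrix.adjugate_fin_two]
    ring
  rw [mem_gammaInfty_iff, h0]
  rcases H with H | H <;> rw [H]
  · ring
  · simp only [Pi.neg_apply]
    ring

/-- A coset of `Γ_∞` is determined by the bottom row up to sign, and every coprime pair is a bottom
row. -/
lemma signedRow_bijective : Function.Bijective signedRow := by
  constructor
  · rintro ⟨q, b⟩ ⟨q', b'⟩ h
    have h' : (bif b then q.out 1 else -(q.out 1)) = (bif b' then q'.out 1 else -(q'.out 1)) :=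
      congrArg Subtype.val h
    have hrow : q.out 1 = q'.out 1 ∨ q.out 1 = -(q'.out 1) := by
      cases b <;> cases b' <;> simp only [cond_true, cond_false] at h'
      · exact Or.inl (neg_injective h')
      · exact Or.inr (neg_eq_iff_eq_neg.mp h')
      · exact Or.inr h'
      · exact Or.inl h'
    have hq : q = q' := by
      rw [← Quotient.out_eq q, ← Quotient.out_eq q']
      refine (Quotient.sound ?_).symm
      exact QuotientGroup.rightRel_apply.mpr (mem_gammaInfty_of_row hrow)
    subst hq
    -- The two signs give different pairs because a coprime row is not zero; this is the source of
    -- the factor `2` below.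
    have hne : q.out 1 ≠ -(q.out 1) := by
      intro h0
      have h1 : q.out 1 = 0 := by
        ext i
        have := congrFun h0 i
        simp only [Pi.neg_apply] at this
        simp only [Pi.zero_apply]
        lia
      have h2 := ModularGroup.bottom_row_coprime q.out
      rw [h1] at h2
      exact not_isCoprime_zero_zero h2
    cases b <;> cases b' <;> simp only [cond_true, cond_false] at h'
    · rfl
    · exact absurd h'.symm hne
    · exact absurd h' hne
    · rfl
  · rintro ⟨v, hv⟩
    rw [mem_gammaSet_one] at hv
    obtain ⟨g, -, hg⟩ := ModularGroup.bottom_row_surj hv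
    set q : Quotient (QuotientGroup.rightRel gammaInfty) := Quotient.mk _ g
    have hrel : QuotientGroup.rightRel gammaInfty g q.out :=
      (QuotientGroup.rightRel gammaInfty).symm (Quotient.mk_out g)
    rw [QuotientGroup.rightRel_apply] at hrel
    rcases row_of_mem_gammaInfty hrel with h | h
    · refine ⟨(q, true), Subtype.ext ?_⟩
      simp only [signedRow, cond_true]
      rw [h]; exact hg
    · refine ⟨(q, false), Subtype.ext ?_⟩
      simp only [signedRow, cond_false]
      rw [h, neg_neg]; exact hg

lemma tsum_coprime_eq {f : (Fin 2 → ℤ) → ℂ} (hf : Summable f) (heven : ∀ x, f (-x) = f x) :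
    ∑' v : gammaSet 1 1 0, f v =
      2 * ∑' q : Quotient (QuotientGroup.rightRel gammaInfty), f (q.out 1) := by
  have hs : Summable fun p => f (signedRow p) :=
    (hf.comp_injective Subtype.val_injective).comp_injective signedRow_bijective.injective
  rw [← (Equiv.ofBijective _ signedRow_bijective).tsum_eq]
  simp only [Equiv.ofBijective_apply]
  rw [hs.tsum_prod, ← tsum_mul_left]
  refine tsum_congr fun q => ?_
  simp [tsum_fintype, signedRow, heven]
  ring

/-- Sorting lattice points by their gcd `r` pulls out `r ^ (-2s)`, which sums to `ζ(2s)`; the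
primitive points cover each coset twice. -/
lemma latticeSum_eq {k : ℤ} (hk : Even k) {s : ℂ} (hs : 1 < s.re) (z : ℍ) :
    latticeSum k s z = 2 * riemannZeta (2 * s) * eisensteinSeries k z s := by
  have hsum := summable_latticeTerm k hs z
  have hs2 : 1 < (2 * s).re := by simp; linarith
  rw [latticeSum, ← gammaSetDivGcdSigmaEquiv.symm.tsum_eq]
  simp_rw [gammaSetDivGcdSigmaEquiv_symm_eq]
  refine (Summable.tsum_sigma (gammaSetDivGcdSigmaEquiv.symm.summable_iff.mpr hsum)).trans ?_
  simp only [Function.comp_apply, gammaSetDivGcdSigmaEquiv_symm_eq]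
  rw [zeta_eq_tsum_one_div_nat_cpow hs2]
  have h1 : ∀ r : ℕ, ∑' v : gammaSet 1 r 0, latticeTerm k s z v =
      1 / (r : ℂ) ^ (2 * s) * ∑' v : gammaSet 1 1 0, latticeTerm k s z v := by
    intro r
    -- The class `r = 0` contains only the origin, where both sides vanish by the convention for `0
    -- ^ s`.
    rcases eq_or_ne r 0 with rfl | hr
    · have h0 : (2 * s) ≠ 0 := by intro h; simp [h] at hs2; linarith
      rw [Nat.cast_zero, Complex.zero_cpow h0, div_zero, zero_mul]
      have : ∀ v : gammaSet 1 0 0, latticeTerm k s z v = 0 := by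
        rintro ⟨v, hv⟩
        rw [gammaSet_one_mem_iff, Int.gcd_eq_zero_iff] at hv
        have : v = 0 := by ext i; fin_cases i <;> simp [hv]
        simp [this, latticeTerm_zero k (by linarith : 0 < s.re)]
      simp [this]
    · have : NeZero r := ⟨hr⟩
      rw [← tsum_mul_left, ← (gammaSetDivGcdEquiv r).tsum_eq]
      refine tsum_congr fun v => ?_
      rw [gammaSetDivGcdEquiv_eq, ← latticeTerm_smul k s z hr, ← gammaSet_eq_gcd_mul_divIntMap v.2]
  rw [tsum_congr h1, tsum_mul_right, tsum_coprime_eq hsum (latticeTerm_neg hk s z), eisensteinSeries]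
  simp_rw [eisensteinTerm_eq_latticeTerm]
  ring

end Coprime

/-! ### Automorphy, conjugation and growth of lattice sums -/

lemma autFactor_ne_zero (γ : SL(2, ℤ)) (z : ℍ) : autFactor γ z ≠ 0 := by
  have := UpperHalfPlane.denom_ne_zero γ z
  rwa [ModularGroup.denom_apply] at this

lemma latticePoint_smul_SL (γ : SL(2, ℤ)) (z : ℍ) (x : Fin 2 → ℤ) :
    latticePoint (γ • z) x =
      latticePoint z (Matrix.vecMul x (γ : Matrix (Fin 2) (Fin 2) ℤ)) / autFactor γ z := by
  have hd := autFactor_ne_zero γ z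
  have h (a b c d u v : ℂ) (hc : c * z + d ≠ 0) : u * ((a * z + b) / (c * z + d)) + v =
      ((u * a + v * c) * z + (u * b + v * d)) / (c * z + d) := by
    rw [eq_div_iff hc, add_mul, mul_assoc, div_mul_cancel₀ _ hc]
    ring
  rw [latticePoint, UpperHalfPlane.specialLinearGroup_apply, latticePoint]
  have e : ∀ i, Matrix.vecMul x (γ : Matrix (Fin 2) (Fin 2) ℤ) i = x 0 * γ 0 i + x 1 * γ 1 i :=
    fun i => by simp [Matrix.vecMul, dotProduct, Fin.sum_univ_two]
  rw [e, e]
  push_cast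
  exact h (γ 0 0) (γ 0 1) (γ 1 0) (γ 1 1) (x 0) (x 1) hd

lemma im_smul_eq (γ : SL(2, ℤ)) (z : ℍ) : (γ • z).im = z.im / ‖autFactor γ z‖ ^ 2 := by
  rw [ModularGroup.im_smul_eq_div_normSq, Complex.normSq_eq_norm_sq, ModularGroup.denom_apply]
  rfl

lemma latticeTerm_smul_SL (k : ℤ) (s : ℂ) (γ : SL(2, ℤ)) (z : ℍ) (x : Fin 2 → ℤ) :
    latticeTerm k s (γ • z) x = (autFactor γ z / (‖autFactor γ z‖ : ℂ)) ^ k *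
      latticeTerm k s z (Matrix.vecMul x (γ : Matrix (Fin 2) (Fin 2) ℤ)) := by
  have hd := autFactor_ne_zero γ z
  have hd' : (‖autFactor γ z‖ : ℝ) ≠ 0 := norm_ne_zero_iff.mpr hd
  have hd'' : (‖autFactor γ z‖ : ℂ) ≠ 0 := by exact_mod_cast hd'
  rw [latticeTerm, latticeTerm, latticePoint_smul_SL, im_smul_eq, norm_div, ← mul_assoc]
  congr 1
  · rw [Complex.ofReal_div, div_div_div_comm, div_zpow, zpow_neg _ k, zpow_neg _ k, div_inv_eq_mul,
      mul_comm]
  · congr 2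
    field_simp

/-- Right multiplication by `γ` permutes `ℤ²`, so the automorphy factor of a single term is that of
the whole sum. -/
lemma latticeSum_smul_SL (k : ℤ) (s : ℂ) (γ : SL(2, ℤ)) (z : ℍ) :
    latticeSum k s (γ • z) =
      (autFactor γ z / (‖autFactor γ z‖ : ℂ)) ^ k * latticeSum k s z := by
  rw [latticeSum, latticeSum]
  simp_rw [latticeTerm_smul_SL]
  rw [tsum_mul_left]
  congr 1
  let e : (Fin 2 → ℤ) ≃ (Fin 2 → ℤ) :=
    { toFun := fun x => Matrix.vecMul x (γ : Matrix (Fin 2) (Fin 2) ℤ)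
      invFun := fun x => Matrix.vecMul x (γ⁻¹ : SL(2, ℤ))
      left_inv := fun x => by
        simp only [Matrix.vecMul_vecMul, ← Matrix.SpecialLinearGroup.coe_mul, mul_inv_cancel,
          Matrix.SpecialLinearGroup.coe_one, Matrix.vecMul_one]
      right_inv := fun x => by
        simp only [Matrix.vecMul_vecMul, ← Matrix.SpecialLinearGroup.coe_mul, inv_mul_cancel,
          Matrix.SpecialLinearGroup.coe_one, Matrix.vecMul_one] }
  exact e.tsum_eq (latticeTerm k s z)

/-- Conjugation inverts the unit vector `ω/|ω|` and so negates the weight. It gives the continuation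
in negative weight and the second slot of the Petersson product. -/
lemma conj_latticeTerm (k : ℤ) (s : ℂ) (z : ℍ) (x : Fin 2 → ℤ) :
    conj (latticeTerm k (conj s) z x) = latticeTerm (-k) s z x := by
  have hnn : 0 ≤ z.im / ‖latticePoint z x‖ ^ 2 := by have := z.im_pos; positivity
  rw [latticeTerm, latticeTerm, map_mul, map_zpow₀, map_div₀, Complex.conj_ofReal]
  congr 1
  · rcases eq_or_ne (latticePoint z x) 0 with h | h
    · simp only [h, map_zero, zero_div, neg_neg]
      rcases eq_or_ne k 0 with rfl | hk
      · simp
      · rw [zero_zpow _ (neg_ne_zero.mpr hk), zero_zpow _ hk]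
    · rw [neg_neg, zpow_neg, ← inv_zpow]
      congr 1
      have h' : (‖latticePoint z x‖ : ℂ) ≠ 0 := by exact_mod_cast norm_ne_zero_iff.mpr h
      have h2 : conj (latticePoint z x) ≠ 0 := by simpa using h
      rw [inv_div, div_eq_div_iff h2 h', ← sq, Complex.mul_conj, Complex.normSq_eq_norm_sq]
      push_cast
      ring
  · rw [Complex.cpow_conj, Complex.conj_ofReal, Complex.conj_conj]
    rw [Complex.arg_ofReal_of_nonneg hnn]
    exact Real.pi_pos.ne

lemma conj_latticeSum (k : ℤ) (s : ℂ) (z : ℍ) :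
    conj (latticeSum k (conj s) z) = latticeSum (-k) s z := by
  rw [latticeSum, Complex.conj_tsum]
  simp_rw [conj_latticeTerm]
  rfl

lemma half_le_im_of_mem_fd {z : ℍ} (hz : z ∈ 𝒟) : 1 / 2 ≤ z.im := by
  have := ModularGroup.three_le_four_mul_im_sq_of_mem_fd hz
  nlinarith [z.im_pos]

/-- On the fundamental domain the lattice sums are bounded uniformly. -/
lemma exists_tsum_norm_latticePoint_le {a : ℝ} (ha : 2 < a) :
    ∃ C, 0 ≤ C ∧ ∀ z ∈ 𝒟, ∑' x : Fin 2 → ℤ, ‖latticePoint z x‖ ^ (-a) ≤ C := by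
  have hs := EisensteinSeries.summable_one_div_norm_rpow ha
  refine ⟨EisensteinSeries.r ⟨⟨1 / 2, 1 / 2⟩, by norm_num⟩ ^ (-a) *
    ∑' x : Fin 2 → ℤ, ‖x‖ ^ (-a), ?_, fun z hz => ?_⟩
  · exact mul_nonneg (Real.rpow_nonneg (EisensteinSeries.r_pos _).le _)
      (tsum_nonneg fun x => by positivity)
  · rw [← tsum_mul_left]
    refine Summable.tsum_le_tsum (fun x => ?_) (summable_norm_latticePoint_rpow z ha)
      (hs.mul_left _)
    exact EisensteinSeries.summand_bound_of_mem_verticalStrip (by linarith) x (by norm_num)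
      ⟨hz.2, half_le_im_of_mem_fd hz⟩

lemma exists_norm_latticeSum_le (k : ℤ) {s : ℂ} (hs : 1 < s.re) :
    ∃ C, 0 ≤ C ∧ ∀ z ∈ 𝒟, ‖latticeSum k s z‖ ≤ C * z.im ^ s.re := by
  obtain ⟨C, hC0, hC⟩ := exists_tsum_norm_latticePoint_le (a := 2 * s.re) (by linarith)
  refine ⟨C, hC0, fun z hz => ?_⟩
  refine (norm_tsum_le_tsum_norm (summable_latticeTerm k hs z).norm).trans ?_
  simp_rw [fun x => norm_latticeTerm k (by linarith : 0 < s.re) z x]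
  rw [tsum_mul_left, mul_comm]
  have := z.im_pos
  gcongr
  exact hC z hz

/-! ### Analytic continuation by theta integrals -/

/-- The constant term of the theta series. -/
def thetaConst (m : ℕ) : ℂ := if m = 0 then 1 else 0

/-- The theta series without its constant term. -/
def thetaTail (m : ℕ) (z : ℍ) (t : ℝ) : ℂ := thetaSeries (2 * m) z t - thetaConst m

/-- The origin is excluded by hand since `0 ^ 0 = 1` would otherwise restore the constant term for
`m = 0`. -/
def thetaCoeff (m : ℕ) (z : ℍ) (x : Fin 2 → ℤ) : ℂ :=
  if x = 0 then 0 else conj (latticePoint z x) ^ (2 * m)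

def thetaExponent (z : ℍ) (x : Fin 2 → ℤ) : ℝ := Real.pi / z.im * ‖latticePoint z x‖ ^ 2

lemma thetaCoeff_eq_zero_or (m : ℕ) (z : ℍ) (x : Fin 2 → ℤ) :
    thetaCoeff m z x = 0 ∨ 0 < thetaExponent z x := by
  rcases eq_or_ne x 0 with rfl | hx
  · simp [thetaCoeff]
  · right
    have h := norm_pos_iff.mpr (latticePoint_ne_zero z hx)
    have := z.im_pos
    unfold thetaExponent
    positivity

lemma hasSum_thetaTail (m : ℕ) (z : ℍ) {t : ℝ} (ht : 0 < t) :
    HasSum (fun x => thetaCoeff m z x * (Real.exp (-thetaExponent z x * t) : ℂ))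
      (thetaTail m z t) := by
  have h := (summable_thetaSeries (2 * m) z ht).hasSum.sub
    (hasSum_ite_eq (0 : Fin 2 → ℤ) (thetaConst m))
  refine h.congr_fun fun x => ?_
  rw [show Real.pi * t / z.im * ‖latticePoint z x‖ ^ 2 = thetaExponent z x * t by
    unfold thetaExponent; ring]
  rcases eq_or_ne x 0 with rfl | hx
  · rcases eq_or_ne m 0 with rfl | hm
    · simp [thetaCoeff, thetaConst, thetaExponent, latticePoint_zero]
    · simp [thetaCoeff, thetaConst, latticePoint_zero, hm]
  · simp [thetaCoeff, hx]

lemma norm_thetaCoeff_div (m : ℕ) (z : ℍ) {M : ℝ} (hM : (m : ℝ) < M) (x : Fin 2 → ℤ) :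
    ‖thetaCoeff m z x‖ / thetaExponent z x ^ M =
      (z.im / Real.pi) ^ M * ‖latticePoint z x‖ ^ (-(2 * M - 2 * m)) := by
  rcases eq_or_ne x 0 with rfl | hx
  · rw [latticePoint_zero, norm_zero, Real.zero_rpow (by linarith)]
    simp [thetaCoeff]
  · have h := norm_pos_iff.mpr (latticePoint_ne_zero z hx)
    have hy := z.im_pos
    have hpi := Real.pi_pos
    rw [thetaCoeff, if_neg hx, norm_pow, RCLike.norm_conj, thetaExponent,
      Real.mul_rpow (by positivity) (by positivity), neg_sub, Real.rpow_sub h,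
      ← Real.rpow_natCast, ← Real.rpow_natCast, ← Real.rpow_mul h.le,
      Real.div_rpow hy.le hpi.le, Real.div_rpow hpi.le hy.le]
    push_cast
    field_simp

lemma summable_thetaCoeff_div (m : ℕ) (z : ℍ) {M : ℝ} (hM : (m : ℝ) + 1 < M) :
    Summable fun x => ‖thetaCoeff m z x‖ / thetaExponent z x ^ M := by
  simp_rw [fun x => norm_thetaCoeff_div m z (by linarith : (m : ℝ) < M) x]
  exact (summable_norm_latticePoint_rpow z (by linarith)).mul_left _

/-- The incomplete Mellin transform of the theta series. -/
def eisensteinTail (m : ℕ) (z : ℍ) (s : ℂ) : ℂ := tailMellin (thetaTail m z) (s + m)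

lemma differentiable_eisensteinTail (m : ℕ) (z : ℍ) : Differentiable ℂ (eisensteinTail m z) := by
  have := differentiable_tailMellin (thetaCoeff_eq_zero_or m z)
    (fun t ht => hasSum_thetaTail m z ht) (σ := m + 1) fun M hM => summable_thetaCoeff_div m z hM
  exact this.comp (differentiable_id.add_const _)

/-- Polynomial growth in `y`, uniform for `Re s ≤ σ`. This serves both integrability against a cusp
form and domination near each value of the parameter. -/
lemma exists_norm_eisensteinTail_le (m : ℕ) (σ : ℝ) :
    ∃ C N : ℝ, 0 ≤ C ∧ ∀ z ∈ 𝒟, ∀ s : ℂ, s.re ≤ σ → ‖eisensteinTail m z s‖ ≤ C * z.im ^ N := by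
  set M : ℝ := max σ 2 + m
  have hM : (m : ℝ) + 1 < M := by
    have := le_max_right σ 2
    simp only [M]
    linarith
  have hM0 : 0 < M := lt_trans (by positivity) hM
  obtain ⟨C, hC0, hC⟩ := exists_tsum_norm_latticePoint_le (a := 2 * M - 2 * m) (by linarith)
  refine ⟨Real.Gamma M * ((Real.pi ^ M)⁻¹ * C), M, ?_, fun z hz s hs => ?_⟩
  · have := Real.Gamma_pos_of_pos hM0
    have := Real.pi_pos
    positivity
  · have h := norm_tailMellin_le (thetaCoeff_eq_zero_or m z) hM0
      (fun t ht => hasSum_thetaTail m z ht) (summable_thetaCoeff_div m z hM) (s := s + m)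
      (by simp only [Complex.add_re, Complex.natCast_re, M]; gcongr; exact hs.trans (le_max_left _ _))
    refine h.trans ?_
    simp_rw [fun x => norm_thetaCoeff_div m z (by linarith : (m : ℝ) < M) x]
    rw [tsum_mul_left, Real.div_rpow z.im_pos.le Real.pi_pos.le]
    have h1 := hC z hz
    have h2 := Real.Gamma_pos_of_pos hM0
    have h3 := z.im_pos
    have h4 := Real.pi_pos
    calc _ ≤ Real.Gamma M * (z.im ^ M / Real.pi ^ M * C) := by gcongr
      _ = _ := by ring

/-- The completed Eisenstein series of weight `2 m`, given by theta integrals. -/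
def thetaEisenstein (m : ℕ) (z : ℍ) (s : ℂ) : ℂ :=
  1 / 2 * (Real.pi : ℂ) ^ m / (z.im : ℂ) ^ m *
    (eisensteinTail m z s + eisensteinTail m z (1 - s) - thetaConst m * (1 / s + 1 / (1 - s)))

/-- The shift by `m` supplies the factor `‖ω‖ ^ (-2m)` that turns `conj ω ^ (2m)` into `(ω/|ω|) ^
(-2m)`. -/
lemma mellin_thetaTail (m : ℕ) (z : ℍ) {s : ℂ} (hs : 1 < s.re) :
    mellin (thetaTail m z) (s + m) =
      (z.im : ℂ) ^ m / (Real.pi : ℂ) ^ m * ((Real.pi : ℂ) ^ (-s) * Complex.Gamma (s + m) *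
        latticeSum (2 * m) s z) := by
  have h := hasSum_mellin (thetaCoeff_eq_zero_or m z) (s := s + m)
    (by simp; positivity) (fun t ht => hasSum_thetaTail m z ht)
    (by simpa using summable_thetaCoeff_div m z (M := s.re + m) (by linarith))
  rw [← h.tsum_eq, latticeSum, ← tsum_mul_left, ← tsum_mul_left]
  refine tsum_congr fun x => ?_
  rcases eq_or_ne x 0 with rfl | hx
  · rw [latticeTerm_zero _ (by linarith)]
    simp [thetaCoeff]
  have hω := latticePoint_ne_zero z hx
  have hn := norm_pos_iff.mpr hω
  have hy := z.im_pos
  have hpi := Real.pi_pos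
  have hpic : (Real.pi : ℂ) ≠ 0 := by exact_mod_cast hpi.ne'
  have hyc : (z.im : ℂ) ≠ 0 := by exact_mod_cast hy.ne'
  have hnc : (‖latticePoint z x‖ : ℂ) ≠ 0 := by exact_mod_cast hn.ne'
  have hconj : conj (latticePoint z x) ≠ 0 := by simpa using hω
  have e1 : thetaExponent z x = Real.pi * (z.im / ‖latticePoint z x‖ ^ 2)⁻¹ := by
    unfold thetaExponent
    field_simp
  have e2 : latticePoint z x = ‖latticePoint z x‖ ^ 2 / conj (latticePoint z x) := by
    rw [eq_div_iff hconj, Complex.mul_conj, Complex.normSq_eq_norm_sq]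
    push_cast; ring
  have e3 : (latticePoint z x / (‖latticePoint z x‖ : ℂ)) ^ (-(2 * m : ℤ)) =
      conj (latticePoint z x) ^ (2 * m) / (‖latticePoint z x‖ : ℂ) ^ (2 * m) := by
    have : latticePoint z x / (‖latticePoint z x‖ : ℂ) =
        (conj (latticePoint z x) / (‖latticePoint z x‖ : ℂ))⁻¹ := by
      rw [inv_div, div_eq_div_iff hnc hconj, Complex.mul_conj, Complex.normSq_eq_norm_sq]
      push_cast; ring
    rw [this, inv_zpow, zpow_neg, inv_inv, ← div_pow]
    norm_cast
  rw [thetaCoeff, if_neg hx, latticeTerm, e3, e1, Complex.ofReal_mul,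
    Complex.mul_cpow_ofReal_nonneg hpi.le (by positivity), Complex.cpow_add _ _ hpic,
    Complex.cpow_natCast, Complex.cpow_neg, Complex.ofReal_inv, Complex.inv_cpow, Complex.cpow_add,
    Complex.cpow_natCast]
  · have h1 : (Real.pi : ℂ) ^ s ≠ 0 := by simp [Complex.cpow_eq_zero_iff, hpic]
    have h2 : ((z.im / ‖latticePoint z x‖ ^ 2 : ℝ) : ℂ) ^ s ≠ 0 := by
      simp [Complex.cpow_eq_zero_iff, hyc, hω]
    generalize ((z.im / ‖latticePoint z x‖ ^ 2 : ℝ) : ℂ) ^ s = Q at *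
    generalize (Real.pi : ℂ) ^ s = P at *
    push_cast
    rw [div_pow, ← pow_mul]
    field_simp
  · exact_mod_cast (by positivity : z.im / ‖latticePoint z x‖ ^ 2 ≠ 0)
  · rw [Complex.arg_ofReal_of_nonneg (by positivity)]
    exact hpi.ne

lemma thetaEisenstein_eq (m : ℕ) (z : ℍ) {s : ℂ} (hs : 1 < s.re) :
    thetaEisenstein m z s = theta (2 * m) s * eisensteinSeries (2 * m) z s := by
  have hyc : (z.im : ℂ) ≠ 0 := by exact_mod_cast z.im_pos.ne'
  have hpic : (Real.pi : ℂ) ≠ 0 := by exact_mod_cast Real.pi_ne_zero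
  have h := mellin_eq_tailMellin_add (thetaCoeff_eq_zero_or m z) (σ := m + 1) (by positivity)
    (K := 2 * m + 1) (δ := thetaConst m) ?_ (fun t ht => hasSum_thetaTail m z ht) ?_
    (fun M hM => summable_thetaCoeff_div m z hM) (s := s + m) (by simp; linarith)
  · rw [mellin_thetaTail m z hs, latticeSum_eq (by simp) hs] at h
    -- The shift by `m` does not affect the polar terms: either `m = 0`, or their coefficient is
    -- zero.
    have h2 : thetaConst m * (1 / (s + m) + 1 / (((2 * m + 1 : ℕ) : ℂ) - (s + m))) =
        thetaConst m * (1 / s + 1 / (1 - s)) := by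
      rcases eq_or_ne m 0 with rfl | hm
      · simp
      · simp [thetaConst, hm]
    have h3 : (((2 * m + 1 : ℕ) : ℂ) - (s + m)) = 1 - s + m := by push_cast; ring
    rw [h2, h3] at h
    rw [thetaEisenstein, eisensteinTail, eisensteinTail, ← h, theta]
    have h4 : ((|(2 * m : ℤ)| : ℤ) : ℂ) / 2 = m := by
      rw [abs_of_nonneg (by positivity)]; push_cast; ring
    rw [h4]
    field_simp
  · rcases eq_or_ne m 0 with rfl | hm
    · right; simp
    · left; simp [thetaConst, hm]
  · intro t ht
    simp only [thetaTail, add_sub_cancel]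
    exact thetaSeries_functional_equation (by simp) z ht

lemma isContinuation_thetaEisenstein (m : ℕ) (z : ℍ) :
    IsContinuation (2 * m) z (thetaEisenstein m z) := by
  refine ⟨?_, fun s hs => thetaEisenstein_eq m z hs⟩
  have h := differentiable_eisensteinTail m z
  have h1 : Differentiable ℂ fun s => eisensteinTail m z s + eisensteinTail m z (1 - s) :=
    h.add (h.comp (differentiable_id.const_sub 1))
  refine DifferentiableOn.const_mul (h1.differentiableOn.sub ?_) _
  rcases eq_or_ne m 0 with rfl | hm
  · intro s hs
    obtain ⟨h0, h1⟩ := hs (by simp)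
    have h1' : 1 - s ≠ 0 := sub_ne_zero.mpr h1.symm
    have e1 : DifferentiableAt ℂ (fun s : ℂ => 1 / s) s :=
      (differentiableAt_const _).div differentiableAt_id h0
    have e2 : DifferentiableAt ℂ (fun s : ℂ => 1 / (1 - s)) s :=
      (differentiableAt_const _).div (differentiableAt_id.const_sub 1) h1'
    exact ((e1.add e2).const_mul _).differentiableWithinAt
  · simp [thetaConst, hm]

/-- Nonnegative weights come from theta integrals; `s ↦ conj (F (conj s))` passes to the opposite
weight and remains holomorphic. -/
lemma exists_isContinuation {k : ℤ} (hk : Even k) (z : ℍ) : ∃ F, IsContinuation k z F := by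
  have hnn : ∀ k : ℤ, Even k → 0 ≤ k → ∃ F, IsContinuation k z F := by
    intro k hk hk0
    obtain ⟨m, rfl⟩ := (even_iff_exists_two_mul).mp hk
    lift m to ℕ using by lia
    exact ⟨_, isContinuation_thetaEisenstein m z⟩
  rcases le_total 0 k with h | h
  · exact hnn k hk h
  · obtain ⟨F, hF1, hF2⟩ := hnn (-k) hk.neg (by lia)
    refine ⟨fun s => conj (F (conj s)), fun s hs => ?_, fun s hs => ?_⟩
    · have hs' : conj s ∈ eisensteinDomain (-k) := by
        intro h0
        obtain ⟨h1, h2⟩ := hs (by lia)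
        refine ⟨by simpa using h1, fun h => h2 ?_⟩
        rw [← Complex.conj_conj s, h, map_one]
      have hopen : IsOpen (eisensteinDomain (-k)) := by
        by_cases hk0 : -k = 0
        · have : eisensteinDomain (-k) = ({0, 1} : Set ℂ)ᶜ := by
            ext s; simp [eisensteinDomain, hk0]
          rw [this]
          exact (Set.toFinite _).isClosed.isOpen_compl
        · have : eisensteinDomain (-k) = Set.univ := by
            ext s; simp [eisensteinDomain]; lia
          rw [this]; exact isOpen_univ
      have := (hF1.differentiableAt (hopen.mem_nhds hs')).conj_conj
      rw [Complex.conj_conj] at this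
      exact this.differentiableWithinAt
    · have hs' : 1 < (conj s).re := by simpa using hs
      have hs1 : 1 < (s).re := hs
      have e : ∀ s : ℂ, 1 < s.re → ∀ k : ℤ, Even k → theta k s * eisensteinSeries k z s =
          1 / 2 * (Real.pi : ℂ) ^ (-s) * Complex.Gamma (s + ((|k| : ℤ) : ℂ) / 2) *
            latticeSum k s z := by
        intro s hs k hk
        rw [latticeSum_eq hk hs, theta]; ring
      change conj (F (conj s)) = _
      rw [hF2 _ hs', e _ hs' _ hk.neg, e _ hs1 _ hk, map_mul, conj_latticeSum, neg_neg, map_mul,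
        map_mul, ← Complex.Gamma_conj, abs_neg]
      simp only [map_add, map_div₀, map_one, map_ofNat, Complex.conj_conj, map_intCast]
      rw [← map_neg, Complex.cpow_conj, Complex.conj_ofReal, Complex.conj_conj]
      rw [Complex.arg_ofReal_of_nonneg Real.pi_pos.le]
      exact Real.pi_pos.ne

/-! ### Measurability in `z` and values of the completed series -/

lemma measurable_latticePoint (x : Fin 2 → ℤ) : Measurable fun z : ℍ => latticePoint z x := by
  unfold latticePoint
  exact Continuous.measurable (by fun_prop)

lemma measurable_latticeSum (k : ℤ) {s : ℂ} (hs : 1 < s.re) :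
    Measurable fun z : ℍ => latticeSum k s z := by
  refine measurable_of_tendsto_metrizable' (Filter.atTop : Filter (Finset (Fin 2 → ℤ)))
    (f := fun t z => ∑ x ∈ t, latticeTerm k s z x) (fun t => ?_) ?_
  · refine Finset.measurable_sum _ fun x _ => ?_
    have h := measurable_latticePoint x
    have h2 : Measurable fun z : ℍ => z.im := UpperHalfPlane.continuous_im.measurable
    unfold latticeTerm
    fun_prop
  · rw [tendsto_pi_nhds]
    exact fun z => (summable_latticeTerm k hs z).hasSum

/-- The integrand is jointly measurable in `(z, t)` as a limit of finite lattice sums. It is set to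
zero for `t ≤ 0`, where the expansion is not available. -/
lemma measurable_eisensteinTail (m : ℕ) (s : ℂ) :
    Measurable fun z : ℍ => eisensteinTail m z s := by
  let g : ℍ × ℝ → ℂ := fun p => if 0 < p.2 then thetaTail m p.1 p.2 else 0
  have hg : Measurable g := by
    refine measurable_of_tendsto_metrizable' (Filter.atTop : Filter (Finset (Fin 2 → ℤ)))
      (f := fun t p => if 0 < p.2 then ∑ x ∈ t, thetaCoeff m p.1 x *
        (Real.exp (-thetaExponent p.1 x * p.2) : ℂ) else 0) (fun t => ?_) ?_
    · refine Measurable.ite (measurableSet_lt measurable_const measurable_snd) ?_ measurable_const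
      refine Finset.measurable_sum _ fun x _ => ?_
      have h := measurable_latticePoint x
      have h2 : Measurable fun z : ℍ => z.im := UpperHalfPlane.continuous_im.measurable
      have h3 : Measurable fun z : ℍ => thetaCoeff m z x := by
        unfold thetaCoeff
        split_ifs
        · exact measurable_const
        · exact (Complex.continuous_conj.measurable.comp h).pow_const _
      have h4 : Measurable fun z : ℍ => thetaExponent z x := by
        unfold thetaExponent
        fun_prop
      fun_prop
    · rw [tendsto_pi_nhds]
      intro p
      by_cases hp : 0 < p.2
      · simp only [g, if_pos hp]
        exact hasSum_thetaTail m p.1 hp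
      · simp only [g, if_neg hp]
        exact tendsto_const_nhds
  have h : Measurable fun p : ℍ × ℝ => (p.2 : ℂ) ^ (s + m - 1) * g p := by fun_prop
  have := (h.stronglyMeasurable.integral_prod_right'
    (ν := (volume.restrict (Set.Ioi (1 : ℝ))))).measurable
  convert this using 2 with z
  unfold eisensteinTail tailMellin
  refine setIntegral_congr_fun measurableSet_Ioi fun t ht => ?_
  have : (0 : ℝ) < t := lt_trans one_pos ht
  simp [g, this]

lemma completedEisenstein_eq_of_isContinuation {k : ℤ} {z : ℍ} {F : ℂ → ℂ}
    (hF : IsContinuation k z F) {s : ℂ} (hs : s ∈ eisensteinDomain k) :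
    completedEisenstein k z s = F s := by
  have h : ∃ F, IsContinuation k z F := ⟨F, hF⟩
  rw [completedEisenstein, dif_pos h]
  exact h.choose_spec.eqOn hF hs

lemma completedEisenstein_eq_latticeSum {k : ℤ} (hk : Even k) (z : ℍ) {s : ℂ} (hs : 1 < s.re) :
    completedEisenstein k z s = 1 / 2 * (Real.pi : ℂ) ^ (-s) *
      Complex.Gamma (s + ((|k| : ℤ) : ℂ) / 2) * latticeSum k s z := by
  have h := exists_isContinuation hk z
  rw [completedEisenstein, dif_pos h, h.choose_spec.2 s hs, latticeSum_eq hk hs, theta]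
  ring

/-! ### The hyperbolic measure and the size of the fundamental domain -/

/-- The measure `dy / y ^ 2` on the positive half-line. -/
def heightMeasure : Measure ℝ :=
  (volume.restrict (Set.Ioi 0)).withDensity fun y => ((1 / ‖y‖₊) ^ 2 : NNReal)

instance : SFinite heightMeasure := by
  unfold heightMeasure
  infer_instance

def reIm (z : ℍ) : ℝ × ℝ := (z.re, z.im)

lemma measurableEmbedding_reIm : MeasurableEmbedding reIm :=
  Complex.measurableEquivRealProd.measurableEmbedding.comp
    UpperHalfPlane.measurableEmbedding_coe

lemma measurePreserving_reIm :
    MeasurePreserving reIm volume ((volume : Measure ℝ).prod heightMeasure) := by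
  refine ⟨measurableEmbedding_reIm.measurable, ?_⟩
  have hprod : (volume : Measure ℝ).prod heightMeasure =
      (volume.restrict (Set.univ ×ˢ Set.Ioi (0 : ℝ))).withDensity
        fun p : ℝ × ℝ => ((1 / ‖p.2‖₊) ^ 2 : NNReal) := by
    rw [heightMeasure, prod_withDensity_right (by fun_prop), Measure.volume_eq_prod,
      ← Measure.prod_restrict, Measure.restrict_univ]
  ext A hA
  rw [Measure.map_apply measurableEmbedding_reIm.measurable hA, volume_eq_lintegral, hprod,
    withDensity_apply _ hA, Measure.restrict_restrict hA]
  have himg : UpperHalfPlane.coe '' (reIm ⁻¹' A) =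
      Complex.measurableEquivRealProd ⁻¹' (A ∩ Set.univ ×ˢ Set.Ioi (0 : ℝ)) := by
    ext z
    constructor
    · rintro ⟨τ, h, rfl⟩
      exact ⟨h, ⟨trivial, τ.im_pos⟩⟩
    · rintro ⟨h, -, h0⟩
      exact ⟨⟨z, h0⟩, h, rfl⟩
  rw [himg, ← Complex.volume_preserving_equiv_real_prod.setLIntegral_comp_preimage_emb
    Complex.measurableEquivRealProd.measurableEmbedding]
  rfl

lemma heightMeasure_Ici_lt_top {a : ℝ} (ha : 0 < a) : heightMeasure (Set.Ici a) < ⊤ := by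
  rw [heightMeasure, withDensity_apply _ measurableSet_Ici,
    Measure.restrict_restrict measurableSet_Ici,
    Set.inter_eq_left.mpr (Set.Ici_subset_Ioi.mpr ha)]
  have h := (integrableOn_Ici_iff_integrableOn_Ioi' (by simp)).mpr
    (integrableOn_Ioi_rpow_of_lt (by norm_num : (-2 : ℝ) < -1) ha)
  refine lt_of_le_of_lt (le_of_eq ?_) h.hasFiniteIntegral
  refine setLIntegral_congr_fun measurableSet_Ici fun y hy => ?_
  have hy : 0 < y := lt_of_lt_of_le ha hy
  simp only [enorm_eq_nnnorm]
  congr 1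
  rw [← NNReal.coe_inj, coe_nnnorm, Real.norm_of_nonneg (by positivity), Real.rpow_neg hy.le]
  simp [abs_of_pos hy]

lemma volume_fd_lt_top : volume 𝒟 < ⊤ := by
  have hsub : 𝒟 ⊆ reIm ⁻¹' (Set.Icc (-(1 / 2)) (1 / 2) ×ˢ Set.Ici (1 / 2)) :=
    fun z hz => ⟨abs_le.mp hz.2, half_le_im_of_mem_fd hz⟩
  refine lt_of_le_of_lt (measure_mono hsub) ?_
  rw [measurePreserving_reIm.measure_preimage
    (measurableSet_Icc.prod measurableSet_Ici).nullMeasurableSet, Measure.prod_prod,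
    Real.volume_Icc]
  exact ENNReal.mul_lt_top ENNReal.ofReal_lt_top (heightMeasure_Ici_lt_top (by norm_num))

lemma volume_fd_diff_fdo : volume (𝒟 \ 𝒟ᵒ) = 0 := by
  have hline : ∀ c : ℝ, volume {z : ℍ | z.re = c} = 0 := by
    intro c
    have : {z : ℍ | z.re = c} = reIm ⁻¹' ({c} ×ˢ Set.univ) := by ext z; simp [reIm]
    rw [this, measurePreserving_reIm.measure_preimage
      ((measurableSet_singleton c).prod MeasurableSet.univ).nullMeasurableSet, Measure.prod_prod]
    simp
  have hcirc : volume {z : ℍ | Complex.normSq z = 1} = 0 := by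
    rw [volume_def]
    refine withDensity_absolutelyContinuous _ _ ?_
    rw [measurableEmbedding_coe.comap_apply]
    refine measure_mono_null ?_ (Measure.addHaar_sphere (volume : Measure ℂ) 0 1)
    rintro _ ⟨z, hz, rfl⟩
    have hz : Complex.normSq z = 1 := hz
    rw [Complex.normSq_eq_norm_sq] at hz
    rw [mem_sphere_zero_iff_norm]
    nlinarith [norm_nonneg (z : ℂ)]
  refine measure_mono_null (t := {z : ℍ | Complex.normSq z = 1} ∪
    ({z : ℍ | z.re = 1 / 2} ∪ {z : ℍ | z.re = -(1 / 2)})) ?_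
    (measure_union_null hcirc (measure_union_null (hline _) (hline _)))
  rintro z ⟨⟨h1, h2⟩, h3⟩
  by_contra hc
  simp only [Set.mem_union, Set.mem_ofPred_eq, not_or] at hc
  refine h3 ⟨lt_of_le_of_ne h1 (Ne.symm hc.1), lt_of_le_of_ne h2 fun h => ?_⟩
  rcases abs_eq (by norm_num : (0 : ℝ) ≤ 1 / 2) |>.mp h with h | h
  · exact hc.2.1 h
  · exact hc.2.2 h

/-! ### Fundamental domains for translations, and unfolding -/

instance : SMulInvariantMeasure SL(2, ℤ) ℍ volume :=
  ⟨fun c _ hs => measure_preimage_smul_of_nullMeasurableSet (G := GL (Fin 2) ℝ) (μ := volume)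
    (hs.nullMeasurableSet) (c : GL (Fin 2) ℝ)⟩

instance : MeasurableConstSMul SL(2, ℤ) ℍ :=
  ⟨fun c => measurable_const_smul (M := GL (Fin 2) ℝ) (c : GL (Fin 2) ℝ)⟩

/-- Two translates can meet only along boundary points. The case `g = -h` is excluded because `-1`
acts trivially. -/
lemma aedisjoint_smul_fd {g h : SL(2, ℤ)} (hgh : g ≠ h) (hgh' : g ≠ -h) :
    AEDisjoint volume (g • 𝒟) (h • 𝒟) := by
  refine measure_mono_null (t := g • (𝒟 \ 𝒟ᵒ)) ?_ ?_
  · rintro _ ⟨⟨z, hz, rfl⟩, ⟨z', hz', h2⟩⟩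
    refine ⟨z, ⟨hz, fun hz0 => ?_⟩, rfl⟩
    have : (h⁻¹ * g) • z ∈ 𝒟 := by
      simp only at h2
      rw [mul_smul, ← h2, inv_smul_smul]
      exact hz'
    rcases ModularGroup.eq_one_or_neg_one_of_mem_fdo_mem_fd hz0 this with h3 | h3
    · exact hgh (inv_mul_eq_one.mp h3).symm
    · apply hgh'
      rw [inv_mul_eq_iff_eq_mul] at h3
      simpa using h3
  · rw [measure_smul, volume_fd_diff_fdo]

lemma T_zpow_ne_neg (i j : ℤ) : ModularGroup.T ^ i ≠ -ModularGroup.T ^ j := by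
  intro h
  have := congrArg (fun g : SL(2, ℤ) => g 0 0) h
  simp [ModularGroup.coe_T_zpow] at this

/-- The set of cosets of `Γ_∞`. -/
abbrev Cosets := Quotient (QuotientGroup.rightRel gammaInfty)

instance : Countable SL(2, ℤ) :=
  inferInstanceAs (Countable {A : Fin 2 → Fin 2 → ℤ // Matrix.det (Matrix.of A) = 1})

instance : Countable Cosets := Quotient.countable

lemma eq_of_mul_out_eq {g h : SL(2, ℤ)} (hg : g ∈ gammaInfty) (hh : h ∈ gammaInfty) {p q : Cosets}
    (e : g * p.out = h * q.out) : p = q := by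
  rw [← p.out_eq, ← q.out_eq]
  refine Quotient.sound ?_
  change QuotientGroup.rightRel gammaInfty _ _
  rw [QuotientGroup.rightRel_apply]
  have : q.out * p.out⁻¹ = h⁻¹ * g := by
    rw [mul_inv_eq_iff_eq_mul, mul_assoc, e, inv_mul_cancel_left]
  rw [this]
  exact mul_mem (inv_mem hh) hg

lemma neg_mem_gammaInfty {g : SL(2, ℤ)} (hg : g ∈ gammaInfty) : -g ∈ gammaInfty := by
  rw [mem_gammaInfty_iff] at *
  simpa using hg

lemma T_zpow_mem_gammaInfty (n : ℤ) : ModularGroup.T ^ n ∈ gammaInfty := ⟨n, Or.inl rfl⟩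

/-- Modulo `±1`, `Γ_∞` is generated by `T`, so one copy of `𝒟` per coset tiles a fundamental domain
for `⟨T⟩`. Comparing it with the vertical strip is what unfolds the Eisenstein series. -/
lemma isFundamentalDomain_iUnion_out_smul_fd :
    IsFundamentalDomain (Subgroup.zpowers ModularGroup.T) (⋃ q : Cosets, q.out • 𝒟) where
  nullMeasurableSet := MeasurableSet.nullMeasurableSet <|
    MeasurableSet.iUnion fun q => ModularGroup.isClosed_fd.measurableSet.const_smul _
  ae_covers := by
    refine Filter.Eventually.of_forall fun z => ?_
    obtain ⟨g, hg⟩ := ModularGroup.exists_smul_mem_fd z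
    set q : Cosets := Quotient.mk _ g⁻¹
    have hq : QuotientGroup.rightRel gammaInfty g⁻¹ q.out := Quotient.exact q.out_eq.symm
    rw [QuotientGroup.rightRel_apply, inv_inv] at hq
    obtain ⟨n, hn⟩ := hq
    refine ⟨⟨ModularGroup.T ^ n, n, rfl⟩, Set.mem_iUnion.mpr ⟨q, g • z, hg, ?_⟩⟩
    change q.out • g • z = ModularGroup.T ^ n • z
    rw [← mul_smul]
    rcases hn with hn | hn
    · rw [hn]
    · rw [hn, ModularGroup.SL_neg_smul]
  aedisjoint := by
    rintro ⟨_, i, rfl⟩ ⟨_, j, rfl⟩ hij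
    change AEDisjoint volume (ModularGroup.T ^ i • ⋃ q : Cosets, q.out • 𝒟)
      (ModularGroup.T ^ j • ⋃ q : Cosets, q.out • 𝒟)
    have hij' : ModularGroup.T ^ i ≠ ModularGroup.T ^ j := fun h => hij (Subtype.ext h)
    rw [Set.smul_set_iUnion, Set.smul_set_iUnion, AEDisjoint.iUnion_left_iff]
    intro p
    rw [AEDisjoint.iUnion_right_iff]
    intro q
    rw [smul_smul, smul_smul]
    refine aedisjoint_smul_fd (fun h => ?_) (fun h => ?_)
    · have := eq_of_mul_out_eq (T_zpow_mem_gammaInfty _) (T_zpow_mem_gammaInfty _) h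
      subst this
      exact hij' (mul_right_cancel h)
    · rw [← neg_mul] at h
      have := eq_of_mul_out_eq (T_zpow_mem_gammaInfty _)
        (neg_mem_gammaInfty (T_zpow_mem_gammaInfty _)) h
      subst this
      exact T_zpow_ne_neg _ _ (mul_right_cancel h)

/-- A vertical strip of width one. -/
def strip : Set ℍ := {z | z.re ∈ Set.Ioc (0 : ℝ) 1}

lemma strip_eq : strip = reIm ⁻¹' (Set.Ioc 0 1 ×ˢ Set.univ) := by
  ext z
  simp [strip, reIm]

lemma measurableSet_strip : MeasurableSet strip := by
  rw [strip_eq]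
  exact measurableEmbedding_reIm.measurable (measurableSet_Ioc.prod MeasurableSet.univ)

lemma isFundamentalDomain_strip :
    IsFundamentalDomain (Subgroup.zpowers ModularGroup.T) strip := by
  refine IsFundamentalDomain.mk' measurableSet_strip.nullMeasurableSet fun z => ?_
  obtain ⟨n, hn, huniq⟩ := existsUnique_add_zsmul_mem_Ioc one_pos z.re 0
  have key : ∀ n : ℤ, ModularGroup.T ^ n • z ∈ strip ↔ z.re + n • (1 : ℝ) ∈ Set.Ioc (0 : ℝ) (0 + 1) := by
    intro n
    have : (ModularGroup.T ^ n • z).re = z.re + n • (1 : ℝ) := by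
      rw [← coe_re, ModularGroup.coe_T_zpow_smul_eq]
      simp
    change (ModularGroup.T ^ n • z).re ∈ Set.Ioc (0 : ℝ) 1 ↔ _
    rw [this, zero_add]
  refine ⟨⟨ModularGroup.T ^ n, n, rfl⟩, (key n).mpr hn, ?_⟩
  rintro ⟨_, m, rfl⟩ hm
  rw [huniq m ((key m).mp hm)]

section Unfolding

variable {F : ℍ → ℂ}

lemma T_zpow_invariant {α : Type*} {F : ℍ → α} (hF : ∀ z, F (ModularGroup.T • z) = F z)
    (g : Subgroup.zpowers ModularGroup.T) (z : ℍ) : F (g • z) = F z := by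
  obtain ⟨_, n, rfl⟩ := g
  change F (ModularGroup.T ^ n • z) = F z
  induction n using Int.induction_on generalizing z with
  | zero => simp
  | succ n ih => rw [zpow_add_one, mul_smul, ih, hF]
  | pred n ih =>
    rw [zpow_sub_one, mul_smul, ih]
    conv_rhs => rw [← smul_inv_smul ModularGroup.T z, hF]

lemma pairwise_aedisjoint_out_smul_fd :
    Pairwise (Function.onFun (AEDisjoint volume) fun q : Cosets => q.out • 𝒟) := by
  intro p q hpq
  refine aedisjoint_smul_fd (fun h => ?_) (fun h => ?_)
  · exact hpq (eq_of_mul_out_eq (one_mem _) (one_mem _) (by simpa using h))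
  · exact hpq (eq_of_mul_out_eq (one_mem _) (neg_mem_gammaInfty (one_mem _)) (by simpa using h))

lemma nullMeasurableSet_smul_fd (g : SL(2, ℤ)) : NullMeasurableSet (g • 𝒟) :=
  (ModularGroup.isClosed_fd.measurableSet.const_smul g).nullMeasurableSet

lemma lintegral_strip_eq_tsum {F : ℍ → ENNReal} (hF : ∀ z, F (ModularGroup.T • z) = F z) :
    ∫⁻ z in strip, F z = ∑' q : Cosets, ∫⁻ z in 𝒟, F (q.out • z) := by
  rw [isFundamentalDomain_strip.setLIntegral_eq isFundamentalDomain_iUnion_out_smul_fd F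
    (T_zpow_invariant hF), lintegral_iUnion₀ (fun q => nullMeasurableSet_smul_fd _)
    pairwise_aedisjoint_out_smul_fd]
  refine tsum_congr fun q => ?_
  exact ((measurePreserving_smul q.out volume).setLIntegral_comp_emb
    (measurableEmbedding_const_smul _) _ _).symm

lemma integral_strip_eq_tsum (hF : ∀ z, F (ModularGroup.T • z) = F z) (hi : IntegrableOn F strip) :
    ∫ z in strip, F z = ∑' q : Cosets, ∫ z in 𝒟, F (q.out • z) := by
  rw [isFundamentalDomain_strip.setIntegral_eq isFundamentalDomain_iUnion_out_smul_fd
    (T_zpow_invariant hF), ← (hasSum_integral_iUnion_ae (fun q => nullMeasurableSet_smul_fd _)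
    pairwise_aedisjoint_out_smul_fd ?_).tsum_eq]
  · refine tsum_congr fun q => ?_
    exact (measurePreserving_smul q.out volume).setIntegral_image_emb
      (measurableEmbedding_const_smul _) _ _
  · exact (isFundamentalDomain_strip.integrableOn_iff isFundamentalDomain_iUnion_out_smul_fd
      (T_zpow_invariant hF)).mp hi

/-- The unfolding principle. -/
lemma integral_fd_tsum_eq (hF : ∀ z, F (ModularGroup.T • z) = F z) (hi : IntegrableOn F strip)
    (hm : Measurable F) :
    ∫ z in 𝒟, ∑' q : Cosets, F (q.out • z) = ∫ z in strip, F z := by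
  rw [integral_strip_eq_tsum hF hi]
  refine (hasSum_integral_of_tsum_lintegral (fun q => ?_) ?_).tsum_eq.symm
  · exact (hm.comp (measurable_const_smul q.out)).aestronglyMeasurable
  · rw [← lintegral_strip_eq_tsum (F := fun z => ‖F z‖ₑ) (fun z => by rw [hF z])]
    exact hi.hasFiniteIntegral.ne

end Unfolding

/-! ### Gamma and beta integrals with complex parameters -/

section GammaIntegrals

lemma integrableOn_rpow_mul_exp {p c : ℝ} (hp : 0 < p) (hc : 0 < c) :
    IntegrableOn (fun t : ℝ => t ^ (p - 1) * Real.exp (-(c * t))) (Set.Ioi 0) := by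
  simpa using integrableOn_rpow_mul_exp_neg_mul_rpow (p := 1) (s := p - 1) (b := c) (by linarith)
    one_pos hc

lemma norm_cpow_mul_exp {t : ℝ} (ht : 0 < t) (a r : ℂ) :
    ‖(t : ℂ) ^ (a - 1) * Complex.exp (-(r * t))‖ = t ^ (a.re - 1) * Real.exp (-(r.re * t)) := by
  rw [norm_mul, Complex.norm_cpow_eq_rpow_re_of_pos ht, Complex.norm_exp]
  simp

lemma integrableOn_cpow_mul_exp {a r : ℂ} (ha : 0 < a.re) (hr : 0 < r.re) :
    IntegrableOn (fun t : ℝ => (t : ℂ) ^ (a - 1) * Complex.exp (-(r * t))) (Set.Ioi 0) := by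
  refine (integrableOn_rpow_mul_exp ha hr).mono' (Measurable.aestronglyMeasurable (by fun_prop)) ?_
  filter_upwards [ae_restrict_mem measurableSet_Ioi] with t ht
  rw [norm_cpow_mul_exp ht]

/-- Gamma integral with a complex scale. -/
lemma integral_cpow_mul_exp {a r : ℂ} (ha : 0 < a.re) (hr : 0 < r.re) :
    ∫ t : ℝ in Set.Ioi 0, (t : ℂ) ^ (a - 1) * Complex.exp (-(r * t)) =
      r ^ (-a) * Complex.Gamma a := by
  have hU : IsOpen {r : ℂ | 0 < r.re} := isOpen_lt continuous_const Complex.continuous_re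
  have hconv : IsPreconnected {r : ℂ | 0 < r.re} := (convex_halfSpace_re_gt 0).isPreconnected
  have h1 : DifferentiableOn ℂ
      (fun r : ℂ => ∫ t : ℝ in Set.Ioi 0, (t : ℂ) ^ (a - 1) * Complex.exp (-(r * t)))
      {r : ℂ | 0 < r.re} := by
    refine differentiableOn_integral_of_locally_dominated hU
      (fun r hr => (integrableOn_cpow_mul_exp ha hr).aestronglyMeasurable)
      (Filter.Eventually.of_forall fun t => ?_) fun r₀ hr₀ => ?_
    · fun_prop
    · have hr₀ : 0 < r₀.re := hr₀
      refine ⟨{r | r₀.re / 2 < r.re}, (isOpen_lt continuous_const Complex.continuous_re).mem_nhds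
        (by change r₀.re / 2 < r₀.re; linarith), _,
        integrableOn_rpow_mul_exp ha (half_pos hr₀), ?_⟩
      filter_upwards [ae_restrict_mem measurableSet_Ioi] with t ht r hr
      have ht : 0 < t := ht
      have hr : r₀.re / 2 < r.re := hr
      rw [norm_cpow_mul_exp ht]
      gcongr
  have h2 : DifferentiableOn ℂ (fun r : ℂ => r ^ (-a) * Complex.Gamma a) {r : ℂ | 0 < r.re} := by
    refine DifferentiableOn.mul_const (fun r hr => ?_) _
    exact (differentiableAt_id.cpow_const (Or.inl hr)).differentiableWithinAt
  refine (h1.analyticOnNhd hU).eqOn_of_preconnected_of_frequently_eq (h2.analyticOnNhd hU) hconv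
    (z₀ := ((1 : ℝ) : ℂ)) (by simp) ?_ hr
  have ht : Filter.Tendsto (fun x : ℝ => (x : ℂ)) (nhdsWithin 1 {1}ᶜ)
      (nhdsWithin ((1 : ℝ) : ℂ) {((1 : ℝ) : ℂ)}ᶜ) := by
    refine tendsto_nhdsWithin_of_tendsto_nhds_of_eventually_within _ ?_ ?_
    · exact (Complex.continuous_ofReal.tendsto 1).mono_left nhdsWithin_le_nhds
    · filter_upwards [self_mem_nhdsWithin] with x hx
      simpa using hx
  -- The formula is known for real `r > 0`; these points accumulate at `1`, which suffices for the
  -- identity theorem in the right half-plane.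
  refine ht.frequently (Filter.Eventually.frequently ?_)
  filter_upwards [nhdsWithin_le_nhds (Ioi_mem_nhds (zero_lt_one' ℝ))] with x hx
  have hx : 0 < x := hx
  rw [Complex.integral_cpow_mul_exp_neg_mul_Ioi ha hx, Complex.cpow_neg, one_div, Complex.inv_cpow]
  rw [Complex.arg_ofReal_of_nonneg hx.le]
  exact Real.pi_pos.ne

end GammaIntegrals

section Beta

variable {a s : ℂ}

/-- Integrating this kernel first in `p` gives the beta integrand times `Γ(a+s)`, and first in `r`
gives `Γ(a)Γ(s)`; integrability licenses the exchange. -/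
lemma integrable_beta_kernel (ha : 0 < a.re) (hs : 0 < s.re) :
    Integrable (fun q : ℝ × ℝ => (q.1 : ℂ) ^ (a - 1) * ((q.2 : ℂ) ^ (a + s - 1) *
      Complex.exp (-((1 + q.1 : ℝ) * q.2))))
      ((volume.restrict (Set.Ioi 0)).prod (volume.restrict (Set.Ioi 0))) := by
  have key : ∀ p ∈ Set.Ioi (0 : ℝ), ∀ r ∈ Set.Ioi (0 : ℝ),
      (r : ℂ) ^ (a - 1) * ((p : ℂ) ^ (a + s - 1) * Complex.exp (-((1 + r : ℝ) * p))) =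
      (p : ℂ) ^ (a + s - 1) * Complex.exp (-p) * ((r : ℂ) ^ (a - 1) *
        Complex.exp (-((p : ℝ) * r))) := by
    intro p hp r hr
    rw [show (-((1 + r : ℝ) * p) : ℂ) = -p + -((p : ℝ) * r) by push_cast; ring, Complex.exp_add]
    ring
  rw [integrable_prod_iff' (Measurable.aestronglyMeasurable (by fun_prop))]
  constructor
  · filter_upwards [ae_restrict_mem measurableSet_Ioi] with p hp
    refine (IntegrableOn.congr_fun ?_ (fun r hr => (key p hp r hr).symm) measurableSet_Ioi)
    exact (integrableOn_cpow_mul_exp ha (by simpa using hp)).const_mul _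
  · have h : IntegrableOn (fun p : ℝ => Real.Gamma a.re * (p ^ (s.re - 1) * Real.exp (-(1 * p))))
        (Set.Ioi 0) := (integrableOn_rpow_mul_exp hs one_pos).const_mul _
    refine h.congr_fun (fun p hp => ?_) measurableSet_Ioi
    have hp' : 0 < p := hp
    have e : ∀ r ∈ Set.Ioi (0 : ℝ), ‖(r : ℂ) ^ (a - 1) * ((p : ℂ) ^ (a + s - 1) *
        Complex.exp (-((1 + r : ℝ) * p)))‖ = p ^ (a.re + s.re - 1) * Real.exp (-p) *
          (r ^ (a.re - 1) * Real.exp (-(p * r))) := by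
      intro r hr
      rw [key p hp r hr, norm_mul, norm_cpow_mul_exp hr, norm_mul,
        Complex.norm_cpow_eq_rpow_re_of_pos hp, Complex.norm_exp]
      simp
    simp only
    rw [setIntegral_congr_fun measurableSet_Ioi e, integral_const_mul,
      Real.integral_rpow_mul_exp_neg_mul_Ioi ha hp', one_div, Real.inv_rpow hp'.le,
      ← Real.rpow_neg hp'.le, one_mul, show s.re - 1 = (a.re + s.re - 1) + (-a.re) by ring,
      Real.rpow_add hp']
    ring

lemma integral_beta_inner (ha : 0 < a.re) (hs : 0 < s.re) {r : ℝ} (hr : 0 < r) :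
    ∫ p : ℝ in Set.Ioi 0, (r : ℂ) ^ (a - 1) * ((p : ℂ) ^ (a + s - 1) *
      Complex.exp (-((1 + r : ℝ) * p))) =
      Complex.Gamma (a + s) * ((r : ℂ) ^ (a - 1) * ((1 + r : ℝ) : ℂ) ^ (-(a + s))) := by
  rw [integral_const_mul, integral_cpow_mul_exp (by simp; linarith)
    (by rw [Complex.ofReal_re]; positivity)]
  ring

lemma integrableOn_beta (ha : 0 < a.re) (hs : 0 < s.re) :
    IntegrableOn (fun r : ℝ => (r : ℂ) ^ (a - 1) * ((1 + r : ℝ) : ℂ) ^ (-(a + s)))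
      (Set.Ioi 0) := by
  have h := (integrable_beta_kernel ha hs).integral_prod_left
  have hG : Complex.Gamma (a + s) ≠ 0 := Complex.Gamma_ne_zero_of_re_pos (by simp; linarith)
  have h2 := (h.const_mul (Complex.Gamma (a + s))⁻¹)
  refine IntegrableOn.congr_fun h2 (fun r hr => ?_) measurableSet_Ioi
  simp only
  rw [integral_beta_inner ha hs hr, inv_mul_cancel_left₀ hG]

/-- Euler's beta integral over the half-line. -/
lemma integral_beta (ha : 0 < a.re) (hs : 0 < s.re) :
    ∫ r : ℝ in Set.Ioi 0, (r : ℂ) ^ (a - 1) * ((1 + r : ℝ) : ℂ) ^ (-(a + s)) =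
      Complex.Gamma a * Complex.Gamma s / Complex.Gamma (a + s) := by
  have hG : Complex.Gamma (a + s) ≠ 0 := Complex.Gamma_ne_zero_of_re_pos (by simp; linarith)
  rw [eq_div_iff hG, mul_comm, ← integral_const_mul,
    ← setIntegral_congr_fun measurableSet_Ioi fun r hr => integral_beta_inner ha hs hr,
    integral_integral_swap (integrable_beta_kernel ha hs)]
  have h : ∀ p ∈ Set.Ioi (0 : ℝ), ∫ r : ℝ in Set.Ioi 0, (r : ℂ) ^ (a - 1) *
      ((p : ℂ) ^ (a + s - 1) * Complex.exp (-((1 + r : ℝ) * p))) =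
      Complex.Gamma a * ((p : ℂ) ^ (s - 1) * Complex.exp (-(1 * p))) := by
    intro p hp
    have hp' : (p : ℂ) ≠ 0 := by exact_mod_cast ne_of_gt hp
    have e : ∀ r : ℝ, (r : ℂ) ^ (a - 1) * ((p : ℂ) ^ (a + s - 1) *
        Complex.exp (-((1 + r : ℝ) * p))) = (p : ℂ) ^ (a + s - 1) * Complex.exp (-p) *
          ((r : ℂ) ^ (a - 1) * Complex.exp (-((p : ℂ) * r))) := by
      intro r
      rw [show (-((1 + r : ℝ) * p) : ℂ) = -p + -((p : ℝ) * r) by push_cast; ring, Complex.exp_add]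
      ring
    simp_rw [e]
    rw [integral_const_mul, integral_cpow_mul_exp ha (by simpa using hp), one_mul,
      show s - 1 = (a + s - 1) + (-a) by ring, Complex.cpow_add _ _ hp']
    ring
  rw [setIntegral_congr_fun measurableSet_Ioi h, integral_const_mul,
    integral_cpow_mul_exp hs (by simp)]
  simp

end Beta

/-! ### The archimedean integral -/

lemma ofReal_mul_cpow {x : ℝ} (hx : 0 < x) {z : ℂ} (hz : z ≠ 0) (c : ℂ) :
    ((x : ℂ) * z) ^ c = (x : ℂ) ^ c * z ^ c := by
  have hxc : (x : ℂ) ≠ 0 := by exact_mod_cast hx.ne'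
  rw [Complex.cpow_def_of_ne_zero (mul_ne_zero hxc hz), Complex.cpow_def_of_ne_zero hxc,
    Complex.cpow_def_of_ne_zero hz, Complex.log_ofReal_mul hx hz, ← Complex.exp_add,
    Complex.ofReal_log hx.le]
  ring_nf

/-- The function `(ω / |ω|) ^ n |ω| ^ (-2 v)`. -/
def sphericalPower (n : ℕ) (v ω : ℂ) : ℂ := (ω / (‖ω‖ : ℂ)) ^ n * (‖ω‖ : ℂ) ^ (-2 * v)

lemma norm_sphericalPower (n : ℕ) (v : ℂ) {ω : ℂ} (hω : ω ≠ 0) :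
    ‖sphericalPower n v ω‖ = ‖ω‖ ^ (-(2 * v.re)) := by
  have h := norm_pos_iff.mpr hω
  rw [sphericalPower, norm_mul, norm_pow, norm_div, Complex.norm_real, norm_norm, div_self h.ne',
    one_pow, one_mul, Complex.norm_cpow_eq_rpow_re_of_pos h]
  simp

lemma measurable_sphericalPower (n : ℕ) (v : ℂ) : Measurable (sphericalPower n v) := by
  unfold sphericalPower
  fun_prop

/-- With `p = y + ix` one has `x + iy = i * conj p` and `|p|² = p * conj p`. As `p` lies in the
right half-plane, principal powers split; `i ^ (2m)` gives the sign. -/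
lemma sphericalPower_eq (m : ℕ) (v : ℂ) (x : ℝ) {y : ℝ} (hy : 0 < y) :
    sphericalPower (2 * m) v (x + y * Complex.I) =
      (-1) ^ m * (((y : ℂ) - x * Complex.I) ^ (-(v - m)) *
        ((y : ℂ) + x * Complex.I) ^ (-(v + m))) := by
  set p : ℂ := (y : ℂ) + x * Complex.I with hp
  have hpre : p.re = y := by simp [hp]
  have hp0 : p ≠ 0 := by
    intro h
    rw [h] at hpre
    simp at hpre
    linarith
  have hpc : (y : ℂ) - x * Complex.I = conj p := by simp [hp, sub_eq_add_neg]
  have hc0 : conj p ≠ 0 := by simpa using hp0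
  have hω : (x : ℂ) + y * Complex.I = Complex.I * conj p := by
    rw [← hpc]
    linear_combination (x : ℂ) * Complex.I_sq
  have hn := norm_pos_iff.mpr hp0
  have hnc : (‖p‖ : ℂ) ≠ 0 := by exact_mod_cast hn.ne'
  have hnorm : ‖(x : ℂ) + y * Complex.I‖ = ‖p‖ := by rw [hω]; simp
  have hsq : (‖p‖ : ℂ) ^ 2 = conj p * p := by
    rw [mul_comm, Complex.mul_conj, Complex.normSq_eq_norm_sq]
    push_cast; ring
  have harg : p.arg ≠ Real.pi := by
    intro h
    have := (Complex.arg_eq_pi_iff.mp h).1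
    linarith
  have hpow : (‖p‖ : ℂ) ^ (-2 * v) = conj p ^ (-v) * p ^ (-v) := by
    have hl : Complex.log (conj p) + Complex.log p = 2 * Complex.log ‖p‖ := by
      rw [Complex.log_conj _ harg, add_comm, Complex.add_conj, Complex.log_re, Complex.ofReal_mul,
        Complex.ofReal_log hn.le]
      simp
    rw [Complex.cpow_def_of_ne_zero hnc, Complex.cpow_def_of_ne_zero hc0,
      Complex.cpow_def_of_ne_zero hp0, ← Complex.exp_add, ← add_mul, hl]
    ring_nf
  rw [sphericalPower, hnorm, hpc, hω, hpow, neg_sub, neg_add, Complex.cpow_sub _ _ hc0,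
    Complex.cpow_add _ _ hp0, Complex.cpow_neg p (m : ℂ), Complex.cpow_natCast,
    Complex.cpow_natCast, Complex.cpow_neg, mul_div_assoc, mul_pow, div_pow, pow_mul Complex.I,
    Complex.I_sq, pow_mul (‖p‖ : ℂ), hsq]
  have h2 : conj p ^ v ≠ 0 := by rw [Ne, Complex.cpow_eq_zero_iff]; tauto
  field_simp
  rw [mul_pow, two_mul, pow_add]
  ring

section Decay

/-- The constant `∫ (1 + x²) ^ (-σ / 2) dx`. -/
def decayConst (σ : ℝ) : ℝ := ∫ x : ℝ, (1 + ‖x‖ ^ 2) ^ (-σ / 2)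

lemma norm_add_mul_I_rpow (σ x : ℝ) {y : ℝ} (hy : 0 < y) :
    ‖(x : ℂ) + y * Complex.I‖ ^ (-σ) = y ^ (-σ) * (1 + ‖y⁻¹ * x‖ ^ 2) ^ (-σ / 2) := by
  have h : ‖(x : ℂ) + y * Complex.I‖ = (y ^ 2 * (1 + ‖y⁻¹ * x‖ ^ 2)) ^ (1 / 2 : ℝ) := by
    rw [Complex.norm_add_mul_I, Real.sqrt_eq_rpow]
    congr 1
    rw [Real.norm_eq_abs, sq_abs]
    field_simp
    ring
  rw [h, ← Real.rpow_mul (by positivity), Real.mul_rpow (by positivity) (by positivity),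
    ← Real.rpow_natCast, ← Real.rpow_mul hy.le]
  congr 2 <;> push_cast <;> ring

lemma integrable_norm_add_mul_I_rpow {σ y : ℝ} (hσ : 1 < σ) (hy : 0 < y) :
    Integrable fun x : ℝ => ‖(x : ℂ) + y * Complex.I‖ ^ (-σ) := by
  simp_rw [fun x => norm_add_mul_I_rpow σ x hy]
  have h : Integrable fun x : ℝ => (1 + ‖x‖ ^ 2) ^ (-σ / 2) :=
    integrable_rpow_neg_one_add_norm_sq (by simpa using hσ)
  exact (h.comp_mul_left' (inv_ne_zero hy.ne')).const_mul _

lemma integral_norm_add_mul_I_rpow (σ : ℝ) {y : ℝ} (hy : 0 < y) :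
    ∫ x : ℝ, ‖(x : ℂ) + y * Complex.I‖ ^ (-σ) = decayConst σ * y ^ (1 - σ) := by
  simp_rw [fun x => norm_add_mul_I_rpow σ x hy]
  rw [integral_const_mul, Measure.integral_comp_mul_left (fun x => (1 + ‖x‖ ^ 2) ^ (-σ / 2)),
    inv_inv, abs_of_pos hy, smul_eq_mul, decayConst, sub_eq_add_neg, Real.rpow_add hy,
    Real.rpow_one]
  ring

lemma add_mul_I_ne_zero (x : ℝ) {y : ℝ} (hy : 0 < y) : (x : ℂ) + y * Complex.I ≠ 0 := by
  intro h
  have := congrArg Complex.im h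
  simp at this
  linarith

lemma lintegral_sphericalPower (n : ℕ) {v : ℂ} (hv : 1 / 2 < v.re) {y : ℝ} (hy : 0 < y) :
    ∫⁻ x : ℝ, ‖sphericalPower n v (x + y * Complex.I)‖ₑ =
      ENNReal.ofReal (decayConst (2 * v.re) * y ^ (1 - 2 * v.re)) := by
  rw [← integral_norm_add_mul_I_rpow _ hy, ofReal_integral_eq_lintegral_ofReal
    (integrable_norm_add_mul_I_rpow (by linarith) hy)
    (Filter.Eventually.of_forall fun x => by positivity)]
  refine lintegral_congr fun x => ?_
  rw [← ofReal_norm, norm_sphericalPower n v (add_mul_I_ne_zero x hy)]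

lemma integrable_cpow_add_mul_I {c : ℂ} (hc : 1 < c.re) {y : ℝ} (hy : 0 < y) :
    Integrable fun x : ℝ => ((y : ℂ) + x * Complex.I) ^ (-c) := by
  refine ((integrable_norm_add_mul_I_rpow hc hy).mul_const (Real.exp (Real.pi * |c.im|))).mono'
    (Measurable.aestronglyMeasurable (by fun_prop)) (Filter.Eventually.of_forall fun x => ?_)
  refine (Complex.norm_cpow_le _ _).trans ?_
  have h : ‖(y : ℂ) + x * Complex.I‖ = ‖(x : ℂ) + y * Complex.I‖ := by
    rw [Complex.norm_add_mul_I, Complex.norm_add_mul_I, add_comm]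
  rw [h, Complex.neg_re, div_eq_mul_inv, ← Real.exp_neg]
  gcongr
  rw [Complex.neg_im, mul_neg, neg_neg]
  calc _ ≤ |((y : ℂ) + x * Complex.I).arg * c.im| := le_abs_self _
    _ = |((y : ℂ) + x * Complex.I).arg| * |c.im| := abs_mul _ _
    _ ≤ _ := by gcongr; exact Complex.abs_arg_le_pi _

end Decay

/-- The density whose Fourier transform is `(y + i x) ^ (-c)`. -/
def gammaDensity (c : ℂ) (y : ℝ) : ℝ → ℂ :=
  (Set.Ioi 0).indicator fun t => (2 * Real.pi : ℂ) ^ c / Complex.Gamma c *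
    ((t : ℂ) ^ (c - 1) * Complex.exp (-((2 * Real.pi * y : ℂ) * t)))

lemma integrable_gammaDensity {c : ℂ} (hc : 0 < c.re) {y : ℝ} (hy : 0 < y) :
    Integrable (gammaDensity c y) := by
  refine IntegrableOn.integrable_indicator ?_ measurableSet_Ioi
  refine (integrableOn_cpow_mul_exp hc ?_).const_mul _
  norm_cast
  have := Real.pi_pos
  positivity

lemma fourier_gammaDensity {c : ℂ} (hc : 0 < c.re) {y : ℝ} (hy : 0 < y) (x : ℝ) :
    𝓕 (gammaDensity c y) x = ((y : ℂ) + x * Complex.I) ^ (-c) := by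
  have hpi := Real.pi_pos
  have hp0 : (y : ℂ) + x * Complex.I ≠ 0 := by
    intro h
    have := congrArg Complex.re h
    simp at this
    linarith
  have e : ∀ t : ℝ, Complex.exp ((-2 * Real.pi * t * x : ℝ) * Complex.I) • gammaDensity c y t =
      (Set.Ioi 0).indicator (fun t : ℝ => (2 * Real.pi : ℂ) ^ c / Complex.Gamma c *
        ((t : ℂ) ^ (c - 1) * Complex.exp (-((((2 * Real.pi : ℝ) : ℂ) *
          ((y : ℂ) + x * Complex.I)) * t)))) t := by
    intro t
    by_cases ht : t ∈ Set.Ioi (0 : ℝ)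
    · rw [gammaDensity, Set.indicator_of_mem ht, Set.indicator_of_mem ht, smul_eq_mul,
        mul_left_comm, mul_left_comm (Complex.exp _), ← Complex.exp_add]
      congr 4
      push_cast
      ring
    · rw [gammaDensity, Set.indicator_of_notMem ht, Set.indicator_of_notMem ht, smul_zero]
  rw [Real.fourier_real_eq_integral_exp_smul]
  simp_rw [e]
  have h2 : ((2 * Real.pi : ℝ) : ℂ) ≠ 0 := by exact_mod_cast (by positivity : 2 * Real.pi ≠ 0)
  have hG := Complex.Gamma_ne_zero_of_re_pos hc
  rw [integral_indicator measurableSet_Ioi, integral_const_mul, integral_cpow_mul_exp hc,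
    ofReal_mul_cpow (by positivity) hp0, Complex.cpow_neg ((2 * Real.pi : ℝ) : ℂ)]
  · have h3 : ((2 * Real.pi : ℝ) : ℂ) ^ c ≠ 0 := by rw [Ne, Complex.cpow_eq_zero_iff]; tauto
    push_cast at *
    field_simp
  · rw [Complex.re_ofReal_mul]
    simp
    positivity

lemma continuousAt_gammaDensity (c : ℂ) (y : ℝ) {t : ℝ} (ht : t ≠ 0) :
    ContinuousAt (gammaDensity c y) t := by
  rcases lt_or_gt_of_ne ht with h | h
  · refine ContinuousAt.congr (f := fun _ => (0 : ℂ)) continuousAt_const ?_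
    filter_upwards [Iio_mem_nhds h] with s hs
    rw [gammaDensity, Set.indicator_of_notMem]
    exact not_lt.mpr (Set.mem_Iio.mp hs).le
  · refine ContinuousAt.congr (f := fun t : ℝ => (2 * Real.pi : ℂ) ^ c / Complex.Gamma c *
      ((t : ℂ) ^ (c - 1) * Complex.exp (-((2 * Real.pi * y : ℂ) * t)))) ?_ ?_
    · refine ContinuousAt.mul continuousAt_const (ContinuousAt.mul ?_ (by fun_prop))
      exact ContinuousAt.comp (g := fun z : ℂ => z ^ (c - 1)) (continuousAt_cpow_const (Or.inl (by simpa using h)))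
        Complex.continuous_ofReal.continuousAt
    · filter_upwards [Ioi_mem_nhds h] with s hs
      rw [gammaDensity, Set.indicator_of_mem hs]

/-- Fourier inversion at a continuity point of the density. The condition `Re c > 1` makes the
transform integrable, and `t = 0` is avoided because the density is cut off there. -/
lemma integral_exp_mul_cpow {c : ℂ} (hc : 1 < c.re) {y : ℝ} (hy : 0 < y) {t : ℝ} (ht : t ≠ 0) :
    ∫ x : ℝ, Complex.exp ((2 * Real.pi * (t * x) : ℝ) * Complex.I) *
      ((y : ℂ) + x * Complex.I) ^ (-c) = gammaDensity c y t := by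
  have hF : 𝓕 (gammaDensity c y) = fun x : ℝ => ((y : ℂ) + x * Complex.I) ^ (-c) :=
    funext fun x => fourier_gammaDensity (by linarith) hy x
  have h := (integrable_gammaDensity (c := c) (by linarith) hy).fourierInv_fourier_eq
    (by rw [hF]; exact integrable_cpow_add_mul_I hc hy) (continuousAt_gammaDensity c y ht)
  rw [hF, Real.fourierInv_eq'] at h
  simpa using h

/-- Parseval-type formula for the product of two powers. -/
lemma integral_exp_mul_cpow_mul_cpow {a b : ℂ} (ha : 1 < a.re) (hb : 0 < b.re) {y : ℝ}
    (hy : 0 < y) :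
    ∫ x : ℝ, Complex.exp (2 * Real.pi * Complex.I * x) * (((y : ℂ) - x * Complex.I) ^ (-a) *
      ((y : ℂ) + x * Complex.I) ^ (-b)) =
      ∫ r : ℝ in Set.Ioi 0, gammaDensity b y (r + 1) * gammaDensity a y r := by
  have hconj : Integrable fun x : ℝ => ((y : ℂ) - x * Complex.I) ^ (-a) := by
    have := (integrable_cpow_add_mul_I ha hy).comp_neg
    simpa [sub_eq_add_neg] using this
  set g : ℝ → ℂ := fun x => Complex.exp ((2 * Real.pi * x : ℝ) * Complex.I) *
    ((y : ℂ) - x * Complex.I) ^ (-a)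
  have hg : Integrable g := by
    refine hconj.bdd_mul (c := 1) (Measurable.aestronglyMeasurable (by fun_prop))
      (Filter.Eventually.of_forall fun x => ?_)
    rw [Complex.norm_exp_ofReal_mul_I]
  have hFg : ∀ t : ℝ, t ≠ 1 → 𝓕 g t = gammaDensity a y (t - 1) := by
    intro t ht
    rw [← integral_exp_mul_cpow ha hy (sub_ne_zero.mpr ht), Real.fourier_real_eq_integral_exp_smul,
      ← integral_neg_eq_self]
    refine integral_congr_ae (Filter.Eventually.of_forall fun x => ?_)
    simp only [g, smul_eq_mul]
    rw [← mul_assoc, ← Complex.exp_add]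
    push_cast
    congr 2 <;> ring
  -- Moving the Fourier transform from one factor to the other needs only integrability of both,
  -- which is why `Re b > 0` is enough for the second exponent.
  have h := VectorFourier.integral_fourierIntegral_smul_eq_flip (e := Real.fourierChar)
    (μ := (volume : Measure ℝ)) (ν := (volume : Measure ℝ)) (L := innerₗ ℝ)
    Real.continuous_fourierChar continuous_inner
    (integrable_gammaDensity hb hy) hg
  rw [flip_innerₗ] at h
  change ∫ x, 𝓕 (gammaDensity b y) x • g x = ∫ t, gammaDensity b y t • 𝓕 g t at h
  have h1 : ∫ x, 𝓕 (gammaDensity b y) x • g x =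
      ∫ x : ℝ, Complex.exp (2 * Real.pi * Complex.I * x) * (((y : ℂ) - x * Complex.I) ^ (-a) *
      ((y : ℂ) + x * Complex.I) ^ (-b)) := by
    refine integral_congr_ae (Filter.Eventually.of_forall fun x => ?_)
    simp only [g, smul_eq_mul]
    rw [fourier_gammaDensity hb hy]
    push_cast
    rw [show (2 * Real.pi * x : ℂ) * Complex.I = 2 * Real.pi * Complex.I * x by ring]
    ring
  have h2 : ∫ t, gammaDensity b y t • 𝓕 g t =
      ∫ t, gammaDensity b y t * gammaDensity a y (t - 1) := by
    refine integral_congr_ae ?_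
    have : ∀ᵐ t : ℝ, t ≠ 1 := by simp [ae_iff]
    filter_upwards [this] with t ht
    rw [hFg t ht, smul_eq_mul]
  -- The frequency of `e(x)` shifts one density by `1`; after recentring, its support condition
  -- confines the integral to `r > 0`.
  rw [← h1, h, h2, ← integral_add_right_eq_self _ (1 : ℝ), ← integral_indicator measurableSet_Ioi]
  refine integral_congr_ae (Filter.Eventually.of_forall fun t => ?_)
  simp only [add_sub_cancel_right]
  by_cases ht : t ∈ Set.Ioi (0 : ℝ)
  · rw [Set.indicator_of_mem ht]
  · rw [Set.indicator_of_notMem ht, gammaDensity, gammaDensity, Set.indicator_of_notMem ht, mul_zero]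

/-- The archimedean integral of the unfolding computation. -/
def archIntegral (n : ℕ) (v w : ℂ) : ℂ :=
  ∫ y : ℝ in Set.Ioi 0, (y : ℂ) ^ (w - 1) * Complex.exp (-(2 * Real.pi * y)) *
    ∫ x : ℝ, Complex.exp (2 * Real.pi * Complex.I * x) * sphericalPower n v (x + y * Complex.I)

section ArchIntegral

variable {a b w s : ℂ}

lemma integrable_arch_kernel (ha : 0 < a.re) (hw : 0 < w.re) (hs : 0 < s.re)
    (h : b - 1 - w = -(a + s)) :
    Integrable (fun q : ℝ × ℝ => (q.1 : ℂ) ^ (a - 1) * ((1 + q.1 : ℝ) : ℂ) ^ (b - 1) *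
      ((q.2 : ℂ) ^ (w - 1) * Complex.exp (-(((4 * Real.pi * (1 + q.1) : ℝ) : ℂ) * q.2))))
      ((volume.restrict (Set.Ioi 0)).prod (volume.restrict (Set.Ioi 0))) := by
  have hpi := Real.pi_pos
  rw [integrable_prod_iff (Measurable.aestronglyMeasurable (by fun_prop))]
  constructor
  · filter_upwards [ae_restrict_mem measurableSet_Ioi] with r hr
    have hr : 0 < r := hr
    refine (integrableOn_cpow_mul_exp hw ?_).const_mul _
    rw [Complex.ofReal_re]
    positivity
  · have h1 := ((integrableOn_beta ha hs).norm).const_mul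
      ((4 * Real.pi) ^ (-w.re) * Real.Gamma w.re)
    refine IntegrableOn.congr_fun h1 (fun r hr => ?_) measurableSet_Ioi
    have hr : 0 < r := hr
    have hr1 : 0 < 1 + r := by positivity
    have e : ∀ y ∈ Set.Ioi (0 : ℝ), ‖(r : ℂ) ^ (a - 1) * ((1 + r : ℝ) : ℂ) ^ (b - 1) *
      ((y : ℂ) ^ (w - 1) * Complex.exp (-(((4 * Real.pi * (1 + r) : ℝ) : ℂ) * y)))‖ =
      ‖(r : ℂ) ^ (a - 1) * ((1 + r : ℝ) : ℂ) ^ (b - 1)‖ *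
        (y ^ (w.re - 1) * Real.exp (-((4 * Real.pi * (1 + r)) * y))) := by
      intro y hy
      rw [norm_mul, norm_cpow_mul_exp hy, Complex.ofReal_re]
    simp only
    rw [setIntegral_congr_fun measurableSet_Ioi e, integral_const_mul,
      Real.integral_rpow_mul_exp_neg_mul_Ioi hw (by positivity), norm_mul, norm_mul, ← h,
      Complex.norm_cpow_eq_rpow_re_of_pos hr1, Complex.norm_cpow_eq_rpow_re_of_pos hr1, one_div,
      Real.inv_rpow (by positivity), ← Real.rpow_neg (by positivity),
      Real.mul_rpow (by positivity) hr1.le, Complex.sub_re (b - 1) w,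
      sub_eq_add_neg (b - 1).re, Real.rpow_add hr1]
    ring

lemma integral_arch_kernel (ha : 0 < a.re) (hw : 0 < w.re) (hs : 0 < s.re)
    (h : b - 1 - w = -(a + s)) :
    ∫ y : ℝ in Set.Ioi 0, ∫ r : ℝ in Set.Ioi 0, (r : ℂ) ^ (a - 1) * ((1 + r : ℝ) : ℂ) ^ (b - 1) *
      ((y : ℂ) ^ (w - 1) * Complex.exp (-(((4 * Real.pi * (1 + r) : ℝ) : ℂ) * y))) =
      (4 * Real.pi : ℂ) ^ (-w) * Complex.Gamma w *
        (Complex.Gamma a * Complex.Gamma s / Complex.Gamma (a + s)) := by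
  have hpi := Real.pi_pos
  rw [← integral_integral_swap (integrable_arch_kernel ha hw hs h), ← integral_beta ha hs,
    ← integral_const_mul]
  refine setIntegral_congr_fun measurableSet_Ioi fun r hr => ?_
  have hr : 0 < r := hr
  have hr1 : 0 < 1 + r := by positivity
  have hr1c : ((1 + r : ℝ) : ℂ) ≠ 0 := by exact_mod_cast hr1.ne'
  rw [integral_const_mul, integral_cpow_mul_exp hw (by rw [Complex.ofReal_re]; positivity),
    Complex.ofReal_mul, Complex.mul_cpow_ofReal_nonneg (by positivity) hr1.le, ← h,
    sub_eq_add_neg (b - 1), Complex.cpow_add _ _ hr1c]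
  push_cast
  ring

end ArchIntegral

/-- On the Fourier side the integrand is a product of two gamma densities; the `y`-integral is then
a gamma integral with scale `4π(1+r)` and the `r`-integral a beta integral. The bound on `Re v` is
the condition `Re (v - m) > 1` of Fourier inversion. -/
theorem archIntegral_eq (m : ℕ) {v w s : ℂ} (hv : m + 1 < v.re) (hw : 0 < w.re) (hs : 0 < s.re)
    (h : s = w + 1 - 2 * v) :
    archIntegral (2 * m) v w = (-1) ^ m * (2 * Real.pi : ℂ) ^ (2 * v) * (4 * Real.pi : ℂ) ^ (-w) *
      Complex.Gamma w * Complex.Gamma s / (Complex.Gamma (v + m) * Complex.Gamma (v - m + s)) := by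
  have hpi := Real.pi_pos
  have ha : 1 < (v - m).re := by simp; linarith
  have hb : 0 < (v + m).re := by
    simp only [Complex.add_re, Complex.natCast_re]
    linarith [(m.cast_nonneg : (0 : ℝ) ≤ m)]
  have h2pi : (2 * Real.pi : ℂ) ≠ 0 := by exact_mod_cast (by positivity : 2 * Real.pi ≠ 0)
  have hab : v + m - 1 - w = -(v - m + s) := by rw [h]; ring
  have e2 : (2 * Real.pi : ℂ) ^ (2 * v) = (2 * Real.pi) ^ (v - m) * (2 * Real.pi) ^ (v + m) := by
    rw [← Complex.cpow_add _ _ h2pi]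
    ring_nf
  have key : ∀ y ∈ Set.Ioi (0 : ℝ), (y : ℂ) ^ (w - 1) * Complex.exp (-(2 * Real.pi * y)) *
      ∫ x : ℝ, Complex.exp (2 * Real.pi * Complex.I * x) *
        sphericalPower (2 * m) v (x + y * Complex.I) =
      ((-1) ^ m * (2 * Real.pi : ℂ) ^ (2 * v) / (Complex.Gamma (v - m) * Complex.Gamma (v + m))) *
      ∫ r : ℝ in Set.Ioi 0, (r : ℂ) ^ (v - m - 1) * ((1 + r : ℝ) : ℂ) ^ (v + m - 1) *
        ((y : ℂ) ^ (w - 1) * Complex.exp (-(((4 * Real.pi * (1 + r) : ℝ) : ℂ) * y))) := by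
    intro y hy
    simp_rw [fun x : ℝ => sphericalPower_eq m v x hy, mul_left_comm (Complex.exp _) ((-1) ^ m)]
    rw [integral_const_mul, integral_exp_mul_cpow_mul_cpow ha hb hy, ← integral_const_mul,
      ← integral_const_mul, ← integral_const_mul]
    refine setIntegral_congr_fun measurableSet_Ioi fun r hr => ?_
    have hr : 0 < r := hr
    simp only [gammaDensity]
    rw [Set.indicator_of_mem (Set.mem_Ioi.mpr hr), Set.indicator_of_mem (Set.mem_Ioi.mpr
      (by linarith : 0 < r + 1)), e2, add_comm r 1,
      show (-(((4 * Real.pi * (1 + r) : ℝ) : ℂ) * y)) = -(2 * Real.pi * y) +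
        (-(2 * Real.pi * y * (1 + r : ℝ)) + -(2 * Real.pi * y * r)) by push_cast; ring,
      Complex.exp_add, Complex.exp_add]
    ring
  rw [archIntegral, setIntegral_congr_fun measurableSet_Ioi key, integral_const_mul,
    integral_arch_kernel (by linarith) hw hs hab]
  have hG := Complex.Gamma_ne_zero_of_re_pos (s := v - m) (by linarith)
  field_simp

/-! ### Real coordinates and affine maps on the half-plane -/

section Coordinates

variable {X : Set ℝ}

lemma lintegral_reIm {G : ℝ × ℝ → ENNReal} (hG : Measurable G) :
    ∫⁻ z in reIm ⁻¹' (X ×ˢ Set.univ), G (reIm z) =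
      ∫⁻ y in Set.Ioi (0 : ℝ), ((1 / ‖y‖₊) ^ 2 : NNReal) * ∫⁻ x in X, G (x, y) := by
  rw [measurePreserving_reIm.setLIntegral_comp_preimage_emb measurableEmbedding_reIm G,
    ← Measure.prod_restrict, Measure.restrict_univ, lintegral_prod_symm' _ hG, heightMeasure,
    lintegral_withDensity_eq_lintegral_mul _ (by fun_prop) (hG.lintegral_prod_left')]
  rfl

lemma integral_reIm {G : ℝ × ℝ → ℂ}
    (hi : IntegrableOn (fun z => G (reIm z)) (reIm ⁻¹' (X ×ˢ Set.univ))) :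
    ∫ z in reIm ⁻¹' (X ×ˢ Set.univ), G (reIm z) =
      ∫ y in Set.Ioi (0 : ℝ), ((1 / ‖y‖₊) ^ 2 : NNReal) • ∫ x in X, G (x, y) := by
  have hi' : Integrable G ((volume.restrict X).prod heightMeasure) := by
    rw [← Measure.restrict_univ (μ := heightMeasure), Measure.prod_restrict]
    exact (measurePreserving_reIm.integrableOn_comp_preimage measurableEmbedding_reIm).mp hi
  rw [measurePreserving_reIm.setIntegral_preimage_emb measurableEmbedding_reIm G,
    ← Measure.prod_restrict, Measure.restrict_univ, integral_prod_symm _ hi', heightMeasure,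
    integral_withDensity_eq_integral_smul (by fun_prop)]

lemma coe_eq_reIm (z : ℍ) : (z : ℂ) = (z.re : ℂ) + z.im * Complex.I :=
  (Complex.re_add_im (z : ℂ)).symm

end Coordinates

section Affine

/-- The matrix `(c r; 0 1)`. -/
def affineMatrix {c : ℝ} (hc : 0 < c) (r : ℝ) : GL (Fin 2) ℝ :=
  Matrix.GeneralLinearGroup.mkOfDetNeZero !![c, r; 0, 1] (by simp [hc.ne'])

lemma coe_affineMatrix_smul {c : ℝ} (hc : 0 < c) (r : ℝ) (z : ℍ) :
    ((affineMatrix hc r • z : ℍ) : ℂ) = c * z + r := by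
  have hdet : 0 < (affineMatrix hc r).det.val := by
    simp [affineMatrix, Matrix.GeneralLinearGroup.mkOfDetNeZero, hc]
  rw [UpperHalfPlane.coe_smul_of_det_pos hdet]
  simp [affineMatrix, Matrix.GeneralLinearGroup.mkOfDetNeZero, num, denom]

lemma im_affineMatrix_smul {c : ℝ} (hc : 0 < c) (r : ℝ) (z : ℍ) :
    (affineMatrix hc r • z).im = c * z.im := by
  rw [← coe_im, coe_affineMatrix_smul]
  simp

lemma lintegral_affine {c : ℝ} (hc : 0 < c) (r : ℝ) (G : ℍ → ENNReal) :
    ∫⁻ z, G (affineMatrix hc r • z) = ∫⁻ z, G z :=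
  (measurePreserving_smul (affineMatrix hc r) volume).lintegral_comp_emb
    (measurableEmbedding_const_smul _) _

lemma integral_affine {c : ℝ} (hc : 0 < c) (r : ℝ) (G : ℍ → ℂ) :
    ∫ z, G (affineMatrix hc r • z) = ∫ z, G z :=
  (measurePreserving_smul (affineMatrix hc r) volume).integral_comp
    (measurableEmbedding_const_smul _) _

end Affine

/-! ### The wave kernel and its scaling -/

section Kernel

variable (n : ℕ) (v β : ℂ)

/-- The function `e(t z) y ^ β (z / |z|) ^ n |z| ^ (-2 v)`. -/
def waveKernel (t : ℝ) (z : ℍ) : ℂ :=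
  Complex.exp (2 * Real.pi * Complex.I * (t * z)) * (z.im : ℂ) ^ β * sphericalPower n v z

lemma measurable_waveKernel (t : ℝ) : Measurable (waveKernel n v β t) := by
  have h1 := (measurable_sphericalPower n v).comp UpperHalfPlane.measurable_coe
  have h2 : Measurable fun z : ℍ => z.im := UpperHalfPlane.continuous_im.measurable
  have h3 : Measurable fun z : ℍ => (z : ℂ) := UpperHalfPlane.measurable_coe
  unfold waveKernel
  fun_prop

lemma sphericalPower_ofReal_mul {t : ℝ} (ht : 0 < t) (ω : ℂ) :
    sphericalPower n v (t * ω) = (t : ℂ) ^ (-2 * v) * sphericalPower n v ω := by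
  have htc : (t : ℂ) ≠ 0 := by exact_mod_cast ht.ne'
  rw [sphericalPower, sphericalPower, norm_mul, Complex.norm_real, Real.norm_of_nonneg ht.le,
    Complex.ofReal_mul, mul_div_mul_left _ _ htc,
    Complex.mul_cpow_ofReal_nonneg ht.le (norm_nonneg _)]
  ring

/-- `sphericalPower` is homogeneous of degree `-2v` under positive scaling, so the frequency can be
absorbed into `z`; the invariant measure then reduces all integrals to `t = 1`. -/
lemma waveKernel_eq_scale {t : ℝ} (ht : 0 < t) (z : ℍ) :
    waveKernel n v β t z =
      (t : ℂ) ^ (2 * v - β) * waveKernel n v β 1 (affineMatrix ht 0 • z) := by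
  have htc : (t : ℂ) ≠ 0 := by exact_mod_cast ht.ne'
  rw [waveKernel, waveKernel, im_affineMatrix_smul, coe_affineMatrix_smul, Complex.ofReal_zero,
    add_zero, sphericalPower_ofReal_mul n v ht, Complex.ofReal_mul,
    Complex.mul_cpow_ofReal_nonneg ht.le z.im_pos.le, Complex.cpow_sub _ _ htc, neg_mul,
    Complex.cpow_neg]
  have h1 : (t : ℂ) ^ (2 * v) ≠ 0 := by rw [Ne, Complex.cpow_eq_zero_iff]; tauto
  have h2 : (t : ℂ) ^ β ≠ 0 := by rw [Ne, Complex.cpow_eq_zero_iff]; tauto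
  push_cast
  field_simp

lemma integral_waveKernel {t : ℝ} (ht : 0 < t) :
    ∫ z, waveKernel n v β t z = (t : ℂ) ^ (2 * v - β) * ∫ z, waveKernel n v β 1 z := by
  simp_rw [waveKernel_eq_scale n v β ht]
  rw [integral_const_mul, integral_affine ht 0 (waveKernel n v β 1)]

lemma lintegral_waveKernel {t : ℝ} (ht : 0 < t) :
    ∫⁻ z, ‖waveKernel n v β t z‖ₑ =
      ENNReal.ofReal (t ^ (2 * v - β).re) * ∫⁻ z, ‖waveKernel n v β 1 z‖ₑ := by
  simp_rw [waveKernel_eq_scale n v β ht, enorm_mul]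
  rw [lintegral_const_mul' _ _ enorm_ne_top,
    lintegral_affine ht 0 fun z => ‖waveKernel n v β 1 z‖ₑ, ← ofReal_norm,
    Complex.norm_cpow_eq_rpow_re_of_pos ht]

/-- The wave kernel in real coordinates. -/
def waveKernelReal (t : ℝ) (p : ℝ × ℝ) : ℂ :=
  Complex.exp (2 * Real.pi * Complex.I * (t * (p.1 + p.2 * Complex.I))) * (p.2 : ℂ) ^ β *
    sphericalPower n v (p.1 + p.2 * Complex.I)

lemma measurable_waveKernelReal (t : ℝ) : Measurable (waveKernelReal n v β t) := by
  have h1 := measurable_sphericalPower n v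
  unfold waveKernelReal
  fun_prop

lemma waveKernel_eq_reIm (t : ℝ) (z : ℍ) :
    waveKernel n v β t z = waveKernelReal n v β t (reIm z) := by
  rw [waveKernel, waveKernelReal, coe_eq_reIm]
  rfl

lemma norm_exp_wave (t x y : ℝ) :
    ‖Complex.exp (2 * Real.pi * Complex.I * (t * (x + y * Complex.I)))‖ =
      Real.exp (-(2 * Real.pi * t * y)) := by
  rw [Complex.norm_exp]
  congr 1
  simp
  ring

variable {v β}

lemma lintegral_waveKernel_one_ne_top (hv : 1 / 2 < v.re) (hs : 0 < (β - 2 * v).re) :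
    ∫⁻ z, ‖waveKernel n v β 1 z‖ₑ ≠ ⊤ := by
  have hpi := Real.pi_pos
  have h := lintegral_reIm (X := Set.univ) (measurable_waveKernelReal n v β 1).enorm
  simp only [Set.univ_prod_univ, Set.preimage_univ, Measure.restrict_univ] at h
  simp_rw [waveKernel_eq_reIm]
  rw [h]
  have e : ∀ y ∈ Set.Ioi (0 : ℝ), ((1 / ‖y‖₊) ^ 2 : NNReal) *
      ∫⁻ x, ‖waveKernelReal n v β 1 (x, y)‖ₑ = ENNReal.ofReal (decayConst (2 * v.re) *
        (y ^ ((β - 2 * v).re - 1) * Real.exp (-(2 * Real.pi * y)))) := by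
    intro y hy
    have hy : 0 < y := hy
    have e1 : ∀ x : ℝ, ‖waveKernelReal n v β 1 (x, y)‖ₑ = ENNReal.ofReal
        (Real.exp (-(2 * Real.pi * y)) * y ^ β.re) *
          ‖sphericalPower n v (x + y * Complex.I)‖ₑ := by
      intro x
      rw [waveKernelReal, enorm_mul, ← ofReal_norm, norm_mul, norm_exp_wave,
        Complex.norm_cpow_eq_rpow_re_of_pos hy, mul_one]
    have e2 : (((1 / ‖y‖₊) ^ 2 : NNReal) : ENNReal) = ENNReal.ofReal (y ^ (-2 : ℝ)) := by
      rw [ENNReal.ofReal, ENNReal.coe_inj, ← NNReal.coe_inj,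
        Real.coe_toNNReal _ (by positivity), Real.rpow_neg hy.le]
      simp [abs_of_pos hy]
    simp_rw [e1]
    rw [lintegral_const_mul' _ _ ENNReal.ofReal_ne_top, lintegral_sphericalPower n hv hy, e2,
      ← ENNReal.ofReal_mul (by positivity), ← ENNReal.ofReal_mul (by positivity)]
    congr 1
    rw [show (β - 2 * v).re - 1 = -2 + β.re + (1 - 2 * v.re) by simp; ring, Real.rpow_add hy,
      Real.rpow_add hy]
    ring
  rw [setLIntegral_congr_fun measurableSet_Ioi e]
  have hi := (integrableOn_rpow_mul_exp hs (by positivity : 0 < 2 * Real.pi)).const_mul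
    (decayConst (2 * v.re))
  exact hi.lintegral_lt_top.ne

lemma integrable_waveKernel_one (hv : 1 / 2 < v.re) (hs : 0 < (β - 2 * v).re) :
    Integrable (waveKernel n v β 1) :=
  ⟨(measurable_waveKernel n v β 1).aestronglyMeasurable,
    (lintegral_waveKernel_one_ne_top n hv hs).lt_top⟩

lemma integral_waveKernel_one (hv : 1 / 2 < v.re) (hs : 0 < (β - 2 * v).re) :
    ∫ z, waveKernel n v β 1 z = archIntegral n v (β - 1) := by
  have h := integral_reIm (X := Set.univ) (G := waveKernelReal n v β 1) (by
    simp_rw [← waveKernel_eq_reIm]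
    exact (integrable_waveKernel_one n hv hs).integrableOn)
  simp only [Set.univ_prod_univ, Set.preimage_univ, Measure.restrict_univ] at h
  simp_rw [waveKernel_eq_reIm]
  rw [h, archIntegral]
  refine setIntegral_congr_fun measurableSet_Ioi fun y hy => ?_
  have hy : 0 < y := hy
  have hyc : (y : ℂ) ≠ 0 := by exact_mod_cast hy.ne'
  have e1 : ∀ x : ℝ, waveKernelReal n v β 1 (x, y) = (y : ℂ) ^ β *
      Complex.exp (-(2 * Real.pi * y)) * (Complex.exp (2 * Real.pi * Complex.I * x) *
        sphericalPower n v (x + y * Complex.I)) := by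
    intro x
    rw [waveKernelReal, show 2 * Real.pi * Complex.I * (((1 : ℝ) : ℂ) * (x + y * Complex.I)) =
      -(2 * Real.pi * y) + 2 * Real.pi * Complex.I * x by
        push_cast; linear_combination (2 * Real.pi * y : ℂ) * Complex.I_sq, Complex.exp_add]
    ring
  simp_rw [e1]
  rw [integral_const_mul, NNReal.smul_def, Complex.real_smul, ← mul_assoc, ← mul_assoc]
  congr 2
  rw [show β - 1 - 1 = β - (2 : ℕ) by push_cast; ring, Complex.cpow_sub _ _ hyc,
    Complex.cpow_natCast]
  simp [abs_of_pos hy]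
  field_simp

end Kernel

/-! ### Second unfolding: the rows of the lattice with `c ≠ 0` -/

lemma T_zpow_injective : Function.Injective fun q : ℤ => ModularGroup.T ^ q := by
  intro i j h
  have := congrArg (fun g : SL(2, ℤ) => g 0 1) h
  simpa [ModularGroup.coe_T_zpow] using this

/-- The powers of `T` are indexed by the integers. -/
def intEquivZPowers : ℤ ≃ Subgroup.zpowers ModularGroup.T :=
  Equiv.ofBijective (fun q => ⟨ModularGroup.T ^ q, q, rfl⟩)
    ⟨fun _ _ h => T_zpow_injective (congrArg Subtype.val h),
      fun ⟨_, q, hq⟩ => ⟨q, Subtype.ext hq⟩⟩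

lemma lintegral_eq_tsum_strip (G : ℍ → ENNReal) :
    ∫⁻ z, G z = ∑' q : ℤ, ∫⁻ z in strip, G (ModularGroup.T ^ q • z) := by
  rw [isFundamentalDomain_strip.lintegral_eq_tsum'']
  exact (intEquivZPowers.tsum_eq fun g : Subgroup.zpowers ModularGroup.T =>
    ∫⁻ z in strip, G (g • z)).symm

lemma integral_eq_tsum_strip {G : ℍ → ℂ} (hG : Integrable G) :
    ∫ z, G z = ∑' q : ℤ, ∫ z in strip, G (ModularGroup.T ^ q • z) := by
  rw [isFundamentalDomain_strip.integral_eq_tsum'' _ hG]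
  exact (intEquivZPowers.tsum_eq fun g : Subgroup.zpowers ModularGroup.T =>
    ∫ z in strip, G (g • z)).symm

section LatticeWave

variable (n : ℕ) (v β : ℂ)

/-- The function `e(l z) y ^ β φ(c z + j)` with `φ(ω) = (ω / |ω|) ^ n |ω| ^ (-2 v)`. -/
def latticeWave (l : ℕ) (c j : ℤ) (z : ℍ) : ℂ :=
  Complex.exp (2 * Real.pi * Complex.I * (l * z)) * (z.im : ℂ) ^ β * sphericalPower n v (c * z + j)

lemma measurable_latticeWave (l : ℕ) (c j : ℤ) : Measurable (latticeWave n v β l c j) := by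
  have h1 := measurable_sphericalPower n v
  have h2 : Measurable fun z : ℍ => z.im := UpperHalfPlane.continuous_im.measurable
  have h3 : Measurable fun z : ℍ => (z : ℂ) := UpperHalfPlane.measurable_coe
  unfold latticeWave
  fun_prop

/-- Since `l` is an integer, `e(lz)` is periodic, so adding `qc` to `j` is the same as translating
`z` by `q`. -/
lemma latticeWave_add_mul (l : ℕ) (c j q : ℤ) (z : ℍ) :
    latticeWave n v β l c (q * c + j) z = latticeWave n v β l c j (ModularGroup.T ^ q • z) := by
  rw [latticeWave, latticeWave, ModularGroup.coe_T_zpow_smul_eq, ModularGroup.im_T_zpow_smul]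
  have h : Complex.exp (2 * Real.pi * Complex.I * (l * (z + q))) =
      Complex.exp (2 * Real.pi * Complex.I * (l * z)) := by
    rw [show 2 * Real.pi * Complex.I * (l * ((z : ℂ) + q)) = 2 * Real.pi * Complex.I * (l * z) +
      ((l * q : ℤ) : ℂ) * (2 * Real.pi * Complex.I) by push_cast; ring, Complex.exp_add,
      Complex.exp_int_mul_two_pi_mul_I, mul_one]
  rw [h]
  congr 2
  push_cast
  ring

lemma latticeWave_neg (hn : Even n) (l : ℕ) (c j : ℤ) (z : ℍ) :
    latticeWave n v β l (-c) (-j) z = latticeWave n v β l c j z := by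
  have h : (((-c : ℤ) : ℂ) * z + ((-j : ℤ) : ℂ)) = -(c * z + j) := by push_cast; ring
  rw [latticeWave, latticeWave, h, sphericalPower, sphericalPower, norm_neg, neg_div, hn.neg_pow]

/-- Substituting `cz + r` for `z` turns `e(lz)` into `e(-lr/c)` times a wave of frequency `l/c`;
only this phase depends on `r` after integration. -/
lemma latticeWave_eq_waveKernel (l : ℕ) {c : ℕ} (hc : 0 < c) (r : ℤ) (z : ℍ) :
    latticeWave n v β l c r z =
      Complex.exp (-(2 * Real.pi * Complex.I * (l * r / c))) * (c : ℂ) ^ (-β) *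
        waveKernel n v β (l / c) (affineMatrix (Nat.cast_pos.mpr hc) (r : ℝ) • z) := by
  have hcc : (c : ℂ) ≠ 0 := by exact_mod_cast hc.ne'
  have hcr : (0 : ℝ) < c := by exact_mod_cast hc
  rw [latticeWave, waveKernel, im_affineMatrix_smul, coe_affineMatrix_smul, Complex.ofReal_mul,
    Complex.mul_cpow_ofReal_nonneg hcr.le z.im_pos.le, Complex.cpow_neg]
  have h1 : (c : ℂ) ^ β ≠ 0 := by rw [Ne, Complex.cpow_eq_zero_iff]; tauto
  have h2 : Complex.exp (2 * Real.pi * Complex.I * (l * z)) =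
      Complex.exp (-(2 * Real.pi * Complex.I * (l * r / c))) *
      Complex.exp (2 * Real.pi * Complex.I * (((l / c : ℝ) : ℂ) * (((c : ℝ) : ℂ) * z + ((r : ℝ) : ℂ)))) := by
    rw [← Complex.exp_add]
    congr 1
    push_cast
    field_simp
    ring
  rw [h2]
  push_cast
  field_simp

/-- The representation `j = q c + r` of the integers. -/
def divModEquiv' (c : ℕ) [NeZero c] : Fin c × ℤ ≃ ℤ :=
  (Equiv.prodComm _ _).trans (Int.divModEquiv c).symm

lemma divModEquiv'_apply (c : ℕ) [NeZero c] (p : Fin c × ℤ) :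
    divModEquiv' c p = p.2 * c + (p.1 : ℕ) := rfl

lemma tsum_lintegral_latticeWave {l c : ℕ} (hl : 0 < l) (hc : 0 < c) :
    ∑' j : ℤ, ∫⁻ z in strip, ‖latticeWave n v β l c j z‖ₑ =
      ENNReal.ofReal ((c : ℝ) ^ (1 - 2 * v).re * (l : ℝ) ^ (2 * v - β).re) *
        ∫⁻ z, ‖waveKernel n v β 1 z‖ₑ := by
  have : NeZero c := ⟨hc.ne'⟩
  have hcr : (0 : ℝ) < c := by exact_mod_cast hc
  have hlr : (0 : ℝ) < l := by exact_mod_cast hl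
  rw [← (divModEquiv' c).tsum_eq, ENNReal.tsum_prod', tsum_fintype]
  have h : ∀ r : Fin c, ∑' q : ℤ, ∫⁻ z in strip,
      ‖latticeWave n v β l c (divModEquiv' c (r, q)) z‖ₑ =
      ENNReal.ofReal ((c : ℝ) ^ (-2 * v).re * (l : ℝ) ^ (2 * v - β).re) *
        ∫⁻ z, ‖waveKernel n v β 1 z‖ₑ := by
    intro r
    have e : ∀ q : ℤ, ∫⁻ z in strip, ‖latticeWave n v β l c (divModEquiv' c (r, q)) z‖ₑ =
        ∫⁻ z in strip, ‖latticeWave n v β l c (r : ℕ) (ModularGroup.T ^ q • z)‖ₑ := by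
      intro q
      refine lintegral_congr fun z => ?_
      rw [divModEquiv'_apply, ← latticeWave_add_mul]
    rw [tsum_congr e, ← lintegral_eq_tsum_strip fun z => ‖latticeWave n v β l c (r : ℕ) z‖ₑ]
    have e2 : ∀ z, ‖latticeWave n v β l c (r : ℕ) z‖ₑ = ENNReal.ofReal ((c : ℝ) ^ (-β).re) *
        ‖waveKernel n v β (l / c) (affineMatrix hcr (((r : ℕ) : ℤ) : ℝ) • z)‖ₑ := by
      intro z
      rw [latticeWave_eq_waveKernel n v β l hc, enorm_mul, ← ofReal_norm, norm_mul,
        ← Complex.ofReal_natCast c, Complex.norm_cpow_eq_rpow_re_of_pos hcr, Complex.norm_exp]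
      have : (-(2 * Real.pi * Complex.I * (l * (((r : ℕ) : ℤ) : ℂ) / ((c : ℝ) : ℂ)))).re = 0 := by
        rw [show -(2 * Real.pi * Complex.I * (l * (((r : ℕ) : ℤ) : ℂ) / ((c : ℝ) : ℂ))) =
          ((-(2 * Real.pi * (l * (((r : ℕ) : ℤ) : ℝ) / c)) : ℝ) : ℂ) * Complex.I by push_cast; ring]
        rw [Complex.re_ofReal_mul, Complex.I_re, mul_zero]
      rw [this, Real.exp_zero, one_mul]
    simp_rw [e2]
    rw [lintegral_const_mul' _ _ ENNReal.ofReal_ne_top,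
      lintegral_affine hcr _ fun z => ‖waveKernel n v β (l / c) z‖ₑ,
      lintegral_waveKernel n v β (by positivity), ← mul_assoc,
      ← ENNReal.ofReal_mul (by positivity), Real.div_rpow hlr.le hcr.le]
    congr 2
    rw [show (-2 * v).re = (-β).re - (2 * v - β).re by simp; ring, Real.rpow_sub hcr]
    ring
  rw [Finset.sum_congr rfl fun r _ => h r, Finset.sum_const, Finset.card_univ, Fintype.card_fin,
    nsmul_eq_mul, ← mul_assoc, ← ENNReal.ofReal_natCast, ← ENNReal.ofReal_mul (by positivity),
    ← mul_assoc]
  congr 3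
  rw [show (1 - 2 * v).re = 1 + (-2 * v).re by simp; ring, Real.rpow_add hcr, Real.rpow_one]

lemma sum_exp_eq (l : ℕ) {c : ℕ} (hc : 0 < c) :
    ∑ r : Fin c, Complex.exp (-(2 * Real.pi * Complex.I * (l * (((r : ℕ) : ℤ) : ℂ) / c))) =
      if c ∣ l then (c : ℂ) else 0 := by
  have hcc : (c : ℂ) ≠ 0 := by exact_mod_cast hc.ne'
  set ζ := Complex.exp (-(2 * Real.pi * Complex.I * (l / c))) with hζ
  have e : ∀ r : Fin c, Complex.exp (-(2 * Real.pi * Complex.I * (l * (((r : ℕ) : ℤ) : ℂ) / c))) =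
      ζ ^ (r : ℕ) := by
    intro r
    rw [hζ, ← Complex.exp_nat_mul]
    congr 1
    push_cast
    ring
  rw [Finset.sum_congr rfl fun r _ => e r, Fin.sum_univ_eq_sum_range (fun r => ζ ^ r)]
  split_ifs with h
  · obtain ⟨d, rfl⟩ := h
    have : ζ = 1 := by
      rw [hζ, Complex.exp_eq_one_iff]
      refine ⟨-d, ?_⟩
      push_cast
      field_simp
    simp [this]
  · have h1 : ζ ≠ 1 := by
      intro h1
      rw [hζ, Complex.exp_eq_one_iff] at h1
      obtain ⟨d, hd⟩ := h1
      have h2 : (2 * Real.pi * Complex.I : ℂ) ≠ 0 := Complex.two_pi_I_ne_zero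
      have h3 : (l : ℂ) / c = -d := by
        apply mul_left_cancel₀ h2
        linear_combination -hd
      rw [div_eq_iff hcc] at h3
      have h4 : (l : ℤ) = -d * c := by exact_mod_cast h3
      exact h (Int.natCast_dvd_natCast.mp ⟨-d, by rw [h4]; ring⟩)
    have hζc : ζ ^ c = 1 := by
      rw [hζ, ← Complex.exp_nat_mul, Complex.exp_eq_one_iff]
      refine ⟨-l, ?_⟩
      push_cast
      field_simp
    rw [geom_sum_eq h1, hζc, sub_self, zero_div]

variable {v β}

lemma lintegral_waveKernel_ne_top (hv : 1 / 2 < v.re) (hs : 0 < (β - 2 * v).re) {t : ℝ}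
    (ht : 0 < t) : ∫⁻ z, ‖waveKernel n v β t z‖ₑ ≠ ⊤ := by
  rw [lintegral_waveKernel n v β ht]
  exact ENNReal.mul_ne_top ENNReal.ofReal_ne_top (lintegral_waveKernel_one_ne_top n hv hs)

/-- For each residue `r` the sum over `q` reassembles `ℍ` from strips, giving the same integral up
to the phase `e(-lr/c)`. Orthogonality of additive characters leaves only `c ∣ l`. -/
lemma tsum_integral_latticeWave (hv : 1 / 2 < v.re) (hs : 0 < (β - 2 * v).re) {l c : ℕ}
    (hl : 0 < l) (hc : 0 < c) :
    ∑' j : ℤ, ∫ z in strip, latticeWave n v β l c j z =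
      if c ∣ l then (c : ℂ) ^ (1 - 2 * v) * (l : ℂ) ^ (2 * v - β) * ∫ z, waveKernel n v β 1 z
      else 0 := by
  have : NeZero c := ⟨hc.ne'⟩
  have hcr : (0 : ℝ) < c := by exact_mod_cast hc
  have hlr : (0 : ℝ) < l := by exact_mod_cast hl
  have hcc : (c : ℂ) ≠ 0 := by exact_mod_cast hc.ne'
  have hsum : Summable fun j : ℤ => ∫ z in strip, latticeWave n v β l c j z := by
    refine Summable.of_norm ?_
    rw [← tsum_enorm_ne_top_iff_summable_norm]
    refine ne_top_of_le_ne_top ?_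
      (ENNReal.tsum_le_tsum fun j => enorm_integral_le_lintegral_enorm _)
    rw [tsum_lintegral_latticeWave n v β hl hc]
    exact ENNReal.mul_ne_top ENNReal.ofReal_ne_top (lintegral_waveKernel_one_ne_top n hv hs)
  have hsum' : Summable fun p : Fin c × ℤ =>
      ∫ z in strip, latticeWave n v β l c (divModEquiv' c p) z :=
    (divModEquiv' c).summable_iff.mpr hsum
  rw [← (divModEquiv' c).tsum_eq, hsum'.tsum_prod, tsum_fintype]
  have h : ∀ r : Fin c, ∑' q : ℤ, ∫ z in strip, latticeWave n v β l c (divModEquiv' c (r, q)) z =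
      Complex.exp (-(2 * Real.pi * Complex.I * (l * (((r : ℕ) : ℤ) : ℂ) / c))) *
        ((c : ℂ) ^ (-2 * v) * (l : ℂ) ^ (2 * v - β) * ∫ z, waveKernel n v β 1 z) := by
    intro r
    have e : ∀ q : ℤ, ∫ z in strip, latticeWave n v β l c (divModEquiv' c (r, q)) z =
        ∫ z in strip, latticeWave n v β l c (r : ℕ) (ModularGroup.T ^ q • z) := by
      intro q
      refine integral_congr_ae (Filter.Eventually.of_forall fun z => ?_)
      simp only
      rw [divModEquiv'_apply, ← latticeWave_add_mul]
    have hint : Integrable (waveKernel n v β (l / c)) :=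
      ⟨(measurable_waveKernel n v β _).aestronglyMeasurable,
        (lintegral_waveKernel_ne_top n hv hs (by positivity)).lt_top⟩
    have hint2 : Integrable (latticeWave n v β l c (r : ℕ)) := by
      have := ((measurePreserving_smul (affineMatrix hcr (((r : ℕ) : ℤ) : ℝ))
        (volume : Measure ℍ)).integrable_comp_emb
        (measurableEmbedding_const_smul _)).mpr hint
      exact (this.const_mul _).congr (Filter.Eventually.of_forall fun z =>
        (latticeWave_eq_waveKernel n v β l hc _ z).symm)
    rw [tsum_congr e, ← integral_eq_tsum_strip hint2]
    simp_rw [latticeWave_eq_waveKernel n v β l hc]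
    rw [integral_const_mul, integral_affine hcr _ (waveKernel n v β (l / c)),
      integral_waveKernel n v β (by positivity), div_eq_mul_inv (l : ℝ), Complex.ofReal_mul,
      Complex.mul_cpow_ofReal_nonneg hlr.le (by positivity), Complex.ofReal_inv, Complex.inv_cpow,
      show -2 * v = -β - (2 * v - β) by ring, Complex.cpow_sub _ _ hcc]
    · push_cast
      ring
    · rw [Complex.arg_ofReal_of_nonneg hcr.le]
      exact Real.pi_pos.ne
  rw [Finset.sum_congr rfl fun r _ => h r, ← Finset.sum_mul, sum_exp_eq l hc]
  split_ifs with hd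
  · rw [show 1 - 2 * v = 1 + -2 * v by ring, Complex.cpow_add _ _ hcc, Complex.cpow_one]
    ring
  · rw [zero_mul]

end LatticeWave

/-! ### The row `c = 0` -/

section ZeroRow

variable (n : ℕ) {v β : ℂ}

lemma lintegral_exp_mul_cpow_strip (hβ : 1 < β.re) {l : ℕ} (hl : 0 < l) :
    ∫⁻ z in strip, ‖Complex.exp (2 * Real.pi * Complex.I * (l * z)) * (z.im : ℂ) ^ β‖ₑ =
      ENNReal.ofReal (Real.Gamma (β.re - 1) * (2 * Real.pi) ^ (1 - β.re) *
        (l : ℝ) ^ (1 - β.re)) := by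
  have hpi := Real.pi_pos
  have hlr : (0 : ℝ) < l := by exact_mod_cast hl
  have h := lintegral_reIm (X := Set.Ioc 0 1) (G := fun p : ℝ × ℝ =>
    ‖Complex.exp (2 * Real.pi * Complex.I * (((l : ℝ) : ℂ) * (p.1 + p.2 * Complex.I))) *
      (p.2 : ℂ) ^ β‖ₑ) (by fun_prop)
  rw [← strip_eq] at h
  have e0 : ∀ z : ℍ, ‖Complex.exp (2 * Real.pi * Complex.I * (l * z)) * (z.im : ℂ) ^ β‖ₑ =
      ‖Complex.exp (2 * Real.pi * Complex.I * (((l : ℝ) : ℂ) * ((reIm z).1 +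
        (reIm z).2 * Complex.I))) * ((reIm z).2 : ℂ) ^ β‖ₑ := by
    intro z
    rw [coe_eq_reIm, Complex.ofReal_natCast]
    rfl
  simp_rw [e0]
  rw [h]
  have e : ∀ y ∈ Set.Ioi (0 : ℝ), ((1 / ‖y‖₊) ^ 2 : NNReal) * ∫⁻ x in Set.Ioc (0 : ℝ) 1,
      ‖Complex.exp (2 * Real.pi * Complex.I * (((l : ℝ) : ℂ) * (x + y * Complex.I))) *
        (y : ℂ) ^ β‖ₑ =
      ENNReal.ofReal (y ^ (β.re - 1 - 1) * Real.exp (-(2 * Real.pi * l * y))) := by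
    intro y hy
    have hy : 0 < y := hy
    have e1 : ∀ x : ℝ, ‖Complex.exp (2 * Real.pi * Complex.I * (((l : ℝ) : ℂ) *
        (x + y * Complex.I))) * (y : ℂ) ^ β‖ₑ =
        ENNReal.ofReal (Real.exp (-(2 * Real.pi * l * y)) * y ^ β.re) := by
      intro x
      rw [← ofReal_norm, norm_mul, norm_exp_wave, Complex.norm_cpow_eq_rpow_re_of_pos hy]
    have e2 : (((1 / ‖y‖₊) ^ 2 : NNReal) : ENNReal) = ENNReal.ofReal (y ^ (-2 : ℝ)) := by
      rw [ENNReal.ofReal, ENNReal.coe_inj, ← NNReal.coe_inj,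
        Real.coe_toNNReal _ (by positivity), Real.rpow_neg hy.le]
      simp [abs_of_pos hy]
    simp_rw [e1]
    rw [lintegral_const, Measure.restrict_apply MeasurableSet.univ, Set.univ_inter,
      Real.volume_Ioc, sub_zero, ENNReal.ofReal_one, mul_one, e2,
      ← ENNReal.ofReal_mul (by positivity)]
    congr 1
    rw [show β.re - 1 - 1 = -2 + β.re by ring, Real.rpow_add hy]
    ring
  rw [setLIntegral_congr_fun measurableSet_Ioi e, ← ofReal_integral_eq_lintegral_ofReal
    (integrableOn_rpow_mul_exp (by linarith) (by positivity))]
  · rw [Real.integral_rpow_mul_exp_neg_mul_Ioi (by linarith) (by positivity), one_div,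
      Real.inv_rpow (by positivity), ← Real.rpow_neg (by positivity), neg_sub,
      Real.mul_rpow (by positivity) hlr.le]
    congr 1
    ring
  · filter_upwards [ae_restrict_mem measurableSet_Ioi] with y hy
    have hy : 0 < y := hy
    positivity

lemma integral_Ioc_exp (l : ℕ) (hl : 0 < l) (y : ℝ) :
    ∫ x in Set.Ioc (0 : ℝ) 1,
      Complex.exp (2 * Real.pi * Complex.I * (((l : ℝ) : ℂ) * (x + y * Complex.I))) = 0 := by
  have hlc : (l : ℂ) ≠ 0 := by exact_mod_cast hl.ne'
  have h : (2 * Real.pi * Complex.I * l : ℂ) ≠ 0 := mul_ne_zero Complex.two_pi_I_ne_zero hlc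
  have e : ∀ x : ℝ, Complex.exp (2 * Real.pi * Complex.I * (((l : ℝ) : ℂ) * (x + y * Complex.I))) =
      Complex.exp (2 * Real.pi * Complex.I * l * (y * Complex.I)) *
        Complex.exp (2 * Real.pi * Complex.I * l * x) := by
    intro x
    rw [← Complex.exp_add]
    congr 1
    push_cast
    ring
  simp_rw [e]
  rw [integral_const_mul, ← intervalIntegral.integral_of_le zero_le_one,
    integral_exp_mul_complex h]
  have : Complex.exp (2 * Real.pi * Complex.I * l) = 1 :=
    Complex.exp_eq_one_iff.mpr ⟨l, by push_cast; ring⟩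
  simp [this]

/-- Here `φ(cz + j)` is constant in `z`, and the integral of `e(lx)` over a period vanishes because
`l > 0`, that is, because `f` is cuspidal. -/
lemma integral_latticeWave_zero (hβ : 1 < β.re) {l : ℕ} (hl : 0 < l) (j : ℤ) :
    ∫ z in strip, latticeWave n v β l 0 j z = 0 := by
  have e : ∀ z : ℍ, latticeWave n v β l 0 j z =
      Complex.exp (2 * Real.pi * Complex.I * (l * z)) * (z.im : ℂ) ^ β * sphericalPower n v j := by
    intro z
    simp [latticeWave]
  simp_rw [e]
  rw [integral_mul_const]
  have h := integral_reIm (X := Set.Ioc 0 1) (G := fun p : ℝ × ℝ =>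
    Complex.exp (2 * Real.pi * Complex.I * (((l : ℝ) : ℂ) * (p.1 + p.2 * Complex.I))) *
      (p.2 : ℂ) ^ β)
  rw [← strip_eq] at h
  have e0 : ∀ z : ℍ, Complex.exp (2 * Real.pi * Complex.I * (l * z)) * (z.im : ℂ) ^ β =
      Complex.exp (2 * Real.pi * Complex.I * (((l : ℝ) : ℂ) * ((reIm z).1 +
        (reIm z).2 * Complex.I))) * ((reIm z).2 : ℂ) ^ β := by
    intro z
    rw [coe_eq_reIm, Complex.ofReal_natCast]
    rfl
  have hi : IntegrableOn (fun z : ℍ => Complex.exp (2 * Real.pi * Complex.I * (l * z)) *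
      (z.im : ℂ) ^ β) strip := by
    refine ⟨Measurable.aestronglyMeasurable ?_, ?_⟩
    · have h2 : Measurable fun z : ℍ => z.im := UpperHalfPlane.continuous_im.measurable
      have h3 : Measurable fun z : ℍ => (z : ℂ) := UpperHalfPlane.measurable_coe
      fun_prop
    · rw [HasFiniteIntegral, lintegral_exp_mul_cpow_strip hβ hl]
      exact ENNReal.ofReal_lt_top
  simp_rw [e0] at hi ⊢
  rw [h hi]
  simp only [integral_mul_const, integral_Ioc_exp l hl, zero_mul, smul_zero, integral_zero]

lemma enorm_sphericalPower_intCast (hv : 0 < v.re) (j : ℤ) :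
    ‖sphericalPower n v j‖ₑ ≤ ENNReal.ofReal (|(j : ℝ)| ^ (-(2 * v.re))) := by
  rcases eq_or_ne j 0 with rfl | hj
  · have : -2 * v ≠ 0 := by
      intro h
      have := congrArg Complex.re h
      simp at this
      linarith
    simp only [sphericalPower, Int.cast_zero, norm_zero, Complex.ofReal_zero,
      Complex.zero_cpow this, mul_zero, enorm_zero]
    exact zero_le
  · rw [← ofReal_norm, norm_sphericalPower n v (by exact_mod_cast hj), Complex.norm_intCast]

lemma tsum_lintegral_latticeWave_zero_le (hv : 1 / 2 < v.re) (hβ : 1 < β.re) {l : ℕ} (hl : 0 < l) :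
    ∑' j : ℤ, ∫⁻ z in strip, ‖latticeWave n v β l 0 j z‖ₑ ≤
      ENNReal.ofReal (Real.Gamma (β.re - 1) * (2 * Real.pi) ^ (1 - β.re) * (l : ℝ) ^ (1 - β.re)) *
        ∑' j : ℤ, ENNReal.ofReal (|(j : ℝ)| ^ (-(2 * v.re))) := by
  rw [← ENNReal.tsum_mul_left]
  refine ENNReal.tsum_le_tsum fun j => ?_
  have e : ∀ z : ℍ, ‖latticeWave n v β l 0 j z‖ₑ =
      ‖Complex.exp (2 * Real.pi * Complex.I * (l * z)) * (z.im : ℂ) ^ β‖ₑ *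
        ‖sphericalPower n v j‖ₑ := by
    intro z
    rw [← enorm_mul]
    simp [latticeWave]
  simp_rw [e]
  rw [lintegral_mul_const' _ _ enorm_ne_top, lintegral_exp_mul_cpow_strip hβ hl]
  gcongr
  exact enorm_sphericalPower_intCast n (by linarith) j

end ZeroRow

/-! ### Summation over frequencies and lattice points -/

section TripleSeries

variable {n : ℕ} {v β : ℂ}

lemma tsum_ofReal_abs_rpow_ne_top {b : ℝ} (hb : 1 < b) :
    ∑' j : ℤ, ENNReal.ofReal (|(j : ℝ)| ^ (-b)) ≠ ⊤ :=
  (Real.summable_abs_int_rpow hb).tsum_ofReal_ne_top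

lemma tsum_lintegral_latticeWave_neg (hn : Even n) (l : ℕ) (c : ℤ) :
    ∑' j : ℤ, ∫⁻ z in strip, ‖latticeWave n v β l (-c) j z‖ₑ =
      ∑' j : ℤ, ∫⁻ z in strip, ‖latticeWave n v β l c j z‖ₑ := by
  rw [← (Equiv.neg ℤ).tsum_eq]
  refine tsum_congr fun j => lintegral_congr fun z => ?_
  rw [Equiv.neg_apply, latticeWave_neg n v β hn]

lemma tsum_integral_latticeWave_neg (hn : Even n) (l : ℕ) (c : ℤ) :
    ∑' j : ℤ, ∫ z in strip, latticeWave n v β l (-c) j z =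
      ∑' j : ℤ, ∫ z in strip, latticeWave n v β l c j z := by
  rw [← (Equiv.neg ℤ).tsum_eq]
  refine tsum_congr fun j => integral_congr_ae (Filter.Eventually.of_forall fun z => ?_)
  rw [Equiv.neg_apply, latticeWave_neg n v β hn]

/-- Taking norms discards the phases, so every `c` contributes a multiple of `|c| ^ (1 - 2 Re v)`,
summable for `Re v > 1`. The zero row, which integrates to zero, still has to be bounded in absolute
value. -/
lemma exists_tsum_lintegral_latticeWave_le (hn : Even n) (hv : 1 < v.re)
    (hs : 0 < (β - 2 * v).re) :
    ∃ K : ENNReal, K ≠ ⊤ ∧ ∀ l : ℕ, 0 < l →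
      ∑' c : ℤ, ∑' j : ℤ, ∫⁻ z in strip, ‖latticeWave n v β l c j z‖ₑ ≤
        K * ENNReal.ofReal ((l : ℝ) ^ (2 * v - β).re) := by
  have hpi := Real.pi_pos
  have hβ : 1 < β.re := by simp at hs; linarith
  have hΓ := Real.Gamma_pos_of_pos (by linarith : 0 < β.re - 1)
  refine ⟨ENNReal.ofReal (Real.Gamma (β.re - 1) * (2 * Real.pi) ^ (1 - β.re)) *
      (∑' j : ℤ, ENNReal.ofReal (|(j : ℝ)| ^ (-(2 * v.re)))) +
      (∑' c : ℤ, ENNReal.ofReal (|(c : ℝ)| ^ (-(2 * v.re - 1)))) *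
        ∫⁻ z, ‖waveKernel n v β 1 z‖ₑ, ?_, fun l hl => ?_⟩
  · refine ENNReal.add_ne_top.mpr ⟨ENNReal.mul_ne_top ENNReal.ofReal_ne_top
      (tsum_ofReal_abs_rpow_ne_top (by linarith)), ENNReal.mul_ne_top
      (tsum_ofReal_abs_rpow_ne_top (by linarith))
      (lintegral_waveKernel_one_ne_top n (by linarith) hs)⟩
  have hl1 : (1 : ℝ) ≤ l := by exact_mod_cast hl
  set D := ENNReal.ofReal ((l : ℝ) ^ (2 * v - β).re) with hD
  set Z := ∑' j : ℤ, ENNReal.ofReal (|(j : ℝ)| ^ (-(2 * v.re)))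
  have hb : ∀ c : ℤ, ∑' j : ℤ, ∫⁻ z in strip, ‖latticeWave n v β l c j z‖ₑ ≤
      (if c = 0 then ENNReal.ofReal (Real.Gamma (β.re - 1) * (2 * Real.pi) ^ (1 - β.re)) * Z * D
        else 0) + ENNReal.ofReal (|(c : ℝ)| ^ (-(2 * v.re - 1))) *
          ((∫⁻ z, ‖waveKernel n v β 1 z‖ₑ) * D) := by
    intro c
    have hnat : ∀ c : ℕ, 0 < c → ∑' j : ℤ, ∫⁻ z in strip, ‖latticeWave n v β l c j z‖ₑ =
        ENNReal.ofReal (|(c : ℝ)| ^ (-(2 * v.re - 1))) *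
          ((∫⁻ z, ‖waveKernel n v β 1 z‖ₑ) * D) := by
      intro c hc
      rw [tsum_lintegral_latticeWave n v β hl hc, Nat.abs_cast, ENNReal.ofReal_mul (by positivity),
        show (1 - 2 * v).re = -(2 * v.re - 1) by simp, ← hD]
      ring
    rcases eq_or_ne c 0 with rfl | hc
    · refine le_trans (tsum_lintegral_latticeWave_zero_le n (by linarith) hβ hl)
        (le_trans ?_ le_self_add)
      -- As `l ≥ 1` and `2 Re v ≥ 1`, the zero row is dominated by the same power of `l` as the
      -- other rows.
      have hle : ENNReal.ofReal ((l : ℝ) ^ (1 - β.re)) ≤ D :=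
        ENNReal.ofReal_le_ofReal (Real.rpow_le_rpow_of_exponent_le hl1 (by simp; linarith))
      rw [if_pos rfl, ENNReal.ofReal_mul (q := (l : ℝ) ^ (1 - β.re)) (by positivity),
        mul_right_comm]
      exact mul_le_mul' le_rfl hle
    · rw [if_neg hc, zero_add]
      rcases Int.natAbs_eq c with h | h
      · rw [h, hnat _ (Int.natAbs_pos.mpr hc)]
        simp
      · rw [h, tsum_lintegral_latticeWave_neg hn, hnat _ (Int.natAbs_pos.mpr hc)]
        simp
  refine (ENNReal.tsum_le_tsum hb).trans (le_of_eq ?_)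
  rw [ENNReal.tsum_add, tsum_ite_eq, ENNReal.tsum_mul_right]
  ring

lemma tsum_ite_dvd {l : ℕ} (hl : 0 < l) (w : ℂ) :
    ∑' c : ℕ+, (if (c : ℕ) ∣ l then ((c : ℕ) : ℂ) ^ w else 0) = divisorSum w l := by
  rw [tsum_pnat_eq_tsum_of_eq_zero (f := fun c : ℕ => if c ∣ l then (c : ℂ) ^ w else 0)
    (by simp [hl.ne']), tsum_eq_sum (s := l.divisors), divisorSum]
  · refine Finset.sum_congr rfl fun c hc => ?_
    rw [if_pos (Nat.dvd_of_mem_divisors hc)]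
  · intro c hc
    rw [if_neg fun h => hc (Nat.mem_divisors.mpr ⟨h, hl.ne'⟩)]

/-- The involution `d ↦ l/d`; it converts the `σ_{1-2v}` produced by the rows into `σ_{2v-1}`. -/
lemma divisorSum_neg {l : ℕ} (hl : 0 < l) (w : ℂ) :
    divisorSum w l = (l : ℂ) ^ w * divisorSum (-w) l := by
  rw [divisorSum, ← Nat.sum_div_divisors, divisorSum, Finset.mul_sum]
  refine Finset.sum_congr rfl fun d hd => ?_
  obtain ⟨e, rfl⟩ := Nat.dvd_of_mem_divisors hd
  have hd0 : d ≠ 0 := by rintro rfl; simp at hl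
  have hdc : (d : ℂ) ≠ 0 := by exact_mod_cast hd0
  have h : (d : ℂ) ^ w ≠ 0 := by rw [Ne, Complex.cpow_eq_zero_iff]; tauto
  rw [Nat.mul_div_cancel_left _ (Nat.pos_of_ne_zero hd0), Nat.cast_mul,
    Complex.natCast_mul_natCast_cpow, Complex.cpow_neg]
  field_simp

/-- The sum of the integrals of the lattice waves over all rows. -/
lemma tsum_integral_latticeWave_all (hn : Even n) (hv : 1 < v.re) (hs : 0 < (β - 2 * v).re)
    {l : ℕ} (hl : 0 < l) :
    ∑' p : ℤ × ℤ, ∫ z in strip, latticeWave n v β l p.1 p.2 z =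
      2 * (∫ z, waveKernel n v β 1 z) * (divisorSum (2 * v - 1) l / (l : ℂ) ^ (β - 1)) := by
  have hβ : 1 < β.re := by simp at hs; linarith
  have hlc : (l : ℂ) ≠ 0 := by exact_mod_cast hl.ne'
  obtain ⟨K, hK, hb⟩ := exists_tsum_lintegral_latticeWave_le hn hv hs
  have hsum : Summable fun p : ℤ × ℤ => ∫ z in strip, latticeWave n v β l p.1 p.2 z := by
    refine Summable.of_norm ?_
    rw [← tsum_enorm_ne_top_iff_summable_norm]
    refine ne_top_of_le_ne_top ?_
      (ENNReal.tsum_le_tsum fun j => enorm_integral_le_lintegral_enorm _)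
    rw [ENNReal.tsum_prod']
    exact ne_top_of_le_ne_top (ENNReal.mul_ne_top hK ENNReal.ofReal_ne_top) (hb l hl)
  rw [hsum.tsum_prod, tsum_int_eq_zero_add_two_mul_tsum_pnat
    (fun c => tsum_integral_latticeWave_neg hn l c) hsum.prod]
  have h0 : ∑' j : ℤ, ∫ z in strip, latticeWave n v β l 0 j z = 0 := by
    simp_rw [fun j => integral_latticeWave_zero n (v := v) hβ hl j]
    exact tsum_zero
  have h1 : ∀ c : ℕ+, ∑' j : ℤ, ∫ z in strip, latticeWave n v β l ((c : ℕ) : ℤ) j z =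
      (if (c : ℕ) ∣ l then ((c : ℕ) : ℂ) ^ (1 - 2 * v) else 0) *
        ((l : ℂ) ^ (2 * v - β) * ∫ z, waveKernel n v β 1 z) := by
    intro c
    rw [tsum_integral_latticeWave n (by linarith) hs hl c.pos]
    split_ifs
    · ring
    · ring
  rw [h0, tsum_congr h1, tsum_mul_right, tsum_ite_dvd hl, divisorSum_neg hl (2 * v - 1), neg_sub,
    show 2 * v - β = (2 * v - 1) - (β - 1) by ring, Complex.cpow_sub _ _ hlc]
  ring

variable {A : ℕ+ → ℂ}

/-- The triple series of lattice waves converges absolutely. -/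
lemma tsum_lintegral_wave_ne_top (hn : Even n) (hv : 1 < v.re) (hs : 0 < (β - 2 * v).re)
    (hA : Summable fun l : ℕ+ => ‖A l‖ * (l : ℝ) ^ (2 * v - β).re) :
    ∑' p : ℕ+ × ℤ × ℤ, ∫⁻ z in strip, ‖A p.1 * latticeWave n v β p.1 p.2.1 p.2.2 z‖ₑ ≠ ⊤ := by
  obtain ⟨K, hK, hb⟩ := exists_tsum_lintegral_latticeWave_le hn hv hs
  simp_rw [enorm_mul, fun p : ℕ+ × ℤ × ℤ => lintegral_const_mul' ‖A p.1‖ₑ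
    (fun z => ‖latticeWave n v β p.1 p.2.1 p.2.2 z‖ₑ) enorm_ne_top (μ := volume.restrict strip)]
  rw [ENNReal.tsum_prod']
  simp_rw [ENNReal.tsum_mul_left]
  refine ne_top_of_le_ne_top (ENNReal.mul_ne_top hK hA.tsum_ofReal_ne_top) ?_
  rw [← ENNReal.tsum_mul_left]
  refine ENNReal.tsum_le_tsum fun l => ?_
  rw [ENNReal.tsum_prod', ENNReal.ofReal_mul (norm_nonneg _), ofReal_norm, mul_left_comm]
  gcongr
  exact hb l l.pos

/-- The integral over the strip of the triple series. -/
lemma integral_strip_tsum_wave (hn : Even n) (hv : 1 < v.re) (hs : 0 < (β - 2 * v).re)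
    (hA : Summable fun l : ℕ+ => ‖A l‖ * (l : ℝ) ^ (2 * v - β).re) :
    ∫ z in strip, ∑' p : ℕ+ × ℤ × ℤ, A p.1 * latticeWave n v β p.1 p.2.1 p.2.2 z =
      2 * archIntegral n v (β - 1) *
        ∑' l : ℕ+, A l * divisorSum (2 * v - 1) l / (l : ℂ) ^ (β - 1) := by
  have h := hasSum_integral_of_tsum_lintegral (fun p : ℕ+ × ℤ × ℤ =>
    ((measurable_latticeWave n v β p.1 p.2.1 p.2.2).const_mul (A p.1)).aestronglyMeasurable)
    (tsum_lintegral_wave_ne_top hn hv hs hA)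
  rw [← h.tsum_eq, h.summable.tsum_prod, ← tsum_mul_left]
  refine tsum_congr fun l => ?_
  simp only [integral_const_mul]
  rw [tsum_mul_left, tsum_integral_latticeWave_all hn hv hs l.pos,
    integral_waveKernel_one n (by linarith) hs]
  ring

lemma integrableOn_strip_tsum_wave (hn : Even n) (hv : 1 < v.re) (hs : 0 < (β - 2 * v).re)
    (hA : Summable fun l : ℕ+ => ‖A l‖ * (l : ℝ) ^ (2 * v - β).re) :
    IntegrableOn (fun z => ∑' p : ℕ+ × ℤ × ℤ, A p.1 * latticeWave n v β p.1 p.2.1 p.2.2 z)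
      strip :=
  integrable_tsum_of_tsum_lintegral (fun p : ℕ+ × ℤ × ℤ =>
    ((measurable_latticeWave n v β p.1 p.2.1 p.2.2).const_mul (A p.1)).aestronglyMeasurable)
    (tsum_lintegral_wave_ne_top hn hv hs hA)

end TripleSeries

/-! ### Fourier coefficients and decay of cusp forms -/

section CuspForms

variable {k : ℤ} (f : CuspForm 𝒮ℒ k)

lemma cuspForm_smul (γ : SL(2, ℤ)) (z : ℍ) : f (γ • z) = autFactor γ z ^ k * f z := by
  have h := SlashInvariantForm.slash_action_eqn'' f
    (γ := Matrix.SpecialLinearGroup.mapGL ℝ γ) (MonoidHom.mem_range.mpr ⟨γ, rfl⟩) z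
  have h2 := ModularGroup.denom_apply γ z
  rw [autFactor, ← h2]
  exact h

/-- The Fourier coefficients of a cusp form. -/
def fourierCoeff (l : ℕ+) : ℂ := (qExpansion 1 f).coeff (l : ℕ)

lemma hasSum_fourierCoeff (z : ℍ) :
    HasSum (fun l : ℕ+ => fourierCoeff f l *
      Complex.exp (2 * Real.pi * Complex.I * (((l : ℕ) : ℂ) * z))) (f z) := by
  have h := ModularForm.hasSum_qExpansion f one_pos (k := k) one_mem_strictPeriods_SL z
  rw [← add_zero (f z), ← mul_one (0 : ℂ)] at h
  have h0 := CuspFormClass.qExpansion_coeff_zero f one_pos one_mem_strictPeriods_SL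
  have h2 := (hasSum_pnat_iff (f := fun m : ℕ => (qExpansion 1 f).coeff m *
    Function.Periodic.qParam 1 z ^ m) (a := f z)).mpr (by simpa [h0] using h)
  refine h2.congr_fun fun l => ?_
  rw [fourierCoeff, Function.Periodic.qParam, ← Complex.exp_nat_mul]
  congr 2
  push_cast
  ring

lemma exists_norm_fourierCoeff_le :
    ∃ C : ℝ, 0 ≤ C ∧ ∀ l : ℕ+, ‖fourierCoeff f l‖ ≤ C * (l : ℝ) ^ ((k : ℝ) / 2) := by
  have h := CuspFormClass.qExpansion_isBigO f
  rw [Subgroup.strictWidthInfty_SL2Z] at h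
  obtain ⟨C, hC, hb⟩ := Asymptotics.bound_of_isBigO_nat_atTop h
  refine ⟨C, hC.le, fun l => ?_⟩
  have hl : (0 : ℝ) < ((l : ℕ) : ℝ) := by exact_mod_cast l.pos
  have hpos := Real.rpow_pos_of_pos hl ((k : ℝ) / 2)
  have := hb (x := l) hpos.ne'
  rwa [Real.norm_of_nonneg hpos.le] at this

lemma summable_pnat_rpow {x : ℝ} (hx : x < -1) : Summable fun l : ℕ+ => (l : ℝ) ^ x :=
  (Real.summable_nat_rpow.mpr hx).comp_injective PNat.coe_injective

lemma summable_norm_fourierCoeff {x : ℝ} (hx : (k : ℝ) / 2 + x < -1) :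
    Summable fun l : ℕ+ => ‖fourierCoeff f l‖ * (l : ℝ) ^ x := by
  obtain ⟨C, hC, hb⟩ := exists_norm_fourierCoeff_le f
  refine Summable.of_nonneg_of_le (fun l => by positivity) (fun l => ?_)
    ((summable_pnat_rpow hx).mul_left C)
  have hl : (0 : ℝ) < ((l : ℕ) : ℝ) := by exact_mod_cast l.pos
  rw [Real.rpow_add hl, ← mul_assoc]
  gcongr
  exact hb l

lemma exists_norm_cuspForm_mul_le (N : ℝ) : ∃ C, ∀ z ∈ 𝒟, ‖f z‖ ≤ C * z.im ^ N := by
  refine ModularGroup.exists_bound_fundamental_domain_of_isBigO (ModularFormClass.continuous f) ?_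
  refine (CuspFormClass.exp_decay_atImInfty f one_pos one_mem_strictPeriods_SL).trans ?_
  have h := (isLittleO_exp_neg_mul_rpow_atTop (a := 2 * Real.pi) (by positivity) N).isBigO
  have h2 := h.comp_tendsto (k := UpperHalfPlane.im) (l' := atImInfty) Filter.tendsto_comap
  refine h2.congr_left fun z => ?_
  simp

end CuspForms

/-! ### First unfolding and the identity for lattice sums -/

section Unfold

variable {k : ℤ} (f : CuspForm 𝒮ℒ k)

/-- The function on the strip that appears after unfolding. -/
def stripFunction (m : ℕ) (u v : ℂ) (z : ℍ) : ℂ :=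
  f z * (z.im : ℂ) ^ ((k : ℂ) / 2 + u) * latticeSum (-(2 * m)) v z

lemma latticeTerm_eq_sphericalPower (m : ℕ) {v : ℂ} (hv : 0 < v.re) (z : ℍ) (x : Fin 2 → ℤ) :
    latticeTerm (-(2 * m)) v z x =
      (z.im : ℂ) ^ v * sphericalPower (2 * m) v ((x 0 : ℂ) * z + x 1) := by
  have hv0 : -2 * v ≠ 0 := by
    intro h
    have := congrArg Complex.re h
    simp at this
    linarith
  rcases eq_or_ne x 0 with rfl | hx
  · rw [latticeTerm_zero _ hv]
    simp only [sphericalPower, Pi.zero_apply, Int.cast_zero, zero_mul, add_zero, norm_zero,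
      Complex.ofReal_zero, Complex.zero_cpow hv0, mul_zero]
  · have hω := norm_pos_iff.mpr (latticePoint_ne_zero z hx)
    have hωc : (‖latticePoint z x‖ : ℂ) ≠ 0 := by exact_mod_cast hω.ne'
    have hy := z.im_pos
    rw [latticeTerm, ← latticePoint, sphericalPower, neg_neg, div_eq_mul_inv z.im,
      Complex.ofReal_mul, Complex.mul_cpow_ofReal_nonneg hy.le (by positivity)]
    have h1 : (((‖latticePoint z x‖ ^ 2)⁻¹ : ℝ) : ℂ) ^ v = (‖latticePoint z x‖ : ℂ) ^ (-2 * v) := by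
      rw [Complex.cpow_def_of_ne_zero (by exact_mod_cast (by positivity)),
        Complex.cpow_def_of_ne_zero hωc, ← Complex.ofReal_log (by positivity),
        ← Complex.ofReal_log hω.le, Real.log_inv, Real.log_pow]
      congr 1
      push_cast
      ring
    have h2 : (latticePoint z x / (‖latticePoint z x‖ : ℂ)) ^ (2 * (m : ℤ)) =
        (latticePoint z x / (‖latticePoint z x‖ : ℂ)) ^ (2 * m) := by norm_cast
    rw [h1, h2]
    ring

/-- Both factors are absolutely convergent series, so their product is a triple series; the powers
of `y` combine to `β = k/2 + u + v`. -/
lemma stripFunction_eq_tsum (m : ℕ) (u : ℂ) {v : ℂ} (hv : 1 < v.re) (z : ℍ) :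
    stripFunction f m u v z = ∑' p : ℕ+ × ℤ × ℤ, fourierCoeff f p.1 *
      latticeWave (2 * m) v ((k : ℂ) / 2 + u + v) p.1 p.2.1 p.2.2 z := by
  have hyc : (z.im : ℂ) ≠ 0 := by exact_mod_cast z.im_pos.ne'
  have h1 := hasSum_fourierCoeff f z
  have h2 := summable_latticeTerm (-(2 * m)) hv z
  have e : latticeSum (-(2 * m)) v z = ∑' p : ℤ × ℤ, (z.im : ℂ) ^ v *
      sphericalPower (2 * m) v ((p.1 : ℂ) * z + p.2) := by
    rw [latticeSum, ← (finTwoArrowEquiv ℤ).symm.tsum_eq]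
    refine tsum_congr fun p => ?_
    rw [latticeTerm_eq_sphericalPower m (by linarith)]
    simp
  have h3 : Summable fun p : ℤ × ℤ => (z.im : ℂ) ^ v *
      sphericalPower (2 * m) v ((p.1 : ℂ) * z + p.2) := by
    refine ((finTwoArrowEquiv ℤ).symm.summable_iff.mpr h2).congr fun p => ?_
    rw [Function.comp_apply, latticeTerm_eq_sphericalPower m (by linarith)]
    simp
  rw [stripFunction, e, mul_right_comm, ← h1.tsum_eq,
    tsum_mul_tsum_of_summable_norm h1.summable.norm h3.norm, ← tsum_mul_right]
  refine tsum_congr fun p => ?_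
  rw [latticeWave, Complex.cpow_add _ v hyc]
  ring

/-- The product `f y ^ (k/2)` contributes the unitary factor of weight `k`, and the lattice sum that
of weight `-2m`. What remains has weight `k₁`, exactly a term of the series for `E_{-k₁}`. -/
lemma stripFunction_smul {k₁ : ℤ} (m : ℕ) (hk : k₁ + 2 * m = k) (u v : ℂ) (γ : SL(2, ℤ)) (z : ℍ) :
    stripFunction f m u v (γ • z) = f z * (z.im : ℂ) ^ ((k : ℂ) / 2) * latticeSum (-(2 * m)) v z *
      eisensteinTerm (-k₁) z u γ := by
  have hj := autFactor_ne_zero γ z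
  have hn := norm_pos_iff.mpr hj
  have hnc : (‖autFactor γ z‖ : ℂ) ≠ 0 := by exact_mod_cast hn.ne'
  have hy := (γ • z).im_pos
  have hyc : ((γ • z).im : ℂ) ≠ 0 := by exact_mod_cast hy.ne'
  have h1 : ((γ • z).im : ℂ) ^ ((k : ℂ) / 2) =
      (z.im : ℂ) ^ ((k : ℂ) / 2) * (‖autFactor γ z‖ : ℂ) ^ (-k) := by
    rw [im_smul_eq, div_eq_mul_inv, Complex.ofReal_mul, Complex.mul_cpow_ofReal_nonneg z.im_pos.le
      (by positivity)]
    congr 1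
    rw [← Complex.cpow_intCast, Complex.cpow_def_of_ne_zero (by exact_mod_cast (by positivity)),
      Complex.cpow_def_of_ne_zero hnc, ← Complex.ofReal_log (by positivity),
      ← Complex.ofReal_log hn.le, Real.log_inv, Real.log_pow]
    congr 1
    push_cast
    ring
  have h2 : autFactor γ z ^ k = autFactor γ z ^ k₁ * autFactor γ z ^ (2 * m : ℤ) := by
    rw [← zpow_add₀ hj, hk]
  have h3 : (‖autFactor γ z‖ : ℂ) ^ (-k) =
      ((‖autFactor γ z‖ : ℂ) ^ k₁ * (‖autFactor γ z‖ : ℂ) ^ (2 * m : ℤ))⁻¹ := by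
    rw [← zpow_add₀ hnc, hk, zpow_neg]
  rw [stripFunction, cuspForm_smul, latticeSum_smul_SL, Complex.cpow_add _ _ hyc, h1,
    eisensteinTerm, neg_neg, h2, h3, zpow_neg, div_zpow, div_zpow]
  field_simp

lemma stripFunction_T_smul {k₁ : ℤ} (m : ℕ) (hk : k₁ + 2 * m = k) (u v : ℂ) (z : ℍ) :
    stripFunction f m u v (ModularGroup.T • z) = stripFunction f m u v z := by
  rw [stripFunction_smul f m hk, ← one_smul SL(2, ℤ) z, stripFunction_smul f m hk, one_smul]
  congr 1
  have h0 : (ModularGroup.T 1 0 : ℤ) = 0 := rfl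
  have h1 : (ModularGroup.T 1 1 : ℤ) = 1 := rfl
  rw [eisensteinTerm, eisensteinTerm, one_smul, ModularGroup.im_T_smul]
  simp [autFactor, h0, h1]

lemma measurable_stripFunction (m : ℕ) (u : ℂ) {v : ℂ} (hv : 1 < v.re) :
    Measurable (stripFunction f m u v) := by
  have h1 : Measurable f := (ModularFormClass.continuous f).measurable
  have h2 : Measurable fun z : ℍ => z.im := UpperHalfPlane.continuous_im.measurable
  have h3 := measurable_latticeSum (-(2 * m)) hv
  unfold stripFunction
  fun_prop

/-- The Rankin-Selberg identity in the region of absolute convergence. -/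
theorem integral_fd_latticeSum {k₁ : ℤ} (hk₁ : Even k₁) (m : ℕ) (hk : k₁ + 2 * m = k) {u v : ℂ}
    (hu : 1 < u.re) (hv : 1 < v.re) (huv : v.re < u.re - 1) (hvk : 0 < u.re - v.re + (k : ℝ) / 2) :
    ∫ z in 𝒟, f z * (z.im : ℂ) ^ ((k : ℂ) / 2) * latticeSum (-k₁) u z *
        latticeSum (-(2 * m)) v z =
      4 * riemannZeta (2 * u) * archIntegral (2 * m) v (u + v + (k : ℂ) / 2 - 1) *
        ∑' l : ℕ+, fourierCoeff f l * divisorSum (2 * v - 1) l /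
          (l : ℂ) ^ (u + v + (k : ℂ) / 2 - 1) := by
  have hβ : (k : ℂ) / 2 + u + v = u + v + (k : ℂ) / 2 := by ring
  have hkre : ((k : ℂ) / 2).re = (k : ℝ) / 2 := by
    rw [← Complex.ofReal_intCast, ← Complex.ofReal_ofNat, ← Complex.ofReal_div, Complex.ofReal_re]
  have hs : 0 < ((k : ℂ) / 2 + u + v - 2 * v).re := by
    simp only [Complex.sub_re, Complex.add_re, hkre, Complex.mul_re, Complex.re_ofNat,
      Complex.im_ofNat, zero_mul, sub_zero]
    linarith
  -- With coefficients of size `l ^ (k/2)`, the total exponent of `l` is `Re v - Re u`, less than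
  -- `-1` by `huv`.
  have hA := summable_norm_fourierCoeff f (x := (2 * v - ((k : ℂ) / 2 + u + v)).re) (by
    simp only [Complex.sub_re, Complex.add_re, hkre, Complex.mul_re, Complex.re_ofNat,
      Complex.im_ofNat, zero_mul, sub_zero]
    linarith)
  have hn : Even (2 * m) := even_two_mul m
  have hfun : stripFunction f m u v = fun z => ∑' p : ℕ+ × ℤ × ℤ, fourierCoeff f p.1 *
      latticeWave (2 * m) v ((k : ℂ) / 2 + u + v) p.1 p.2.1 p.2.2 z :=
    funext fun z => stripFunction_eq_tsum f m u hv z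
  have hint : IntegrableOn (stripFunction f m u v) strip := by
    rw [hfun]
    exact integrableOn_strip_tsum_wave hn hv hs hA
  have hval := integral_strip_tsum_wave hn hv hs hA
  rw [← hfun, ← integral_fd_tsum_eq (stripFunction_T_smul f m hk u v) hint
    (measurable_stripFunction f m u hv), hβ] at hval
  have e : ∀ z : ℍ, f z * (z.im : ℂ) ^ ((k : ℂ) / 2) * latticeSum (-k₁) u z *
      latticeSum (-(2 * m)) v z = 2 * riemannZeta (2 * u) *
        ∑' q : Cosets, stripFunction f m u v (q.out • z) := by
    intro z
    simp_rw [fun q : Cosets => stripFunction_smul f m hk u v q.out z]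
    rw [tsum_mul_left, latticeSum_eq hk₁.neg hu, eisensteinSeries]
    ring
  simp_rw [e]
  rw [integral_const_mul, hval]
  ring

end Unfold

/-! ### Holomorphy of the inner product in `v` -/

section Continuation

variable {k : ℤ} (f : CuspForm 𝒮ℒ k)

/-- The complex conjugate of the incomplete Mellin transform, as a holomorphic function. -/
def conjTail (m : ℕ) (z : ℍ) (v : ℂ) : ℂ := conj (eisensteinTail m z (conj v))

lemma differentiable_conjTail (m : ℕ) (z : ℍ) : Differentiable ℂ (conjTail m z) := fun v => by
  have := (differentiable_eisensteinTail m z (conj v)).conj_conj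
  rw [Complex.conj_conj] at this
  exact this

lemma measurable_conjTail (m : ℕ) (v : ℂ) : Measurable fun z : ℍ => conjTail m z v :=
  Complex.continuous_conj.measurable.comp (measurable_eisensteinTail m (conj v))

lemma exists_norm_conjTail_le (m : ℕ) (σ : ℝ) :
    ∃ C N : ℝ, 0 ≤ C ∧ ∀ z ∈ 𝒟, ∀ s : ℂ, s.re ≤ σ → ‖conjTail m z s‖ ≤ C * z.im ^ N := by
  obtain ⟨C, N, hC, h⟩ := exists_norm_eisensteinTail_le m σ
  refine ⟨C, N, hC, fun z hz s hs => ?_⟩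
  rw [conjTail, RCLike.norm_conj]
  exact h z hz _ (by simpa using hs)

lemma conj_completedEisenstein {n : ℤ} (hn : Even n) (z : ℍ) {u : ℂ} (hu : 1 < u.re) :
    conj (completedEisenstein n z (conj u)) = 1 / 2 * (Real.pi : ℂ) ^ (-u) *
      Complex.Gamma (u + ((|n| : ℤ) : ℂ) / 2) * latticeSum (-n) u z := by
  rw [completedEisenstein_eq_latticeSum hn z (by simpa using hu)]
  simp only [map_mul, map_div₀, map_one, map_ofNat, conj_latticeSum]
  congr 2
  · congr 1
    rw [← map_neg, Complex.cpow_conj _ _ (by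
      rw [Complex.arg_ofReal_of_nonneg Real.pi_pos.le]; exact Real.pi_pos.ne),
      Complex.conj_conj, Complex.conj_ofReal]
  · rw [← Complex.Gamma_conj]
    simp [Complex.conj_ofNat]

lemma conj_completedEisenstein_two_mul (m : ℕ) (z : ℍ) {v : ℂ} (hv : m = 0 → v ≠ 0 ∧ v ≠ 1) :
    conj (completedEisenstein (2 * m) z (conj v)) = 1 / 2 * (Real.pi : ℂ) ^ m / (z.im : ℂ) ^ m *
      (conjTail m z v + conjTail m z (1 - v) - thetaConst m * (1 / v + 1 / (1 - v))) := by
  have hd : conj v ∈ eisensteinDomain (2 * m) := by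
    intro h
    obtain ⟨h0, h1⟩ := hv (by lia)
    constructor
    · simpa using h0
    · intro h
      apply h1
      rw [← Complex.conj_conj v, h, map_one]
  rw [completedEisenstein_eq_of_isContinuation (isContinuation_thetaEisenstein m z) hd,
    thetaEisenstein]
  have h3 : conj (thetaConst m) = thetaConst m := by
    rw [thetaConst]; split_ifs <;> simp
  simp only [map_mul, map_div₀, map_pow, map_one, map_ofNat, map_add, map_sub, h3,
    Complex.conj_ofReal, Complex.conj_conj, conjTail]

/-- The part of the Petersson integrand which does not depend on the second spectral parameter. -/
def outerFactor (k₁ : ℤ) (m : ℕ) (u : ℂ) (z : ℍ) : ℂ :=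
  f z * (z.im : ℂ) ^ ((k : ℂ) / 2) * (1 / 2 * (Real.pi : ℂ) ^ (-u) *
      Complex.Gamma (u + ((|k₁| : ℤ) : ℂ) / 2) * latticeSum (-k₁) u z) *
    (1 / 2 * (Real.pi : ℂ) ^ m / (z.im : ℂ) ^ m)

lemma peterssonIntegrand_eq_mul_conj {k₁ k₂ : ℤ} (hk : k₁ + k₂ = k) (u v : ℂ) (z : ℍ) :
    peterssonIntegrand k f (eisensteinProduct k₁ k₂ (conj u) (conj v)) z =
      f z * (z.im : ℂ) ^ ((k : ℂ) / 2) * conj (completedEisenstein k₁ z (conj u)) *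
        conj (completedEisenstein k₂ z (conj v)) := by
  have hyc : (z.im : ℂ) ≠ 0 := by exact_mod_cast z.im_pos.ne'
  have h1 : conj ((z.im : ℂ) ^ (-((k : ℂ) / 2))) = (z.im : ℂ) ^ (-((k : ℂ) / 2)) := by
    rw [← Complex.ofReal_intCast, ← Complex.ofReal_ofNat, ← Complex.ofReal_div,
      ← Complex.ofReal_neg, ← Complex.ofReal_cpow z.im_pos.le, Complex.conj_ofReal]
  have h2 : (z.im : ℂ) ^ k * (z.im : ℂ) ^ (-((k : ℂ) / 2)) = (z.im : ℂ) ^ ((k : ℂ) / 2) := by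
    rw [← Complex.cpow_intCast, ← Complex.cpow_add _ _ hyc]
    congr 1
    ring
  rw [peterssonIntegrand, eisensteinProduct, hk, map_mul, map_mul, h1, ← h2]
  ring

lemma peterssonIntegrand_eq {k₁ : ℤ} (hk₁ : Even k₁) (m : ℕ) (hk : k₁ + 2 * m = k) {u v : ℂ}
    (hu : 1 < u.re) (hv : m = 0 → v ≠ 0 ∧ v ≠ 1) (z : ℍ) :
    peterssonIntegrand k f (eisensteinProduct k₁ (2 * m) (conj u) (conj v)) z =
      outerFactor f k₁ m u z * (conjTail m z v + conjTail m z (1 - v)) -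
        thetaConst m * (1 / v + 1 / (1 - v)) * outerFactor f k₁ m u z := by
  rw [peterssonIntegrand_eq_mul_conj f hk, conj_completedEisenstein hk₁ z hu,
    conj_completedEisenstein_two_mul m z hv, outerFactor]
  ring

lemma measurable_outerFactor (k₁ : ℤ) (m : ℕ) {u : ℂ} (hu : 1 < u.re) :
    Measurable (outerFactor f k₁ m u) := by
  have h1 : Measurable f := (ModularFormClass.continuous f).measurable
  have h2 : Measurable fun z : ℍ => z.im := UpperHalfPlane.continuous_im.measurable
  have h3 := measurable_latticeSum (-k₁) hu
  unfold outerFactor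
  fun_prop

/-- A cusp form decays faster than any power of `y` on `𝒟`. The exponent requested from it below is
the one that cancels every other power of `y`. -/
lemma exists_norm_outerFactor_mul_le (k₁ : ℤ) (m : ℕ) {u : ℂ} (hu : 1 < u.re) (N : ℝ) :
    ∃ C, ∀ z ∈ 𝒟, ‖outerFactor f k₁ m u z‖ * z.im ^ N ≤ C := by
  obtain ⟨C₁, hC₁, h₁⟩ := exists_norm_latticeSum_le (-k₁) hu
  obtain ⟨C₂, h₂⟩ := exists_norm_cuspForm_mul_le f (-(k / 2 + u.re - m + N))
  set A : ℝ := ‖1 / 2 * (Real.pi : ℂ) ^ (-u) * Complex.Gamma (u + ((|k₁| : ℤ) : ℂ) / 2)‖ with hA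
  set B : ℝ := ‖1 / 2 * (Real.pi : ℂ) ^ m‖ with hB
  refine ⟨C₂ * A * C₁ * B, fun z hz => ?_⟩
  have hy := z.im_pos
  have hkre : ((k : ℂ) / 2).re = (k : ℝ) / 2 := by simp
  have h3 : ‖outerFactor f k₁ m u z‖ =
      ‖f z‖ * (z.im ^ ((k : ℝ) / 2) * A * ‖latticeSum (-k₁) u z‖ * B * z.im ^ (-(m : ℝ))) := by
    rw [outerFactor, norm_mul, norm_mul, norm_mul, norm_mul _ (latticeSum _ _ _), ← hA, norm_div,
      ← hB, Complex.norm_cpow_eq_rpow_re_of_pos hy, hkre, norm_pow, Complex.norm_real,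
      Real.norm_of_nonneg hy.le, Real.rpow_neg hy.le, Real.rpow_natCast]
    ring
  have h4 : z.im ^ (-(k / 2 + u.re - m + N)) * (z.im ^ ((k : ℝ) / 2) * z.im ^ u.re *
      z.im ^ (-(m : ℝ)) * z.im ^ N) = 1 := by
    rw [← Real.rpow_add hy, ← Real.rpow_add hy, ← Real.rpow_add hy, ← Real.rpow_add hy]
    convert Real.rpow_zero _ using 2
    ring
  have hA0 : 0 ≤ A := norm_nonneg _
  have hB0 : 0 ≤ B := norm_nonneg _
  calc ‖outerFactor f k₁ m u z‖ * z.im ^ N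
      ≤ C₂ * z.im ^ (-(k / 2 + u.re - m + N)) * (z.im ^ ((k : ℝ) / 2) * A *
        (C₁ * z.im ^ u.re) * B * z.im ^ (-(m : ℝ))) * z.im ^ N := by
        rw [h3]
        have hf := h₂ z hz
        have hl := h₁ z hz
        have := (norm_nonneg _).trans hf
        gcongr
    _ = C₂ * A * C₁ * B * (z.im ^ (-(k / 2 + u.re - m + N)) * (z.im ^ ((k : ℝ) / 2) *
      z.im ^ u.re * z.im ^ (-(m : ℝ)) * z.im ^ N)) := by ring
    _ = _ := by rw [h4, mul_one]

lemma exists_norm_outerFactor_mul_conjTail_le (k₁ : ℤ) (m : ℕ) {u : ℂ} (hu : 1 < u.re) (σ : ℝ) :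
    ∃ C, ∀ z ∈ 𝒟, ∀ v : ℂ, v.re ≤ σ → ‖outerFactor f k₁ m u z * conjTail m z v‖ ≤ C := by
  obtain ⟨C, N, hC, h⟩ := exists_norm_conjTail_le m σ
  obtain ⟨C', h'⟩ := exists_norm_outerFactor_mul_le f k₁ m hu N
  refine ⟨C * C', fun z hz v hv => ?_⟩
  rw [norm_mul]
  calc _ ≤ ‖outerFactor f k₁ m u z‖ * (C * z.im ^ N) := by gcongr; exact h z hz v hv
    _ = C * (‖outerFactor f k₁ m u z‖ * z.im ^ N) := by ring
    _ ≤ _ := by gcongr; exact h' z hz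

lemma integrableOn_fd_of_norm_le {g : ℍ → ℂ} (hg : Measurable g) {C : ℝ}
    (h : ∀ z ∈ 𝒟, ‖g z‖ ≤ C) : IntegrableOn g 𝒟 :=
  IntegrableOn.of_bound volume_fd_lt_top hg.aestronglyMeasurable C
    ((ae_restrict_iff' ModularGroup.isClosed_fd.measurableSet).mpr (ae_of_all _ h))

lemma integrableOn_outerFactor (k₁ : ℤ) (m : ℕ) {u : ℂ} (hu : 1 < u.re) :
    IntegrableOn (outerFactor f k₁ m u) 𝒟 := by
  obtain ⟨C, h⟩ := exists_norm_outerFactor_mul_le f k₁ m hu 0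
  exact integrableOn_fd_of_norm_le (measurable_outerFactor f k₁ m hu) (C := C) (by simpa using h)

lemma integrableOn_outerFactor_mul_conjTail (k₁ : ℤ) (m : ℕ) {u : ℂ} (hu : 1 < u.re) (v : ℂ) :
    IntegrableOn (fun z => outerFactor f k₁ m u z * conjTail m z v) 𝒟 := by
  obtain ⟨C, h⟩ := exists_norm_outerFactor_mul_conjTail_le f k₁ m hu v.re
  exact integrableOn_fd_of_norm_le ((measurable_outerFactor f k₁ m hu).mul
    (measurable_conjTail m v)) fun z hz => h z hz v le_rfl

/-- The integrand is entire in `v` and bounded by a constant for `Re v` bounded above, and `𝒟` has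
finite volume. -/
lemma differentiable_integral_outerFactor_mul_conjTail (k₁ : ℤ) (m : ℕ) {u : ℂ} (hu : 1 < u.re) :
    Differentiable ℂ fun v => ∫ z in 𝒟, outerFactor f k₁ m u z * conjTail m z v := by
  rw [← differentiableOn_univ]
  refine differentiableOn_integral_of_locally_dominated isOpen_univ
    (fun v _ => ((measurable_outerFactor f k₁ m hu).mul
      (measurable_conjTail m v)).aestronglyMeasurable)
    (ae_of_all _ fun z => ((differentiable_conjTail m z).const_mul _).differentiableOn)
    fun v₀ _ => ?_
  obtain ⟨C, h⟩ := exists_norm_outerFactor_mul_conjTail_le f k₁ m hu (v₀.re + 1)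
  refine ⟨{v | v.re < v₀.re + 1}, (isOpen_lt Complex.continuous_re continuous_const).mem_nhds
    (by simp), fun _ => C, ?_, ?_⟩
  · exact integrableOn_const volume_fd_lt_top.ne
  · exact (ae_restrict_iff' ModularGroup.isClosed_fd.measurableSet).mpr (ae_of_all _ fun z hz v hv => h z hz v hv.le)

end Continuation

/-! ### The convolution Dirichlet series -/

section DirichletSeries

variable {k : ℤ} (f : CuspForm 𝒮ℒ k)

/-- There are at most `l` divisors, and each term is at most `l` to the power `max(0, 2 Re v - 1)`,
written as `|a| + a` with `a = Re v - 1/2`. -/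
lemma norm_divisorSum_le (v : ℂ) {l : ℕ} (hl : 0 < l) :
    ‖divisorSum (2 * v - 1) l‖ ≤ (l : ℝ) ^ (1 + (|v.re - 1 / 2| + (v.re - 1 / 2))) := by
  have hl0 : (0 : ℝ) < l := by exact_mod_cast hl
  have hl1 : (1 : ℝ) ≤ l := by exact_mod_cast hl
  set e := |v.re - 1 / 2| + (v.re - 1 / 2) with he
  have he0 : 0 ≤ e := by have := neg_abs_le (v.re - 1 / 2); linarith
  have h : ∀ d ∈ l.divisors, ‖(d : ℂ) ^ (2 * v - 1)‖ ≤ (l : ℝ) ^ e := by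
    intro d hd
    have hd0 := Nat.pos_of_mem_divisors hd
    have hdl := Nat.divisor_le hd
    rw [Complex.norm_natCast_cpow_of_pos hd0]
    have hre : (2 * v - 1).re ≤ e := by
      have := le_abs_self (v.re - 1 / 2)
      simp
      linarith
    calc (d : ℝ) ^ (2 * v - 1).re ≤ (d : ℝ) ^ e :=
          Real.rpow_le_rpow_of_exponent_le (by exact_mod_cast hd0) hre
      _ ≤ _ := Real.rpow_le_rpow (by positivity) (by exact_mod_cast hdl) he0
  refine (norm_sum_le_of_le _ h).trans ?_
  rw [Finset.sum_const, nsmul_eq_mul, Real.rpow_add hl0 1 e, Real.rpow_one]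
  gcongr
  exact_mod_cast Nat.card_divisors_le_self l

/-- The terms of the convolution Dirichlet series. -/
def convolutionTerm (u v : ℂ) (l : ℕ+) : ℂ :=
  fourierCoeff f l * divisorSum (2 * v - 1) l / (l : ℂ) ^ (u + v + (k : ℂ) / 2 - 1)

/-- The bounds for the coefficients and divisor sums combine to the exponent `3/2 + |Re v - 1/2| -
Re u`; requiring it to be below `-1` gives the constant `5/2`. -/
lemma exists_norm_convolutionTerm_le (u : ℂ) {τ : ℝ} (hτ : τ < u.re - 5 / 2) :
    ∃ b : ℕ+ → ℝ, Summable b ∧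
      ∀ l, ∀ v : ℂ, |v.re - 1 / 2| ≤ τ → ‖convolutionTerm f u v l‖ ≤ b l := by
  obtain ⟨C, hC, hb⟩ := exists_norm_fourierCoeff_le f
  refine ⟨fun l => C * (l : ℝ) ^ (3 / 2 + τ - u.re),
    (summable_pnat_rpow (by linarith)).mul_left C, fun l v hv => ?_⟩
  have hl0 : (0 : ℝ) < ((l : ℕ) : ℝ) := by exact_mod_cast l.pos
  have hl1 : (1 : ℝ) ≤ ((l : ℕ) : ℝ) := by exact_mod_cast l.pos
  have hre : (u + v + (k : ℂ) / 2 - 1).re = u.re + v.re + k / 2 - 1 := by simp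
  rw [convolutionTerm, norm_div, norm_mul, Complex.norm_natCast_cpow_of_pos l.pos, hre,
    div_eq_mul_inv, ← Real.rpow_neg hl0.le]
  calc _ ≤ C * (l : ℝ) ^ ((k : ℝ) / 2) * (l : ℝ) ^ (1 + (|v.re - 1 / 2| + (v.re - 1 / 2))) *
        (l : ℝ) ^ (-(u.re + v.re + k / 2 - 1)) := by
        gcongr
        · exact hb l
        · exact norm_divisorSum_le v l.pos
    _ = C * (l : ℝ) ^ (3 / 2 + |v.re - 1 / 2| - u.re) := by
        rw [mul_assoc, mul_assoc, ← Real.rpow_add hl0, ← Real.rpow_add hl0]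
        congr 2
        ring
    _ ≤ _ := mul_le_mul_of_nonneg_left
        (Real.rpow_le_rpow_of_exponent_le hl1 (by linarith)) hC

lemma summable_convolutionTerm {u v : ℂ} (h : |v.re - 1 / 2| < u.re - 5 / 2) :
    Summable (convolutionTerm f u v) := by
  obtain ⟨b, hb, hle⟩ := exists_norm_convolutionTerm_le f u h
  exact hb.of_norm_bounded fun l => hle l v le_rfl

lemma differentiable_convolutionTerm (u : ℂ) (l : ℕ+) :
    Differentiable ℂ fun v => convolutionTerm f u v l := by
  have hl : ((l : ℕ) : ℂ) ≠ 0 := by exact_mod_cast l.pos.ne'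
  unfold convolutionTerm divisorSum
  refine Differentiable.div ?_ ?_ fun v => by simp [Complex.cpow_eq_zero_iff, hl]
  · refine Differentiable.const_mul (Differentiable.fun_sum fun d hd => ?_) _
    have hd : (d : ℂ) ≠ 0 := by exact_mod_cast (Nat.pos_of_mem_divisors hd).ne'
    exact Differentiable.const_cpow (by fun_prop) (Or.inl hd)
  · exact Differentiable.const_cpow (by fun_prop) (Or.inl hl)

lemma isOpen_abs_re_lt (τ : ℝ) : IsOpen {v : ℂ | |v.re - 1 / 2| < τ} :=
  isOpen_lt (by fun_prop) continuous_const

lemma differentiableOn_tsum_convolutionTerm (u : ℂ) :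
    DifferentiableOn ℂ (fun v => ∑' l, convolutionTerm f u v l)
      {v | |v.re - 1 / 2| < u.re - 5 / 2} := by
  intro v₀ hv₀
  obtain ⟨τ, h1, h2⟩ := exists_between (show |v₀.re - 1 / 2| < u.re - 5 / 2 from hv₀)
  obtain ⟨b, hb, hle⟩ := exists_norm_convolutionTerm_le f u h2
  have := Complex.differentiableOn_tsum_of_summable_norm hb
    (fun l => (differentiable_convolutionTerm f u l).differentiableOn) (isOpen_abs_re_lt τ)
    fun l v hv => hle l v (le_of_lt hv)
  exact (this.differentiableAt ((isOpen_abs_re_lt τ).mem_nhds h1)).differentiableWithinAt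

end DirichletSeries

/-! ### Constants, absolute convergence and the identity theorem -/

lemma pi_cpow_identity {u v w s : ℂ} {κ : ℂ} (hs : s = u - v + κ) (hw : w = u + v + κ - 1) :
    (Real.pi : ℂ) ^ (-u) * (Real.pi : ℂ) ^ (-v) * (2 * Real.pi : ℂ) ^ (2 * v) *
        (4 * Real.pi : ℂ) ^ (-w) * (2 * Real.pi : ℂ) ^ (s + w) = 2 * (Real.pi : ℂ) ^ κ := by
  have hpi : (Real.pi : ℂ) ≠ 0 := by exact_mod_cast Real.pi_ne_zero
  have h4 : (4 * Real.pi : ℂ) = ((2 : ℝ) : ℂ) * (((2 : ℝ) : ℂ) * Real.pi) := by push_cast; ring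
  have h2 : ∀ x : ℂ, (2 * Real.pi : ℂ) ^ x = 2 ^ x * (Real.pi : ℂ) ^ x := fun x => by
    have := Complex.mul_cpow_ofReal_nonneg (a := 2) (b := Real.pi) (by norm_num) Real.pi_pos.le x
    simpa using this
  have h4' : ∀ x : ℂ, (4 * Real.pi : ℂ) ^ x = 2 ^ x * (2 ^ x * (Real.pi : ℂ) ^ x) := fun x => by
    have := Complex.mul_cpow_ofReal_nonneg (a := 2) (b := 2 * Real.pi) (by norm_num)
      (by positivity) x
    rw [← h2, h4]
    simpa using this
  rw [h2, h2, h4']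
  have e1 : (2 : ℂ) ^ (2 * v) * 2 ^ (-w) * 2 ^ (-w) * 2 ^ (s + w) = 2 := by
    rw [← Complex.cpow_add _ _ two_ne_zero, ← Complex.cpow_add _ _ two_ne_zero,
      ← Complex.cpow_add _ _ two_ne_zero]
    convert Complex.cpow_one 2 using 2
    rw [hs, hw]
    ring
  have e2 : (Real.pi : ℂ) ^ (-u) * (Real.pi : ℂ) ^ (-v) * (Real.pi : ℂ) ^ (2 * v) *
      (Real.pi : ℂ) ^ (-w) * (Real.pi : ℂ) ^ (s + w) = (Real.pi : ℂ) ^ κ := by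
    rw [← Complex.cpow_add _ _ hpi, ← Complex.cpow_add _ _ hpi, ← Complex.cpow_add _ _ hpi,
      ← Complex.cpow_add _ _ hpi]
    congr 1
    rw [hs, hw]
    ring
  rw [← e2]
  linear_combination ((Real.pi : ℂ) ^ (-u) * (Real.pi : ℂ) ^ (-v) * (Real.pi : ℂ) ^ (2 * v) *
      (Real.pi : ℂ) ^ (-w) * (Real.pi : ℂ) ^ (s + w)) * e1

section Identity

variable {k : ℤ} (f : CuspForm 𝒮ℒ k)

/-- The gamma factors multiplying the convolution Dirichlet series. -/
def rankinFactor (k k₁ : ℤ) (m : ℕ) (u v : ℂ) : ℂ :=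
  (-1) ^ m * 2 * (Real.pi : ℂ) ^ ((k : ℂ) / 2) * riemannZeta (2 * u) *
    (Complex.Gamma (((|k₁| : ℤ) : ℂ) / 2 + u) / Complex.Gamma ((k₁ : ℂ) / 2 + u)) *
    (Complex.Gamma (u - v + (k : ℂ) / 2) * Complex.Gamma (u + v + (k : ℂ) / 2 - 1) /
      (2 * (Real.pi : ℂ)) ^ (u - v + (k : ℂ) / 2 + (u + v + (k : ℂ) / 2 - 1)))

lemma peterssonInner_eq_of_absolutely_convergent {k₁ : ℤ} (hk₁ : Even k₁) (m : ℕ)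
    (hk : k₁ + 2 * m = k) (hk0 : 0 ≤ k) {u v : ℂ} (hv : m + 1 < v.re) (huv : v.re < u.re - 2) :
    peterssonInner k f (eisensteinProduct k₁ (2 * m) (conj u) (conj v)) =
      rankinFactor k k₁ m u v * ∑' l, convolutionTerm f u v l := by
  have hm0 : (0 : ℝ) ≤ m := m.cast_nonneg
  have hk0' : (0 : ℝ) ≤ k := by exact_mod_cast hk0
  have hv1 : 1 < v.re := by linarith
  have hu1 : 1 < u.re := by linarith
  have hcongr : ∀ z, peterssonIntegrand k f (eisensteinProduct k₁ (2 * m) (conj u) (conj v)) z =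
      (1 / 2 * (Real.pi : ℂ) ^ (-u) * Complex.Gamma (u + ((|k₁| : ℤ) : ℂ) / 2)) *
      (1 / 2 * (Real.pi : ℂ) ^ (-v) * Complex.Gamma (v + m)) *
      (f z * (z.im : ℂ) ^ ((k : ℂ) / 2) * latticeSum (-k₁) u z * latticeSum (-(2 * m)) v z) := by
    intro z
    have habs : (((|2 * (m : ℤ)| : ℤ) : ℂ)) / 2 = m := by
      rw [abs_of_nonneg (by positivity)]
      push_cast
      ring
    rw [peterssonIntegrand_eq_mul_conj f hk, conj_completedEisenstein hk₁ z hu1,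
      conj_completedEisenstein (even_two_mul _) z hv1, habs]
    ring
  have hGv : Complex.Gamma (v + m) ≠ 0 := Complex.Gamma_ne_zero_of_re_pos (by simp; linarith)
  have hs : u - v + (k : ℂ) / 2 = (u + v + (k : ℂ) / 2 - 1) + 1 - 2 * v := by ring
  have h2pi : (2 * Real.pi : ℂ) ≠ 0 := by exact_mod_cast (by positivity : 2 * Real.pi ≠ 0)
  rw [peterssonInner, funext hcongr, integral_const_mul, integral_fd_latticeSum f hk₁ m hk hu1 hv1
    (by linarith) (by linarith), archIntegral_eq m hv (by simp; linarith) (by simp; linarith) hs,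
    rankinFactor]
  -- The gamma factor in the denominator of the archimedean integral loses its dependence on `v`;
  -- the other one, `Γ(v + m)`, cancels against the completion of `E_{k₂}`.
  have hk1 : v - m + (u - v + (k : ℂ) / 2) = (k₁ : ℂ) / 2 + u := by
    rw [← hk]
    push_cast
    ring
  rw [hk1, add_comm u (((|k₁| : ℤ) : ℂ) / 2), ← mul_assoc]
  congr 1
  have hid := pi_cpow_identity (u := u) (v := v) (κ := (k : ℂ) / 2) rfl rfl
  have hne : (2 * (Real.pi : ℂ)) ^ (u - v + (k : ℂ) / 2 + (u + v + (k : ℂ) / 2 - 1)) ≠ 0 := by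
    simp [Complex.cpow_eq_zero_iff, Real.pi_ne_zero]
  rw [← eq_div_iff hne] at hid
  calc _ = ((Real.pi : ℂ) ^ (-u) * (Real.pi : ℂ) ^ (-v) * (2 * Real.pi : ℂ) ^ (2 * v) *
        (4 * Real.pi : ℂ) ^ (-(u + v + (k : ℂ) / 2 - 1))) * (-1) ^ m * riemannZeta (2 * u) *
        (Complex.Gamma (((|k₁| : ℤ) : ℂ) / 2 + u) / Complex.Gamma ((k₁ : ℂ) / 2 + u)) *
        (Complex.Gamma (u - v + (k : ℂ) / 2) * Complex.Gamma (u + v + (k : ℂ) / 2 - 1)) *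
        (Complex.Gamma (v + m) / Complex.Gamma (v + m)) := by ring
    _ = _ := by
      rw [hid, div_self hGv]
      ring

lemma integrableOn_peterssonIntegrand {k₁ : ℤ} (hk₁ : Even k₁) (m : ℕ)
    (hk : k₁ + 2 * m = k) {u v : ℂ} (hu : 1 < u.re) (hv : m = 0 → v ≠ 0 ∧ v ≠ 1) :
    IntegrableOn (peterssonIntegrand k f (eisensteinProduct k₁ (2 * m) (conj u) (conj v))) 𝒟 := by
  rw [funext fun z => peterssonIntegrand_eq f hk₁ m hk hu hv z]
  simp_rw [mul_add]
  exact ((integrableOn_outerFactor_mul_conjTail f k₁ m hu v).add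
    (integrableOn_outerFactor_mul_conjTail f k₁ m hu (1 - v))).sub
    ((integrableOn_outerFactor f k₁ m hu).const_mul _)

lemma peterssonInner_eq_sub {k₁ : ℤ} (hk₁ : Even k₁) (m : ℕ)
    (hk : k₁ + 2 * m = k) {u v : ℂ} (hu : 1 < u.re) (hv : m = 0 → v ≠ 0 ∧ v ≠ 1) :
    peterssonInner k f (eisensteinProduct k₁ (2 * m) (conj u) (conj v)) =
      (∫ z in 𝒟, outerFactor f k₁ m u z * conjTail m z v) +
        (∫ z in 𝒟, outerFactor f k₁ m u z * conjTail m z (1 - v)) -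
        thetaConst m * (1 / v + 1 / (1 - v)) * ∫ z in 𝒟, outerFactor f k₁ m u z := by
  have h1 := integrableOn_outerFactor_mul_conjTail f k₁ m hu v
  have h2 := integrableOn_outerFactor_mul_conjTail f k₁ m hu (1 - v)
  rw [peterssonInner, funext fun z => peterssonIntegrand_eq f hk₁ m hk hu hv z]
  generalize thetaConst m * (1 / v + 1 / (1 - v)) = c
  simp_rw [mul_add]
  refine (integral_sub (h1.add h2) ((integrableOn_outerFactor f k₁ m hu).const_mul c)).trans ?_
  rw [integral_const_mul]
  congr 1
  exact integral_add h1 h2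

/-- The factor removing the poles at `0` and `1` of the Eisenstein series of weight `2 * m`. -/
def poleFactor (m : ℕ) (v : ℂ) : ℂ := if m = 0 then v * (1 - v) else 1

lemma poleFactor_ne_zero {m : ℕ} {v : ℂ} (hv : m = 0 → v ≠ 0 ∧ v ≠ 1) : poleFactor m v ≠ 0 := by
  unfold poleFactor
  split_ifs with h
  · exact mul_ne_zero (hv h).1 (sub_ne_zero.mpr (hv h).2.symm)
  · exact one_ne_zero

lemma differentiable_poleFactor (m : ℕ) : Differentiable ℂ (poleFactor m) := by
  unfold poleFactor
  split_ifs <;> fun_prop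

lemma poleFactor_mul_thetaConst {m : ℕ} {v : ℂ} (hv : m = 0 → v ≠ 0 ∧ v ≠ 1) :
    poleFactor m v * (thetaConst m * (1 / v + 1 / (1 - v))) = thetaConst m := by
  unfold poleFactor thetaConst
  split_ifs with h
  · have h0 := (hv h).1
    have h1 : 1 - v ≠ 0 := sub_ne_zero.mpr (hv h).2.symm
    field_simp
    ring
  · ring

/-- For `k ≥ 0` the arguments of the two `v`-dependent gamma factors have positive real part in this
strip, and `s + w` is independent of `v`. -/
lemma differentiableOn_rankinFactor (k₁ : ℤ) (m : ℕ) (hk0 : 0 ≤ k) (u : ℂ) :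
    DifferentiableOn ℂ (rankinFactor k k₁ m u) {v | |v.re - 1 / 2| < u.re - 5 / 2} := by
  intro v hv
  have hk0' : (0 : ℝ) ≤ k := by exact_mod_cast hk0
  obtain ⟨h1, h2⟩ := abs_lt.mp (show |v.re - 1 / 2| < u.re - 5 / 2 from hv)
  have hG : ∀ s : ℂ, 0 < s.re → DifferentiableAt ℂ Complex.Gamma s := fun s hs =>
    Complex.differentiableAt_Gamma s fun n h => by
      rw [h] at hs
      simp at hs
      linarith [(n.cast_nonneg : (0 : ℝ) ≤ n)]
  have hs := hG (u - v + (k : ℂ) / 2) (by simp; linarith)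
  have hw := hG (u + v + (k : ℂ) / 2 - 1) (by simp; linarith)
  have hexp : ∀ v : ℂ, u - v + (k : ℂ) / 2 + (u + v + (k : ℂ) / 2 - 1) = 2 * u + k - 1 :=
    fun v => by ring
  unfold rankinFactor
  simp_rw [hexp]
  refine (DifferentiableAt.const_mul (DifferentiableAt.div_const (DifferentiableAt.mul ?_ ?_) _)
    _).differentiableWithinAt
  · exact hs.comp v (f := fun v => u - v + (k : ℂ) / 2) (by fun_prop)
  · exact hw.comp v (f := fun v => u + v + (k : ℂ) / 2 - 1) (by fun_prop)

lemma isPreconnected_abs_re_lt (τ : ℝ) : IsPreconnected {v : ℂ | |v.re - 1 / 2| < τ} := by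
  refine Convex.isPreconnected ?_
  have : {v : ℂ | |v.re - 1 / 2| < τ} = Complex.reLm ⁻¹' Metric.ball (1 / 2) τ := by
    ext v
    simp [Real.dist_eq]
  rw [this]
  exact (convex_ball _ _).linear_preimage _

/-- Identity theorem in the convex strip `U`, started from the smaller strip of absolute
convergence. -/
theorem peterssonInner_eq {k₁ : ℤ} (hk₁ : Even k₁) (m : ℕ) (hk : k₁ + 2 * m = k) (hk0 : 0 ≤ k)
    {u v : ℂ} (hu : m + 7 / 2 < u.re) (huv : |v.re - 1 / 2| < u.re - 5 / 2)
    (hv : m = 0 → v ≠ 0 ∧ v ≠ 1) :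
    peterssonInner k f (eisensteinProduct k₁ (2 * m) (conj u) (conj v)) =
      rankinFactor k k₁ m u v * ∑' l, convolutionTerm f u v l := by
  have hm0 : (0 : ℝ) ≤ m := m.cast_nonneg
  have hu1 : 1 < u.re := by linarith
  set U := {v : ℂ | |v.re - 1 / 2| < u.re - 5 / 2}
  have hU : IsOpen U := isOpen_abs_re_lt _
  have hI := differentiable_integral_outerFactor_mul_conjTail f k₁ m hu1
  have hI' := hI.comp (differentiable_id.const_sub 1)
  -- Multiplying both sides by `poleFactor` makes them holomorphic on all of `U`, including `0` and
  -- `1`; here the polar terms are already multiplied out.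
  let P : ℂ → ℂ := fun v => poleFactor m v *
    ((∫ z in 𝒟, outerFactor f k₁ m u z * conjTail m z v) +
      (∫ z in 𝒟, outerFactor f k₁ m u z * conjTail m z (1 - v))) -
    thetaConst m * ∫ z in 𝒟, outerFactor f k₁ m u z
  let Q : ℂ → ℂ := fun v => poleFactor m v *
    (rankinFactor k k₁ m u v * ∑' l, convolutionTerm f u v l)
  have hP : DifferentiableOn ℂ P U :=
    (((differentiable_poleFactor m).mul (hI.add hI')).sub_const _).differentiableOn
  have hQ : DifferentiableOn ℂ Q U := (differentiable_poleFactor m).differentiableOn.mul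
    ((differentiableOn_rankinFactor k₁ m hk0 u).mul (differentiableOn_tsum_convolutionTerm f u))
  have hPv : ∀ v : ℂ, (m = 0 → v ≠ 0 ∧ v ≠ 1) → P v = poleFactor m v *
      peterssonInner k f (eisensteinProduct k₁ (2 * m) (conj u) (conj v)) := by
    intro v hv
    simp only [P]
    rw [peterssonInner_eq_sub f hk₁ m hk hu1 hv, mul_sub, ← mul_assoc,
      poleFactor_mul_thetaConst hv]
  -- The region of absolute convergence is nonempty because `Re u > m + 7/2`; a real point of it
  -- serves as base point.
  obtain ⟨x, hx1, hx2⟩ := exists_between (show (m : ℝ) + 1 < u.re - 2 by linarith)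
  have hW : {v : ℂ | (m : ℝ) + 1 < v.re ∧ v.re < u.re - 2} ∈ nhds (x : ℂ) :=
    ((isOpen_lt continuous_const Complex.continuous_re).inter
      (isOpen_lt Complex.continuous_re continuous_const)).mem_nhds (by simp [hx1, hx2])
  have hxU : (x : ℂ) ∈ U := by
    simp only [U, Set.mem_ofPred_eq, Complex.ofReal_re]
    rw [abs_lt]
    constructor <;> linarith
  have hPQ : Set.EqOn P Q U := by
    refine (hP.analyticOnNhd hU).eqOn_of_preconnected_of_eventuallyEq (hQ.analyticOnNhd hU)
      (isPreconnected_abs_re_lt _) hxU ?_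
    filter_upwards [hW] with v ⟨h1, h2⟩
    have hv : m = 0 → v ≠ 0 ∧ v ≠ 1 := fun _ => by
      constructor <;> rintro rfl <;> simp at h1 <;> linarith
    rw [hPv v hv, peterssonInner_eq_of_absolutely_convergent f hk₁ m hk hk0 h1 h2]
  have := hPQ huv
  rw [hPv v hv] at this
  exact mul_left_cancel₀ (poleFactor_ne_zero hv) this

end Identity

end RankinEisenstein

end

theorem proposition9p1 (k k₁ k₂ : ℤ) (f : CuspForm 𝒮ℒ k)
    (hk₁ : Even k₁) (hk₂ : Even k₂) (hk : k₁ + k₂ = k) (hk₂0 : 0 ≤ k₂)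
    (u v : ℂ)
    (hleft : -u.re - (k : ℝ) / 2 + 1 / 2 < |v.re - 1 / 2|)
    (hright : |v.re - 1 / 2| < u.re - (k₂ : ℝ) / 2 - 7 / 2)
    -- for `k₂ = 0` the points `v = 0, 1` are poles of the Eisenstein series
    (hpole : k₂ = 0 → v ≠ 0 ∧ v ≠ 1)
    (s w : ℂ) (hs : s = u - v + (k : ℂ) / 2) (hw : w = u + v + (k : ℂ) / 2 - 1) :
    -- the integral defining the inner product converges absolutely
    IntegrableOn (RankinEisenstein.peterssonIntegrand k f
      (RankinEisenstein.eisensteinProduct k₁ k₂ (conj u) (conj v))) 𝒟 ∧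
    -- the Dirichlet series converges absolutely
    Summable (fun n : ℕ+ => (qExpansion 1 f).coeff (n : ℕ) *
      RankinEisenstein.divisorSum (2 * v - 1) n / (n : ℂ) ^ w) ∧
    RankinEisenstein.peterssonInner k f
        (RankinEisenstein.eisensteinProduct k₁ k₂ (conj u) (conj v)) =
      ((-1 : ℂ) ^ (k₂ / 2) * 2 * (Real.pi : ℂ) ^ ((k : ℂ) / 2) * riemannZeta (2 * u) *
        (Complex.Gamma (((|k₁| : ℤ) : ℂ) / 2 + u) / Complex.Gamma ((k₁ : ℂ) / 2 + u)) *
        (Complex.Gamma s * Complex.Gamma w / (2 * (Real.pi : ℂ)) ^ (s + w))) *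
      ∑' n : ℕ+, (qExpansion 1 f).coeff (n : ℕ) *
        RankinEisenstein.divisorSum (2 * v - 1) n / (n : ℂ) ^ w := by
  obtain ⟨j, hj⟩ := even_iff_exists_two_mul.mp hk₂
  lift j to ℕ using by lia with m
  subst hj
  have hm0 : (0 : ℝ) ≤ m := m.cast_nonneg
  have hdiv : (2 * (m : ℤ)) / 2 = m := by lia
  have hm : ((2 * (m : ℤ) : ℤ) : ℝ) / 2 = m := by push_cast; ring
  rw [hm] at hright
  have hu : m + 7 / 2 < u.re := by linarith [abs_nonneg (v.re - 1 / 2)]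
  have huv : |v.re - 1 / 2| < u.re - 5 / 2 := by linarith
  have hv : m = 0 → v ≠ 0 ∧ v ≠ 1 := fun h => hpole (by lia)
  subst hs hw
  refine ⟨RankinEisenstein.integrableOn_peterssonIntegrand f hk₁ m hk (by linarith) hv,
    RankinEisenstein.summable_convolutionTerm f huv, ?_⟩
  -- In negative weight the space of cusp forms is zero and both sides vanish.
  rcases lt_or_ge k 0 with hk0 | hk0
  · have := rank_zero_iff.mp (CuspForm.rank_eq_zero_of_weight_lt_twelve (hk0.trans (by norm_num)))
    have hf : f = 0 := Subsingleton.elim _ _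
    simp [hf, RankinEisenstein.peterssonInner, RankinEisenstein.peterssonIntegrand,
      UpperHalfPlane.qExpansion_zero]
  · rw [hdiv, zpow_natCast]
    exact RankinEisenstein.peterssonInner_eq f hk₁ m hk hk0 hu huv hv
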